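/- Conventions. A monoid is a commutative cancellative semigroup with identity, and $\mathbb N_0=\{0,1,2,\dots\}$. For a monoid $H$, let $H^\times$ be its unit group, $H_{\mathrm{red}}=H/H^\times$, and $\mathcal A(H_{\mathrm{red}})$ the set of atoms of $H_{\mathrm{red}}$. Let $\mathsf Z(H)=\mathcal F(\mathcal A(H_{\mathrm{red}}))$ be the free abelian monoid over these atoms, with length function $|\cdot|$, and let $\pi\colon \mathsf Z(H)\to H_{\mathrm{red}}$ be the homomorphism mapping a formal product of atoms to its product. For $a\in H$ put $\mathsf Z(a)=\pi^{-1}(aH^\times)$ and $\mathsf L(a)=\{|z| : z\in\mathsf Z(a)\}$. - $\daleth(H)=\sup\{\min(\mathsf L(a)\setminus\{2\}) : a\in H,\ 2\in \mathsf L(a),\ \mathsf L(a)\ne\{2\}\}$. - For $z,z'\in \mathsf Z(H)$ let $\mathsf d(z,z')=\max\{|z\gcd(z,z')^{-1}|,\,|z'\gcd(z,z')^{-1}|\}$. For $a\in H$, $\mathsf c(a)$ is the smallest $N\in\mathbb N_0\cup\{\infty\}$ such that for all $z,z'\in\mathsf Z(a)$ there are $z=z_0,z_1,\dots,z_k=z'$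 in $\mathsf Z(a)$ with $\mathsf d(z_{i-1},z_i)\le N$ for all $i\in\{1,\dots,k\}$. The catenary degree of $H$ is $\mathsf c(H)=\sup\{\mathsf c(a): a\in H\}$. - A divisor theory of $H$ is a monoid homomorphism $\varphi\colon H\to\mathcal F(P)$ into the free abelian monoid over a set $P$ such that $\varphi(a)\mid\varphi(b)$ implies $a\mid b$ for all $a,b\in H$, and such that every $p\in P$ is the greatest common divisor of $\varphi(E)$ for some finite set $E\subset H$. A monoid is a Krull monoid if it has a divisor theory $\varphi$; its class group, which does not depend on the choice of $\varphi$ up to isomorphism, is the quotient group $G=\mathsf q(\mathcal F(P))/\mathsf q(\varphi(H))$. A class $g\in G$ contains a prime divisor if $g$ is the class of some $p\in P$. - The Davenport constant $\mathsf D(G)$ of an abelian group $G$ is the supremum of the lengths of the minimal zero-sum sequences over $G$. Here a sequence is a finite unordered sequence with repetition allowed, and it is minimal zero-sum if it is nonempty, has sum $0$, and no nonempty proper subsequence has sum $0$. Let $C_n$ denote a cyclic group of order $n$. **Theorem 1.1.** Let $H$ be a Krull monoid with finite class group $G$, where $|G|\ge 3$ and every class contains a prime divisor. Then the following statements are equivalent: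 (a) $\mathsf c(H)=\mathsf D(G)-1$. (b) $\daleth(H)=\mathsf D(G)-1$. (c) $G\cong C_2^{\,r-1}\oplus C_4$ for some $r\ge 2$, or $G\cong C_2\oplus C_{2n}$ for some $n\ge 2$. -/

import Mathlib

/-! Monoids are commutative and cancellative (`CancelCommMonoid`). The free abelian monoid `F(P)` is
`Multiplicative (P →₀ ℕ)` and its quotient group is `P →₀ ℤ`, written additively. -/

namespace KrullMonoid

section Factorizations

variable (H : Type*) [CancelCommMonoid H]

/-- The atoms of the reduced monoid `H_red = H / Hˣ`. -/
abbrev Atom : Type _ := {u : Associates H // Irreducible u}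

/-- The factorization monoid `Z(H)`, the free abelian monoid over the atoms of `H_red`; its elements
are finite multisets of atoms, and the monoid operation is addition of multisets. -/
abbrev FactorizationMonoid : Type _ := Multiset (Atom H)

variable {H}

/-- The factorization homomorphism `π : Z(H) → H_red`, taking a formal product of atoms to its
product. -/
def factorizationHom (z : FactorizationMonoid H) : Associates H :=
  (z.map Subtype.val).prod

/-- The set `Z(a)` of factorizations of `a`. -/
def factorizations (a : H) : Set (FactorizationMonoid H) :=
  {z | factorizationHom z = Associates.mk a}

/-- The set of lengths `L(a)`. -/
def setOfLengths (a : H) : Set ℕ :=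
  Multiset.card '' factorizations a

variable (H) in
/-- The system of sets of lengths `𝓛(H)`. -/
def systemOfSetsOfLengths : Set (Set ℕ) :=
  Set.range (setOfLengths : H → Set ℕ)

variable (H) in
/-- The invariant `ℸ(H) = sup {min (L \ {2}) | 2 ∈ L ∈ 𝓛(H)}`. The sets `L = {2}`, for which
`L \ {2}` has no minimum, contribute nothing. -/
noncomputable def daleth : ℕ∞ :=
  sSup {x : ℕ∞ | ∃ L ∈ systemOfSetsOfLengths H, 2 ∈ L ∧ ∃ m : ℕ, IsLeast (L \ {2}) m ∧ x = m}

open Classical in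
/-- The distance `d(z, z') = max {|z gcd(z, z')⁻¹|, |z' gcd(z, z')⁻¹|}` of two factorizations; the
greatest common divisor in the free abelian monoid is the intersection of multisets. -/
noncomputable def factorizationDist (z z' : FactorizationMonoid H) : ℕ :=
  max (Multiset.card (z - z ∩ z')) (Multiset.card (z' - z ∩ z'))

/-- The factorizations `z` and `z'` of `a` can be concatenated by an `N`-chain of factorizations
of `a`. -/
def ChainConnected (a : H) (N : ℕ∞) (z z' : FactorizationMonoid H) : Prop :=
  ∃ (k : ℕ) (c : ℕ → FactorizationMonoid H), c 0 = z ∧ c k = z' ∧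
    (∀ i ≤ k, c i ∈ factorizations a) ∧
    ∀ i < k, (factorizationDist (c i) (c (i + 1)) : ℕ∞) ≤ N

/-- The catenary degree `c(a)` of an element. -/
noncomputable def catenaryDegreeAt (a : H) : ℕ∞ :=
  sInf {N : ℕ∞ | ∀ z ∈ factorizations a, ∀ z' ∈ factorizations a, ChainConnected a N z z'}

variable (H) in
/-- The catenary degree `c(H)` of the monoid. -/
noncomputable def catenaryDegree : ℕ∞ :=
  ⨆ a : H, catenaryDegreeAt a

end Factorizations

section DivisorTheory

variable {H : Type*} [CancelCommMonoid H] {P : Type*}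

/-- A monoid homomorphism `φ` is a divisor homomorphism if `φ a ∣ φ b` implies `a ∣ b`. -/
def IsDivisorHom {F : Type*} [CommMonoid F] (φ : H →* F) : Prop :=
  ∀ a b : H, φ a ∣ φ b → a ∣ b

/-- The prime `p ∈ P` as an element of the free abelian monoid `F(P)`. -/
noncomputable def primeElt (p : P) : Multiplicative (P →₀ ℕ) :=
  Multiplicative.ofAdd (Finsupp.single p 1)

/-- `φ : H → F(P)` is a divisor theory: a divisor homomorphism such that every `p ∈ P` is the
greatest common divisor of `φ(E)` for some finite set `E ⊆ H`. A monoid is a Krull monoid if and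
only if it has a divisor theory. -/
structure IsDivisorTheory (φ : H →* Multiplicative (P →₀ ℕ)) : Prop where
  isDivisorHom : IsDivisorHom φ
  exists_gcd : ∀ p : P, ∃ E : Finset H, ∀ d : Multiplicative (P →₀ ℕ),
    d ∣ primeElt p ↔ ∀ a ∈ E, d ∣ φ a

/-- The embedding of the free abelian monoid `F(P)` into its quotient group `P →₀ ℤ`. -/
noncomputable def toQuotientGroup (x : Multiplicative (P →₀ ℕ)) : P →₀ ℤ :=
  Finsupp.mapRange (fun n : ℕ => (n : ℤ)) Nat.cast_zero (Multiplicative.toAdd x)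

/-- The quotient group of `φ(H)`, i.e. the subgroup of the quotient group of `F(P)` that `φ(H)`
generates. -/
noncomputable def principalSubgroup (φ : H →* Multiplicative (P →₀ ℕ)) : AddSubgroup (P →₀ ℤ) :=
  AddSubgroup.closure (Set.range fun a : H => toQuotientGroup (φ a))

/-- The class group `C(φ) = q(F(P)) / q(φ(H))`, written additively. For a divisor theory `φ` this
is the class group of the Krull monoid `H`. -/
abbrev ClassGroup (φ : H →* Multiplicative (P →₀ ℕ)) : Type _ :=
  (P →₀ ℤ) ⧸ principalSubgroup φ

/-- Every class contains a prime divisor. -/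
def EveryClassContainsPrime (φ : H →* Multiplicative (P →₀ ℕ)) : Prop :=
  ∀ g : ClassGroup φ, ∃ p : P,
    (QuotientAddGroup.mk (toQuotientGroup (primeElt p)) : ClassGroup φ) = g

end DivisorTheory

section Davenport

variable {G : Type*} [AddCommGroup G]

/-- `S` is a minimal zero-sum sequence over `G` (a sequence is a finite multiset): it is a nonempty
zero-sum sequence and no proper nonempty subsequence has sum zero. -/
def IsMinimalZeroSum (S : Multiset G) : Prop :=
  S ≠ 0 ∧ S.sum = 0 ∧ ∀ T ≤ S, T ≠ 0 → T.sum = 0 → T = S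

variable (G) in
/-- The Davenport constant `D(G)`, the supremum of the lengths of the minimal zero-sum sequences
over `G`. -/
noncomputable def davenportConstant : ℕ∞ :=
  sSup {x : ℕ∞ | ∃ S : Multiset G, IsMinimalZeroSum S ∧ x = Multiset.card S}

end Davenport

end KrullMonoid

/-! Write `G` for the class group and `D` for its Davenport constant. Replacing primes by their
classes turns factorizations in `H` into decompositions of zero-sum sequences over `G` into minimal
ones (`IsDivisorHom.irreducible_iff`, `IsDivisorHom.mem_setOfLengths_iff`). Call `m ≥ 3` a daleth
value (`IsDalethValue`) if for some minimal zero-sum `U`, `V` the product `U(-V)` decomposes into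
`m` factors and every decomposition has length 2 or at least `m`. Then `ℸ(H)` is the supremum of the
daleth values. Each of them is at most the catenary degree (`IsDivisorHom.le_catenaryDegree`), and
the catenary degree is at most any `N ≥ 2` that bounds them and satisfies `2N ≥ D + 1`
(`IsDivisorHom.catenaryDegree_le`). Once `D ≥ 5`, this applies to `N = D - 2`, so (a) and (b) both
say that `D - 1` is a daleth value and `D` is not.

Two opposing facts determine the groups. A factor in a decomposition of `U(-V)` has length at least
3 unless it is `x(-x)`, which uses up a common element; so `n` factors need `3n ≤ |U| + |V| + |U ∩
V|` (`PairFactorization.three_mul_le`). A large daleth value thus forces `U` and `V` to be long and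
nearly equal, and allows very few equalities between subsums of `U` and of `V`
(`LengthGap.dichotomy`). But the subsums of a zero-sum free sequence of length `D - 1` cover `G`
(`LengthBound.exists_sum_eq`), which produces many such equalities. For the value `D` the outcome is
that `G` is cyclic or an elementary 2-group (`LengthGap.cyclic_or_elementary`); for `D - 1` it is
that `2G` has at most two elements or that `G` is generated by some `g` and some `t` with `2t = 0`
(`LengthGap.doublingLeTwo_or_cyclicByTwo`). Cyclic groups and elementary 2-groups do attain `D`, and
every group with `D ≤ 4` is one of them; discarding them leaves the groups in (c).

For the converse, a minimal zero-sum sequence whose subsums are distinct apart from complementary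
pairs (`AlmostDissociated`) makes its own length a daleth value. Such sequences of length at least
`D - 1` are `g^(2n)` in `C_2 ⊕ C_2n` and `f² e_1 ⋯ e_(r-1) (2f + ∑ e_i)` in `C_2^(r-1) ⊕ C_4`. The
required upper bounds for `D` come from a quotient of order four (`lengthBound_of_ker`) and from
nilpotent ideals in the group ring over the field with two elements (`lengthBound_of_closure`). -/

namespace KrullMonoid

/-! ### Zero-sum free sequences, decompositions of `A + (-B)`, and the basic length inequality. -/

section ZeroSum

variable {G : Type*} [AddCommGroup G]

/-- A sequence is zero-sum free if it has no nonempty subsequence with sum zero. -/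
def ZeroSumFree (S : Multiset G) : Prop :=
  ∀ T ≤ S, T.sum = 0 → T = 0

theorem exists_add_of_le_add {α : Type*} [DecidableEq α] {W X Y : Multiset α} (h : W ≤ X + Y) :
    ∃ W₁ W₂, W₁ ≤ X ∧ W₂ ≤ Y ∧ W = W₁ + W₂ := by
  refine ⟨W ∩ X, W - X, Multiset.inter_le_right, ?_, ?_⟩
  · rw [tsub_le_iff_left]; exact h
  · ext a; simp only [Multiset.count_add, Multiset.count_inter, Multiset.count_sub]; omega

theorem exists_le_map {α β : Type*} {f : α → β} {T : Multiset β} {M : Multiset α}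
    (h : T ≤ M.map f) : ∃ N ≤ M, N.map f = T := by
  classical
  induction M using Multiset.induction generalizing T with
  | empty => exact ⟨0, le_rfl, by simpa [eq_comm] using h⟩
  | cons a M ih =>
    rw [Multiset.map_cons] at h
    by_cases ha : f a ∈ T
    · obtain ⟨T', rfl⟩ := Multiset.exists_cons_of_mem ha
      obtain ⟨N, hN, rfl⟩ := ih ((Multiset.cons_le_cons_iff _).1 h)
      exact ⟨a ::ₘ N, (Multiset.cons_le_cons_iff _).2 hN, by simp⟩
    · obtain ⟨N, hN, rfl⟩ := ih ((Multiset.le_cons_of_notMem ha).1 h)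
      exact ⟨N, hN.trans (Multiset.le_cons_self _ _), rfl⟩

theorem ZeroSumFree.mono {S T : Multiset G} (hS : ZeroSumFree S) (h : T ≤ S) : ZeroSumFree T :=
  fun R hR => hS R (hR.trans h)

theorem IsMinimalZeroSum.eq_or {U T : Multiset G} (hU : IsMinimalZeroSum U) (hT : T ≤ U)
    (h0 : T.sum = 0) : T = 0 ∨ T = U := by
  by_cases h : T = 0
  · exact Or.inl h
  · exact Or.inr (hU.2.2 T hT h h0)

theorem IsMinimalZeroSum.eq_zero_of_card_lt {U T : Multiset G} (hU : IsMinimalZeroSum U)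
    (hT : T ≤ U) (h0 : T.sum = 0) (hc : T.card < U.card) : T = 0 := by
  rcases hU.eq_or hT h0 with h | h
  · exact h
  · subst h; omega

theorem IsMinimalZeroSum.zeroSumFree_of_cons {U : Multiset G} {a : G}
    (hU : IsMinimalZeroSum (a ::ₘ U)) : ZeroSumFree U := fun T hT h0 =>
  hU.eq_zero_of_card_lt (hT.trans (Multiset.le_cons_self _ _)) h0
    (by have := Multiset.card_le_card hT; simp; omega)

theorem IsMinimalZeroSum.zeroSumFree_of_lt {U S : Multiset G}
    (hU : IsMinimalZeroSum U) (hS : S ≤ U) (hc : S.card < U.card) : ZeroSumFree S := fun _ hT h0 =>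
  hU.eq_zero_of_card_lt (hT.trans hS) h0 ((Multiset.card_le_card hT).trans_lt hc)

/-- A zero-sum subsequence containing the new element leaves a complement inside `S` with sum zero,
which must be empty. Hence a bound `D` for minimal zero-sum sequences bounds zero-sum free ones by
`D - 1`. -/
theorem ZeroSumFree.cons_neg_sum {S : Multiset G} (hS : ZeroSumFree S) :
    IsMinimalZeroSum ((-S.sum) ::ₘ S) := by
  classical
  refine ⟨Multiset.cons_ne_zero, by simp, fun T hT hT0 h0 => ?_⟩
  by_cases hm : -S.sum ∈ T
  · obtain ⟨T', rfl⟩ := Multiset.exists_cons_of_mem hm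
    have hT' := (Multiset.cons_le_cons_iff _).1 hT
    obtain ⟨R, rfl⟩ := Multiset.le_iff_exists_add.1 hT'
    have : R.sum = 0 := by
      simp only [Multiset.sum_cons, Multiset.sum_add] at h0
      have : -R.sum = 0 := by rw [← h0]; abel
      simpa using this
    rw [hS R (Multiset.le_add_left _ _) this]; simp
  · exact absurd (hS T ((Multiset.le_cons_of_notMem hm).1 hT) h0) hT0

/-- An upper bound for the lengths of the minimal zero-sum sequences over `G`. -/
def LengthBound (G : Type*) [AddCommGroup G] (D : ℕ) : Prop :=
  ∀ U : Multiset G, IsMinimalZeroSum U → U.card ≤ D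

variable {D : ℕ}

theorem LengthBound.card_lt (hD : LengthBound G D) {S : Multiset G} (hS : ZeroSumFree S) :
    S.card < D := by
  have := hD _ hS.cons_neg_sum
  simp at this; omega

/-- The subsums of a zero-sum free sequence of maximal length cover the group. -/
theorem LengthBound.exists_sum_eq (hD : LengthBound G D) {S : Multiset G} (hS : ZeroSumFree S)
    (hc : D ≤ S.card + 1) (x : G) : ∃ T ≤ S, T.sum = x := by
  classical
  -- Maximality of the length means that adjoining `-x` creates a zero-sum subsequence, whose other
  -- terms sum to `x`.
  by_cases hx : ZeroSumFree (-x ::ₘ S)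
  · have := hD.card_lt hx
    simp at this; omega
  · simp only [ZeroSumFree, not_forall] at hx
    obtain ⟨T, hT, h0, hT0⟩ := hx
    by_cases hm : -x ∈ T
    · obtain ⟨T', rfl⟩ := Multiset.exists_cons_of_mem hm
      refine ⟨T', (Multiset.cons_le_cons_iff _).1 hT, ?_⟩
      rw [Multiset.sum_cons] at h0
      exact (neg_add_eq_zero.1 h0).symm
    · exact absurd (hS T ((Multiset.le_cons_of_notMem hm).1 hT) h0) hT0

theorem LengthBound.exists_sum_eq_erase [DecidableEq G] (hD : LengthBound G D) {U : Multiset G}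
    (hU : IsMinimalZeroSum U) (hc : D ≤ U.card) {h : G} (hh : h ∈ U) (x : G) :
    ∃ T ≤ U.erase h, T.sum = x := by
  have h1 := Multiset.card_erase_add_one hh
  exact hD.exists_sum_eq (hU.zeroSumFree_of_lt (Multiset.erase_le _ _) (by omega)) (by omega) x

/-- Every element is a subsum, over a subsequence that contains a prescribed element, of a minimal
zero-sum sequence of maximal length. -/
theorem LengthBound.exists_mem_sum_eq (hD : LengthBound G D) {U : Multiset G}
    (hU : IsMinimalZeroSum U) (hc : D ≤ U.card) {h : G} (hh : h ∈ U) (x : G) :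
    ∃ T ≤ U, h ∈ T ∧ T.sum = x := by
  classical
  obtain ⟨T, hT, hx⟩ := hD.exists_sum_eq_erase hU hc hh (x - h)
  refine ⟨h ::ₘ T, ?_, Multiset.mem_cons_self _ _, by simp [hx]⟩
  rw [← Multiset.cons_erase hh]
  exact (Multiset.cons_le_cons_iff _).2 hT

/-- `S` is a sum of `n` minimal zero-sum sequences. -/
inductive HasFactorization : Multiset G → ℕ → Prop
  | zero : HasFactorization 0 0
  | cons {W S : Multiset G} {n : ℕ} : IsMinimalZeroSum W → HasFactorization S n →
      HasFactorization (W + S) (n + 1)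

/-- The sequence `A + (-B)` is a sum of `n` minimal zero-sum sequences, each one with a specified
part in `A` and in `-B`. -/
inductive PairFactorization : Multiset G → Multiset G → ℕ → Prop
  | zero : PairFactorization 0 0 0
  | cons {X Y A B : Multiset G} {n : ℕ} : IsMinimalZeroSum (X + Y.map Neg.neg) →
      PairFactorization A B n → PairFactorization (X + A) (Y + B) (n + 1)

theorem PairFactorization.add {A B A' B' : Multiset G} {n n' : ℕ} (h : PairFactorization A B n)
    (h' : PairFactorization A' B' n') : PairFactorization (A + A') (B + B') (n + n') := by
  induction h with
  | zero => simpa using h'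
  | cons hW _ ih =>
    rw [add_assoc, add_assoc, add_right_comm]
    exact .cons hW ih

theorem PairFactorization.single {X Y : Multiset G} (h : IsMinimalZeroSum (X + Y.map Neg.neg)) :
    PairFactorization X Y 1 := by
  simpa using PairFactorization.cons h .zero

theorem PairFactorization.hasFactorization {A B : Multiset G} {n : ℕ}
    (h : PairFactorization A B n) : HasFactorization (A + B.map Neg.neg) n := by
  induction h with
  | zero => simpa using HasFactorization.zero
  | cons hW _ ih =>
    rw [Multiset.map_add, add_add_add_comm]
    exact .cons hW ih

theorem sum_map_neg_eq (B : Multiset G) : (B.map Neg.neg).sum = -B.sum := by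
  induction B using Multiset.induction with
  | empty => simp
  | cons a B ih => rw [Multiset.map_cons, Multiset.sum_cons, ih, Multiset.sum_cons, neg_add]

/-- Each factor is a subsequence of `A + (-B)` and can be cut into a part from `A` and a part from
`-B`. The cut need not be unique when `A` and `-B` share elements, but any choice works. -/
theorem HasFactorization.pairFactorization {S : Multiset G} {n : ℕ} (h : HasFactorization S n) :
    ∀ A B : Multiset G, S = A + B.map Neg.neg → PairFactorization A B n := by
  classical
  induction h with
  | zero =>
    intro A B h
    obtain ⟨rfl, hB⟩ := (add_eq_zero.1 h.symm)
    rw [Multiset.map_eq_zero] at hB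
    subst hB; exact .zero
  | @cons W S n hW _ ih =>
    intro A B h
    obtain ⟨X, Y, hX, hY, rfl⟩ := exists_add_of_le_add (h ▸ Multiset.le_add_right W S)
    obtain ⟨A', rfl⟩ := Multiset.le_iff_exists_add.1 hX
    obtain ⟨Y', hY', rfl⟩ := exists_le_map hY
    obtain ⟨B', rfl⟩ := Multiset.le_iff_exists_add.1 hY'
    refine .cons hW (ih A' B' ?_)
    rw [Multiset.map_add, add_add_add_comm] at h
    exact add_left_cancel h

theorem exists_isMinimalZeroSum_le {S : Multiset G} (hS : S ≠ 0) (h0 : S.sum = 0) :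
    ∃ W ≤ S, IsMinimalZeroSum W := by
  induction' hn : S.card using Nat.strong_induction_on with n ih generalizing S
  by_cases h : IsMinimalZeroSum S
  · exact ⟨S, le_rfl, h⟩
  · simp only [IsMinimalZeroSum, not_and, not_forall] at h
    obtain ⟨T, hT, hT0, hs, hne⟩ := h hS h0
    obtain ⟨W, hW, hm⟩ := ih T.card (hn ▸ Multiset.card_lt_card (lt_of_le_of_ne hT hne)) hT0 hs rfl
    exact ⟨W, hW.trans hT, hm⟩

theorem HasFactorization.sum_eq {S : Multiset G} {n : ℕ} (h : HasFactorization S n) :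
    S.sum = 0 := by
  induction h with
  | zero => simp
  | cons hW _ ih => rw [Multiset.sum_add, hW.2.1, ih, add_zero]

theorem HasFactorization.eq_zero {S : Multiset G} (h : HasFactorization S 0) : S = 0 := by
  cases h; rfl

theorem exists_hasFactorization {S : Multiset G} (h0 : S.sum = 0) :
    ∃ n, HasFactorization S n := by
  induction' hn : S.card using Nat.strong_induction_on with n ih generalizing S
  by_cases hS : S = 0
  · exact ⟨0, hS ▸ .zero⟩
  · obtain ⟨W, hW, hm⟩ := exists_isMinimalZeroSum_le hS h0
    obtain ⟨R, rfl⟩ := Multiset.le_iff_exists_add.1 hW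
    have : 0 < W.card := Multiset.card_pos.2 hm.1
    obtain ⟨k, hk⟩ := ih R.card (by simp at hn; omega)
      (by rw [Multiset.sum_add, hm.2.1, zero_add] at h0; exact h0) rfl
    exact ⟨_, .cons hm hk⟩

theorem exists_pairFactorization {A B : Multiset G} (h : A.sum = B.sum) :
    ∃ n, PairFactorization A B n := by
  obtain ⟨n, hn⟩ := exists_hasFactorization (S := A + B.map Neg.neg)
    (by rw [Multiset.sum_add, sum_map_neg_eq, h, add_neg_cancel])
  exact ⟨n, hn.pairFactorization A B rfl⟩

theorem PairFactorization.eq_zero {A B : Multiset G} (h : PairFactorization A B 0) :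
    A = 0 ∧ B = 0 := by
  cases h; exact ⟨rfl, rfl⟩

theorem exists_pairFactorization_pos {A B : Multiset G} (h : A.sum = B.sum)
    (hne : A ≠ 0 ∨ B ≠ 0) : ∃ n, 1 ≤ n ∧ PairFactorization A B n := by
  obtain ⟨n, hn⟩ := exists_pairFactorization h
  refine ⟨n, Nat.one_le_iff_ne_zero.2 ?_, hn⟩
  rintro rfl
  have := hn.eq_zero
  tauto

/-- The sequence `A + (-B)` contains two disjoint nonempty zero-sum sequences or is minimal. -/
theorem exists_two_le_pairFactorization {A B : Multiset G} (h : A.sum = B.sum)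
    (hne : A ≠ 0 ∨ B ≠ 0) (hW : ¬ IsMinimalZeroSum (A + B.map Neg.neg)) :
    ∃ n, 2 ≤ n ∧ PairFactorization A B n := by
  obtain ⟨n, h1, hn⟩ := exists_pairFactorization_pos h hne
  refine ⟨n, ?_, hn⟩
  by_contra hlt
  obtain rfl : n = 1 := by omega
  have := hn.hasFactorization
  generalize hS : A + B.map Neg.neg = S at this hW
  cases this with
  | cons hW' h' => rw [h'.eq_zero, add_zero] at hW; exact hW hW'

/-- No two elements of `A`, and no single one, have sum zero. -/
def NoShortZeroSum (A : Multiset G) : Prop := ∀ T ≤ A, T.sum = 0 → 3 ≤ T.card ∨ T = 0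

theorem NoShortZeroSum.mono {A B : Multiset G} (h : NoShortZeroSum B) (hA : A ≤ B) :
    NoShortZeroSum A := fun T hT => h T (hT.trans hA)

theorem IsMinimalZeroSum.noShortZeroSum {U : Multiset G} (hU : IsMinimalZeroSum U)
    (hc : 3 ≤ U.card) : NoShortZeroSum U := fun T hT h0 => by
  rcases hU.eq_or hT h0 with h | rfl
  · exact Or.inr h
  · exact Or.inl hc

/-- Every factor `X + (-Y)` contributes at least 3 to the right-hand side: either it has length at
least 3, or it is `x, -x`, where the common element `x` supplies the missing unit. This inequality
drives all the counting below. -/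
theorem PairFactorization.three_mul_le [DecidableEq G] {A B : Multiset G} {n : ℕ}
    (h : PairFactorization A B n) (hA : NoShortZeroSum A) (hB : NoShortZeroSum B) :
    3 * n ≤ A.card + B.card + (A ∩ B).card := by
  induction h with
  | zero => simp
  | @cons X Y A B n hW h ih =>
    have ih := ih (hA.mono (Multiset.le_add_left _ _)) (hB.mono (Multiset.le_add_left _ _))
    have hle : X ∩ Y + A ∩ B ≤ (X + A) ∩ (Y + B) := by
      rw [Multiset.le_iff_count]
      intro a
      simp only [Multiset.count_add, Multiset.count_inter]; omega
    have hle := Multiset.card_le_card hle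
    simp only [Multiset.card_add] at hle ⊢
    suffices 3 ≤ X.card + Y.card + (X ∩ Y).card by omega
    have hs : X.sum = Y.sum := by
      have := hW.2.1
      rwa [Multiset.sum_add, sum_map_neg_eq, add_neg_eq_zero] at this
    by_contra hlt
    have hX := hA X (Multiset.le_add_right _ _)
    have hY := hB Y (Multiset.le_add_right _ _)
    have hne : X ≠ 0 ∨ Y ≠ 0 := by
      by_contra! h0
      apply hW.1; simp [h0.1, h0.2]
    rcases Nat.eq_zero_or_pos X.card with hx | hx
    · rw [Multiset.card_eq_zero] at hx
      have := hY (by rw [← hs, hx, Multiset.sum_zero])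
      subst hx
      rcases this with h | h
      · omega
      · simp [h] at hne
    rcases Nat.eq_zero_or_pos Y.card with hy | hy
    · rw [Multiset.card_eq_zero] at hy
      have := hX (by rw [hs, hy, Multiset.sum_zero])
      subst hy
      rcases this with h | h
      · omega
      · simp [h] at hne
    obtain ⟨x, rfl⟩ := Multiset.card_eq_one.1 (show X.card = 1 by omega)
    obtain ⟨y, rfl⟩ := Multiset.card_eq_one.1 (show Y.card = 1 by omega)
    simp only [Multiset.sum_singleton] at hs
    subst hs
    rw [show ({x} : Multiset G) ∩ {x} = {x} from
      le_antisymm Multiset.inter_le_left (Multiset.le_inter le_rfl le_rfl)] at hlt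
    simp at hlt

end ZeroSum

/-! ### Intersections of multisets. -/

section Intersection

theorem inter_eq_zero_or_exists_mem {α : Type*} [DecidableEq α] (A B : Multiset α) :
    A ∩ B = 0 ∨ ∃ h, h ∈ A ∧ h ∈ B := by
  by_cases h : A ∩ B = 0
  · exact Or.inl h
  · obtain ⟨a, ha⟩ := Multiset.exists_mem_of_ne_zero h
    exact Or.inr ⟨a, (Multiset.mem_inter.1 ha).1, (Multiset.mem_inter.1 ha).2⟩

theorem eq_of_card_inter {α : Type*} [DecidableEq α] {A B : Multiset α} (hA : A.card ≤ (A ∩ B).card)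
    (hB : B.card ≤ (A ∩ B).card) : A = B := by
  rw [← Multiset.eq_of_le_of_card_le Multiset.inter_le_left hA]
  exact Multiset.eq_of_le_of_card_le Multiset.inter_le_right hB

theorem card_inter_le {α : Type*} [DecidableEq α] (A B : Multiset α) :
    (A ∩ B).card ≤ A.card ∧ (A ∩ B).card ≤ B.card :=
  ⟨Multiset.card_le_card Multiset.inter_le_left, Multiset.card_le_card Multiset.inter_le_right⟩

end Intersection

/-! ### Gaps in the set of lengths of `U + (-V)`, and coincidences of subsums. -/

section LengthGap

variable {G : Type*} [AddCommGroup G]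

/-- Every factorization of `U + (-V)` has length `2` or length at least `m`. -/
def LengthGap (m : ℕ) (U V : Multiset G) : Prop :=
  ∀ n, PairFactorization U V n → n = 2 ∨ m ≤ n

theorem not_isMinimalZeroSum_of_mem {A B : Multiset G} {h : G} (hA : h ∈ A) (hB : h ∈ B)
    (hc : 3 ≤ A.card + B.card) : ¬ IsMinimalZeroSum (A + B.map Neg.neg) := fun hm => by
  have hle : ({h, -h} : Multiset G) ≤ A + B.map Neg.neg := by
    change ({h} : Multiset G) + {-h} ≤ _
    exact add_le_add (Multiset.singleton_le.2 hA)
      (Multiset.singleton_le.2 (Multiset.mem_map_of_mem _ hB))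
  have := hm.eq_zero_of_card_lt hle (by simp) (by simp; omega)
  simp at this

theorem exists_two_le_or_inter [DecidableEq G] {A B : Multiset G} (hs : A.sum = B.sum)
    (hne : A ≠ 0 ∨ B ≠ 0) : (∃ n, 2 ≤ n ∧ PairFactorization A B n) ∨
      (PairFactorization A B 1 ∧ (A ∩ B = 0 ∨ A.card + B.card ≤ 2)) := by
  by_cases hm : IsMinimalZeroSum (A + B.map Neg.neg)
  · refine Or.inr ⟨.single hm, ?_⟩
    rcases inter_eq_zero_or_exists_mem A B with h | ⟨h, h1, h2⟩
    · exact Or.inl h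
    · by_contra! hc
      exact not_isMinimalZeroSum_of_mem h1 h2 (by omega) hm
  · exact Or.inl (exists_two_le_pairFactorization hs hne hm)

variable {D m : ℕ} {U V : Multiset G}

/-- Equal sums of `A` and `B` split `U + (-V)` into two zero-sum halves. If either half breaks
further, the total length is at least 3, hence at least `m`, and `PairFactorization.three_mul_le`
bounds each half. Otherwise both halves are minimal, so neither contains some `h` together with
`-h`, unless it is nothing but such a pair. -/
theorem LengthGap.dichotomy [DecidableEq G] (hg : LengthGap m U V) (hU : NoShortZeroSum U)
    (hV : NoShortZeroSum V) {A A' B B' : Multiset G} (hA : A + A' = U) (hB : B + B' = V)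
    (hs : A.sum = B.sum) (hs' : A'.sum = B'.sum) (hne : A ≠ 0 ∨ B ≠ 0) (hne' : A' ≠ 0 ∨ B' ≠ 0) :
    ((A ∩ B = 0 ∨ A.card + B.card ≤ 2) ∧ (A' ∩ B' = 0 ∨ A'.card + B'.card ≤ 2)) ∨
    ∃ n n', m ≤ n + n' ∧ 1 ≤ n ∧ 1 ≤ n' ∧ 3 * n ≤ A.card + B.card + (A ∩ B).card ∧
      3 * n' ≤ A'.card + B'.card + (A' ∩ B').card := by
  have key : ∀ n n', 1 ≤ n → 1 ≤ n' → 3 ≤ n + n' → PairFactorization A B n →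
      PairFactorization A' B' n' → ∃ n n', m ≤ n + n' ∧ 1 ≤ n ∧ 1 ≤ n' ∧
      3 * n ≤ A.card + B.card + (A ∩ B).card ∧
      3 * n' ≤ A'.card + B'.card + (A' ∩ B').card := by
    intro n n' h1 h1' h3 h h'
    subst hA hB
    refine ⟨n, n', ?_, h1, h1', h.three_mul_le (hU.mono (Multiset.le_add_right _ _))
      (hV.mono (Multiset.le_add_right _ _)), h'.three_mul_le (hU.mono (Multiset.le_add_left _ _))
      (hV.mono (Multiset.le_add_left _ _))⟩
    rcases hg _ (h.add h') with h | h <;> omega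
  rcases exists_two_le_or_inter hs hne with ⟨n, h2, h⟩ | ⟨h, hi⟩ <;>
    rcases exists_two_le_or_inter hs' hne' with ⟨n', h2', h'⟩ | ⟨h', hi'⟩
  · exact Or.inr (key n n' (by omega) (by omega) (by omega) h h')
  · exact Or.inr (key n 1 (by omega) (by omega) (by omega) h h')
  · exact Or.inr (key 1 n' (by omega) (by omega) (by omega) h h')
  · exact Or.inl ⟨hi, hi'⟩

/-- Distinct subsequences of `U` have distinct sums, except for complementary ones without common
elements. -/
def AlmostDissociated (U : Multiset G) : Prop :=
  ∀ A B : Multiset G, A ≤ U → B ≤ U → A.sum = B.sum →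
    A = B ∨ (A + B = U ∧ ∀ x, x ∈ A → x ∉ B)

/-- Counting over both halves in the second case of `LengthGap.dichotomy` gives `|A ∩ B| + |A' ∩ B'|
≥ |U|`, so `A = B`. In the first case `A`, `B` are disjoint and so are their complements, which
means that each element occurs in exactly one of them, with its full multiplicity in `U`. -/
theorem LengthGap.almostDissociated (hU : IsMinimalZeroSum U) (hm : U.card ≤ m)
    (hU3 : 3 ≤ U.card) (hg : LengthGap m U U) : AlmostDissociated U := by
  classical
  intro A B hA hB hs
  by_cases hAB : A = B
  · exact Or.inl hAB
  obtain ⟨A', rfl⟩ := Multiset.le_iff_exists_add.1 hA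
  obtain ⟨B', hB'⟩ := Multiset.le_iff_exists_add.1 hB
  have hs' : A'.sum = B'.sum := by
    have := congrArg Multiset.sum hB'
    rw [Multiset.sum_add, Multiset.sum_add, hs] at this
    exact add_left_cancel this
  have hne : A ≠ 0 ∨ B ≠ 0 := by
    by_contra! h; exact hAB (h.1.trans h.2.symm)
  have hne' : A' ≠ 0 ∨ B' ≠ 0 := by
    by_contra! h; apply hAB; simpa [h.1, h.2] using hB'
  have hc := congrArg Multiset.card hB'
  simp only [Multiset.card_add] at hc hm
  have hi := card_inter_le A B
  have hi' := card_inter_le A' B'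
  rcases hg.dichotomy (hU.noShortZeroSum hU3) (hU.noShortZeroSum hU3) rfl hB'.symm hs hs' hne hne'
    with ⟨h1, h2⟩ | ⟨n, n', h1, -, -, h2, h3⟩
  · have hz : A ∩ B = 0 := by
      rcases h1 with h | h
      · exact h
      by_contra h0
      have := Multiset.card_pos.2 h0
      exact hAB (eq_of_card_inter (by omega) (by omega))
    have hz' : A' ∩ B' = 0 := by
      rcases h2 with h | h
      · exact h
      by_contra h0
      have := Multiset.card_pos.2 h0
      have := eq_of_card_inter (A := A') (B := B') (by omega) (by omega)
      rw [this] at hB'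
      exact hAB (add_right_cancel hB')
    right
    constructor
    · ext x
      have e1 := congrArg (Multiset.count x) hB'
      have e2 := congrArg (Multiset.count x) hz
      have e3 := congrArg (Multiset.count x) hz'
      simp only [Multiset.count_add, Multiset.count_inter, Multiset.count_zero] at *
      omega
    · intro x hx hx'
      have : x ∈ A ∩ B := Multiset.mem_inter.2 ⟨hx, hx'⟩
      simp [hz] at this
  · exact absurd (eq_of_card_inter (A := A) (B := B) (by omega) (by omega)) hAB

end LengthGap

/-! ### The two target conditions on the group, and criteria for them by covering with subsums. -/

section Doubling

variable {G : Type*} [AddCommGroup G]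

variable (G) in
/-- The subgroup `2G` has at most two elements. -/
def DoublingLeTwo : Prop := ∃ w : G, ∀ x : G, x + x = 0 ∨ x + x = w

variable (G) in
/-- The group is generated by an element `g` and an element `t` with `2t = 0`. -/
def CyclicByTwo : Prop := ∃ g t : G, t + t = 0 ∧ ∀ x : G, ∃ k : ℤ, x = k • g ∨ x = k • g + t

theorem sum_add_sum_eq_zero {M : Multiset G} (hM : ∀ x ∈ M, x + x = 0) : M.sum + M.sum = 0 := by
  induction M using Multiset.induction with
  | empty => simp
  | cons a M ih =>
    rw [Multiset.sum_cons, add_add_add_comm, ih fun x hx => hM x (Multiset.mem_cons_of_mem hx),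
      hM a (Multiset.mem_cons_self _ _), add_zero]

theorem sum_add_sum_eq {M : Multiset G} {w : G} (hw : w + w = 0)
    (hM : ∀ x ∈ M, x + x = 0 ∨ x + x = w) : M.sum + M.sum = 0 ∨ M.sum + M.sum = w := by
  induction M using Multiset.induction with
  | empty => simp
  | cons a M ih =>
    have ih := ih fun x hx => hM x (Multiset.mem_cons_of_mem hx)
    have ha := hM a (Multiset.mem_cons_self _ _)
    rw [Multiset.sum_cons, add_add_add_comm]
    rcases ha with ha | ha <;> rcases ih with ih | ih <;> rw [ha, ih] <;> simp [hw]

theorem doublingLeTwo_of_cover {M : Multiset G} {w : G} (hw : w + w = 0)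
    (hM : ∀ x ∈ M, x + x = 0 ∨ x + x = w) (hc : ∀ x, ∃ T ≤ M, T.sum = x) : DoublingLeTwo G :=
  ⟨w, fun x => by
    obtain ⟨T, hT, rfl⟩ := hc x
    exact sum_add_sum_eq hw fun x hx => hM x (Multiset.mem_of_le hT hx)⟩

/-- For `y` outside `⟨g⟩` the sequence `g^(D-2) y` is zero-sum free of length `D - 1`, so its
subsums cover the group and `⟨g⟩` has index 2. Then `2y = k g`. For `k = 2l` the element `y - l g`
has order two; for `k = 2l + 1` one gets `g = 2(y - l g)`, and `y - l g` is a generator. -/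
theorem cyclicByTwo_of_nsmul_ne_zero {D : ℕ} (hD : LengthBound G D) {g : G}
    (hg : ∀ j, 0 < j → j + 1 < D → j • g ≠ 0) (h2 : 2 ≤ D) : CyclicByTwo G := by
  classical
  by_cases hK : ∀ x : G, ∃ k : ℤ, x = k • g
  · exact ⟨g, 0, by simp, fun x => (hK x).imp fun k hk => Or.inl hk⟩
  push Not at hK
  obtain ⟨y, hy⟩ := hK
  have hS : ZeroSumFree (y ::ₘ Multiset.replicate (D - 2) g) := by
    intro T hT h0
    by_cases hm : y ∈ T
    · obtain ⟨T', rfl⟩ := Multiset.exists_cons_of_mem hm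
      obtain ⟨k, hk, rfl⟩ := Multiset.le_replicate_iff.1 ((Multiset.cons_le_cons_iff _).1 hT)
      rw [Multiset.sum_cons, Multiset.sum_replicate, add_eq_zero_iff_eq_neg] at h0
      exact absurd (by rw [h0]; simp) (hy (-k))
    · obtain ⟨k, hk, rfl⟩ := Multiset.le_replicate_iff.1 ((Multiset.le_cons_of_notMem hm).1 hT)
      rw [Multiset.sum_replicate] at h0
      by_contra hne
      exact hg k (Nat.pos_of_ne_zero fun h => hne (by simp [h])) (by omega) h0
  have hc : ∀ x : G, ∃ k : ℤ, x = k • g ∨ x = k • g + y := by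
    intro x
    obtain ⟨T, hT, rfl⟩ := hD.exists_sum_eq hS (by simp; omega) x
    by_cases hm : y ∈ T
    · obtain ⟨T', rfl⟩ := Multiset.exists_cons_of_mem hm
      obtain ⟨k, hk, rfl⟩ := Multiset.le_replicate_iff.1 ((Multiset.cons_le_cons_iff _).1 hT)
      exact ⟨k, Or.inr (by simp [add_comm])⟩
    · obtain ⟨k, hk, rfl⟩ := Multiset.le_replicate_iff.1 ((Multiset.le_cons_of_notMem hm).1 hT)
      exact ⟨k, Or.inl (by simp)⟩
  obtain ⟨k, hk | hk⟩ := hc (y + y)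
  · rcases Int.even_or_odd' k with ⟨l, rfl | rfl⟩
    · refine ⟨g, y - l • g, ?_, fun x => ?_⟩
      · rw [sub_add_sub_comm, hk]; module
      · obtain ⟨j, rfl | rfl⟩ := hc x
        · exact ⟨j, Or.inl rfl⟩
        · exact ⟨j + l, Or.inr (by module)⟩
    · have hgy : g = (2 : ℤ) • (y - l • g) := by
        have : (2 : ℤ) • (y - l • g) = (y + y) - (2 * l) • g := by module
        rw [this, hk]; module
      refine ⟨y - l • g, 0, by simp, fun x => ?_⟩
      obtain ⟨j, rfl | rfl⟩ := hc x
      · refine ⟨2 * j, Or.inl ?_⟩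
        conv_lhs => rw [hgy]
        module
      · refine ⟨2 * (j + l) + 1, Or.inl ?_⟩
        have : j • g + y = (j + l) • g + (y - l • g) := by module
        rw [this]
        conv_lhs => enter [1]; rw [hgy]
        module
  · exact absurd (add_right_cancel hk) (hy k)

theorem IsMinimalZeroSum.nsmul_ne_zero {U : Multiset G} (hU : IsMinimalZeroSum U) {g : G} {j n : ℕ}
    (hg : Multiset.replicate n g ≤ U) (hj : 0 < j) (hjn : j ≤ n) (hjU : j < U.card) :
    j • g ≠ 0 := fun h => by
  have := hU.eq_zero_of_card_lt ((Multiset.replicate_le_replicate _).2 hjn |>.trans hg)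
    (by simpa using h) (by simpa using hjU)
  have := congrArg Multiset.card this
  simp at this; omega

/-- A minimal zero-sum sequence that contains an element with large multiplicity. -/
theorem IsMinimalZeroSum.cyclicByTwo {D : ℕ} (hD : LengthBound G D) (h2 : 2 ≤ D) {U : Multiset G}
    (hU : IsMinimalZeroSum U) {g : G} (hg : Multiset.replicate (D - 2) g ≤ U)
    (hc : D ≤ U.card + 1) : CyclicByTwo G :=
  cyclicByTwo_of_nsmul_ne_zero hD (fun _ hj hjD => hU.nsmul_ne_zero hg hj (by omega) (by omega)) h2

/-- Five copies of an element whose triple is the sum of a sequence of involutions. -/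
theorem card_add_four_lt {D : ℕ} (hD : LengthBound G D) {E : Multiset G} (hE : ZeroSumFree E)
    (h2 : ∀ x ∈ E, x + x = 0) {e f : G} (he : e ∈ E) (h3 : 3 • f = E.sum) (hf : f + f ≠ 0) :
    E.card + 4 < D := by
  classical
  -- Here `6f = 0`, while `2f` and `4f` do not vanish. Doubling a zero sum with `j` copies of `f`
  -- gives `2j f = 0`, so `j` is 0 or 3. For `j = 3`, as `3f` is the sum of `E`, the complement in
  -- `E` of the remaining terms would have sum zero, and it contains `e`.
  have key : ZeroSumFree (Multiset.replicate 5 f + E.erase e) := by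
    intro T hT h0
    obtain ⟨T₁, T₂, hT₁, hT₂, rfl⟩ := exists_add_of_le_add hT
    obtain ⟨j, hj, rfl⟩ := Multiset.le_replicate_iff.1 hT₁
    have hE2 := sum_add_sum_eq_zero h2
    have hT2 : T₂.sum + T₂.sum = 0 := sum_add_sum_eq_zero fun x hx =>
      h2 x (Multiset.mem_of_mem_erase (Multiset.mem_of_le hT₂ hx))
    rw [Multiset.sum_add, Multiset.sum_replicate] at h0
    have h2j : (2 * j) • f = 0 := by
      have : (2 * j) • f = (j • f + T₂.sum) + (j • f + T₂.sum) - (T₂.sum + T₂.sum) := by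
        rw [two_mul, add_nsmul]; abel
      rw [this, h0, hT2]; simp
    have h6 : 6 • f = 0 := by
      rw [show 6 • f = 3 • f + 3 • f by abel, h3, hE2]
    have hf' : 2 • f ≠ 0 := by rwa [two_nsmul]
    have h4' : 4 • f ≠ 0 := fun h => hf' (by
      rw [show 2 • f = 6 • f - 4 • f by abel_nf, h, h6, sub_zero])
    interval_cases j
    · simp only [zero_nsmul, zero_add] at h0
      simp [hE T₂ (hT₂.trans (Multiset.erase_le _ _)) h0]
    · exact absurd h2j hf'
    · exact absurd h2j h4'
    · exfalso
      rw [h3] at h0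
      obtain ⟨R, hR⟩ := Multiset.le_iff_exists_add.1 hT₂
      have hE' : E = e ::ₘ (T₂ + R) := by rw [← hR, Multiset.cons_erase he]
      have := hE (e ::ₘ R) (by rw [hE']; exact Multiset.cons_le_cons _ (Multiset.le_add_left _ _)) (by
        have h5 : E.sum = (e ::ₘ R).sum + T₂.sum := by
          rw [hE']; simp only [Multiset.sum_cons, Multiset.sum_add]; abel
        rw [h5, add_assoc, hT2, add_zero] at h0
        exact h0)
      exact Multiset.cons_ne_zero this
    · have h8 : (2 * 4) • f = 6 • f + 2 • f := by abel
      rw [h8, h6, zero_add] at h2j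
      exact absurd h2j hf'
    · have h8 : (2 * 5) • f = 6 • f + 4 • f := by abel
      rw [h8, h6, zero_add] at h2j
      exact absurd h2j h4'
  have := hD.card_lt key
  have := Multiset.card_erase_add_one he
  simp at *; omega

end Doubling

/-! ### Almost dissociated sequences of maximal length, and the exchange of one element for another.
-/

section AlmostDissociated

variable {G : Type*} [AddCommGroup G] [DecidableEq G] {D : ℕ} {U : Multiset G}

/-- If `U` has distinct elements `x`, `y`, then `x` is the sum of some `A ≤ U` containing `y`. As `A
≠ {x}`, the two are complementary with the same sum, so `2x` is the sum of `U`, which is 0. If all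
elements agree, their multiples cover the group. -/
theorem AlmostDissociated.cyclic_or_elementary (hF : AlmostDissociated U) (hD : LengthBound G D)
    (hU : IsMinimalZeroSum U) (hc : D ≤ U.card) :
    (∃ g : G, ∀ x : G, ∃ k : ℤ, x = k • g) ∨ ∀ x : G, x + x = 0 := by
  obtain ⟨g, hg⟩ := Multiset.exists_mem_of_ne_zero hU.1
  have hcov := hD.exists_sum_eq_erase hU hc hg
  by_cases h : ∀ x ∈ U, x = g
  · left
    refine ⟨g, fun x => ?_⟩
    obtain ⟨T, hT, rfl⟩ := hcov x
    rw [Multiset.eq_replicate_card.2 fun x hx => h x (Multiset.mem_of_mem_erase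
      (Multiset.mem_of_le hT hx))]
    exact ⟨T.card, by simp⟩
  · right
    push Not at h
    obtain ⟨b, hb, hbg⟩ := h
    have key : ∀ x ∈ U, ∀ y ∈ U, y ≠ x → x + x = 0 := by
      intro x hx y hy hxy
      obtain ⟨A, hA, hyA, hs⟩ := hD.exists_mem_sum_eq hU hc hy x
      rcases hF A {x} hA (Multiset.singleton_le.2 hx) (by simpa using hs) with h | ⟨h, -⟩
      · rw [h] at hyA; exact absurd (Multiset.mem_singleton.1 hyA) hxy
      · have := congrArg Multiset.sum h
        rwa [Multiset.sum_add, hs, Multiset.sum_singleton, hU.2.1] at this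
    have hall : ∀ x ∈ U, x + x = 0 := by
      intro x hx
      by_cases hxg : x = g
      · exact key x hx b hb (hxg ▸ hbg)
      · exact key x hx g hg (Ne.symm hxg)
    intro x
    obtain ⟨T, hT, rfl⟩ := hcov x
    exact sum_add_sum_eq_zero fun x hx => hall x (Multiset.mem_of_mem_erase (Multiset.mem_of_le hT hx))

/-- A subsequence of `g V` that does not fit into `V` must use every copy of `g`; the full
multiplicity in `T'` is what later arguments need. -/
theorem le_or_of_le_cons {α : Type*} [DecidableEq α] {T V : Multiset α} {g : α}
    (hT : T ≤ g ::ₘ V) : T ≤ V ∨ ∃ T', T = g ::ₘ T' ∧ T' ≤ V ∧ T'.count g = V.count g := by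
  by_cases h : T ≤ V
  · exact Or.inl h
  right
  have hg : V.count g < T.count g := by
    by_contra! hc
    apply h
    rw [Multiset.le_iff_count] at hT ⊢
    intro x
    by_cases hx : x = g
    · rwa [hx]
    · have := hT x
      rwa [Multiset.count_cons_of_ne hx] at this
  obtain ⟨T', rfl⟩ := Multiset.exists_cons_of_mem (Multiset.count_pos.1 (by omega : 0 < T.count g))
  have hT' := (Multiset.cons_le_cons_iff _).1 hT
  refine ⟨T', rfl, hT', le_antisymm (Multiset.le_iff_count.1 hT' g) ?_⟩
  rw [Multiset.count_cons_self] at hg; omega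

theorem IsMinimalZeroSum.erase {h : G} (hU : IsMinimalZeroSum U) (hh : h ∈ U) :
    ZeroSumFree (U.erase h) :=
  IsMinimalZeroSum.zeroSumFree_of_cons (a := h) (by rwa [Multiset.cons_erase hh])

/-- The element `g` occurs in `U` once and has order at most two. -/
def IsSimpleInvolution (U : Multiset G) (g : G) : Prop := U.count g = 1 ∧ g + g = 0

/-- Trading `h` for one more `g` keeps the length `|U|`, so for `|U| = D - 1` the subsums of the new
sequence cover the group. A zero sum using the extra `g` would give a `T` with the sum of `U`
without `g`, but with fewer copies of `h`. By almost dissociation `T = {g}`, and `g` would be a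
simple involution. -/
theorem AlmostDissociated.zeroSumFree_cons_erase (hF : AlmostDissociated U)
    (hU : IsMinimalZeroSum U) {g h : G} (hg : g ∈ U) (hh : h ∈ U) (hgh : h ≠ g)
    (hn : ¬ IsSimpleInvolution U g) : ZeroSumFree (g ::ₘ U.erase h) := by
  intro T hT h0
  rcases le_or_of_le_cons hT with hT' | ⟨T, rfl, hT', hcg⟩
  · exact hU.erase hh T hT' h0
  exfalso
  have hch : T.count h < U.count h := by
    have := Multiset.le_iff_count.1 hT' h
    rw [Multiset.count_erase_self] at this
    have := Multiset.count_pos.2 hh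
    omega
  rw [Multiset.count_erase_of_ne hgh.symm] at hcg
  have hsum : (U.erase g).sum = T.sum := by
    have h1 := hU.2.1
    rw [← Multiset.cons_erase hg, Multiset.sum_cons] at h1
    rw [Multiset.sum_cons] at h0
    exact add_left_cancel (h1.trans h0.symm)
  rcases hF T (U.erase g) (hT'.trans (Multiset.erase_le _ _)) (Multiset.erase_le _ _) hsum.symm with
    h | ⟨h, -⟩
  · rw [h, Multiset.count_erase_of_ne hgh] at hch; omega
  · have hT1 : T = {g} := by
      apply add_right_cancel (b := U.erase g)
      rw [h, Multiset.singleton_add, Multiset.cons_erase hg]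
    subst hT1
    simp only [Multiset.count_singleton_self] at hcg
    exact hn ⟨hcg.symm, by simpa using h0⟩

/-- The element `B.sum` has order at most two, and each element occurs in `B` with multiplicity
zero or the one in `U`. -/
def IsFullBlock (U B : Multiset G) : Prop :=
  (∀ x, B.count x = 0 ∨ B.count x = U.count x) ∧ B.sum + B.sum = 0

theorem AlmostDissociated.isFullBlock (hF : AlmostDissociated U) (hU : IsMinimalZeroSum U)
    {A B : Multiset G} (hA : A ≤ U) (hB : B ≤ U) (hs : A.sum = B.sum) (hne : A ≠ B) :
    IsFullBlock U B := by
  rcases hF A B hA hB hs with h | ⟨h, hd⟩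
  · exact absurd h hne
  refine ⟨fun x => ?_, ?_⟩
  · have h1 := congrArg (Multiset.count x) h
    rw [Multiset.count_add] at h1
    by_cases hx : x ∈ A
    · exact Or.inl (Multiset.count_eq_zero.2 (hd x hx))
    · rw [Multiset.count_eq_zero.2 hx] at h1
      right; omega
  · nth_rewrite 1 [← hs]
    rw [← Multiset.sum_add, h, hU.2.1]

/-- The situation of two elements of an almost dissociated sequence, neither of which is a simple
involution. -/
theorem AlmostDissociated.fullBlock_or (hF : AlmostDissociated U) (hD : LengthBound G D)
    (hU : IsMinimalZeroSum U) (hc : D ≤ U.card + 1) {g h : G} (hg : g ∈ U) (hh : h ∈ U)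
    (hgh : h ≠ g) (hn : ¬ IsSimpleInvolution U g) {B : Multiset G} (hB : g ::ₘ B ≤ U)
    (hBh : B.count h = U.count h) :
    IsFullBlock U (g ::ₘ B) ∨ IsFullBlock U B ∧ g ∉ B := by
  have hz := hF.zeroSumFree_cons_erase hU hg hh hgh hn
  have hcard := Multiset.card_erase_add_one hh
  obtain ⟨A, hA, hs⟩ := hD.exists_sum_eq hz (by rw [Multiset.card_cons]; omega) (g ::ₘ B).sum
  have hhU := Multiset.count_pos.2 hh
  rcases le_or_of_le_cons hA with hA' | ⟨A, rfl, hA', hcg⟩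
  -- The subsum `A` that represents the sum of `g B` differs from `g B`, since one copy of `h` was
  -- removed while `B` has all of them. So the two are complementary.
  · left
    refine hF.isFullBlock hU (hA'.trans (Multiset.erase_le _ _)) hB hs ?_
    rintro rfl
    have := Multiset.le_iff_count.1 hA' h
    rw [Multiset.count_erase_self, Multiset.count_cons_of_ne hgh] at this
    omega
  · right
    rw [Multiset.sum_cons, Multiset.sum_cons] at hs
    have hne : A ≠ B := by
      rintro rfl
      have := Multiset.le_iff_count.1 hA' h
      rw [Multiset.count_erase_self] at this
      omega
    rw [Multiset.count_erase_of_ne hgh.symm] at hcg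
    have hAU := hA'.trans (Multiset.erase_le _ _)
    have hBU := (Multiset.le_cons_self _ _).trans hB
    refine ⟨hF.isFullBlock hU hAU hBU (add_left_cancel hs) hne, fun hgB => ?_⟩
    rcases hF A B hAU hBU (add_left_cancel hs) with h | ⟨-, hd⟩
    · exact hne h
    · exact hd g (Multiset.count_pos.1 (hcg ▸ Multiset.count_pos.2 hg)) hgB

end AlmostDissociated

/-! ### Almost dissociated sequences of length `D - 1`: an element of multiplicity two. -/

section AlmostDissociated

variable {G : Type*} [AddCommGroup G] [DecidableEq G] {D : ℕ} {U : Multiset G}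

/-- Take `B` to be one `g` and all copies of `h` in `AlmostDissociated.fullBlock_or`. Since `g` lies
in `B`, the sequence `g B`, with exactly two copies of `g`, must be a full block. -/
theorem AlmostDissociated.count_eq_two (hF : AlmostDissociated U) (hD : LengthBound G D)
    (hU : IsMinimalZeroSum U) (hc : D ≤ U.card + 1) {g h : G} (hh : h ∈ U)
    (hgh : h ≠ g) (hg : 2 ≤ U.count g) : U.count g = 2 := by
  have hn : ¬ IsSimpleInvolution U g := fun h => by have := h.1; omega
  have hB : g ::ₘ g ::ₘ Multiset.replicate (U.count h) h ≤ U := by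
    rw [Multiset.le_iff_count]
    intro x
    simp only [Multiset.count_cons, Multiset.count_replicate]
    split_ifs <;> subst_vars <;> first | omega | exact absurd rfl hgh
  have hBh : (g ::ₘ Multiset.replicate (U.count h) h).count h = U.count h := by
    rw [Multiset.count_cons_of_ne hgh, Multiset.count_replicate_self]
  rcases hF.fullBlock_or hD hU hc (Multiset.count_pos.1 (by omega)) hh hgh hn hB hBh with h1 | h1
  · have := h1.1 g
    rw [Multiset.count_cons_self, Multiset.count_cons_self, Multiset.count_replicate,
      if_neg hgh] at this
    omega
  · exact absurd (Multiset.mem_cons_self _ _) h1.2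

/-- With `g` prepended, the sequence contains just one of the two copies of `g` and is no full
block, so the alternative of `AlmostDissociated.fullBlock_or` holds. -/
theorem AlmostDissociated.isFullBlock_of_count_eq_two (hF : AlmostDissociated U)
    (hD : LengthBound G D) (hU : IsMinimalZeroSum U) (hc : D ≤ U.card + 1) {g h : G} (hh : h ∈ U)
    (hgh : h ≠ g) (hg : U.count g = 2) {T : Multiset G} (hT : T ≤ U) (hgT : g ∉ T) (hhT : h ∉ T) :
    IsFullBlock U (Multiset.replicate (U.count h) h + T) := by
  have hn : ¬ IsSimpleInvolution U g := fun h => by have := h.1; omega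
  have hB : g ::ₘ (Multiset.replicate (U.count h) h + T) ≤ U := by
    rw [Multiset.le_iff_count] at hT ⊢
    intro x
    have := hT x
    have h1 := Multiset.count_eq_zero.2 hgT
    have h2 := Multiset.count_eq_zero.2 hhT
    simp only [Multiset.count_cons, Multiset.count_replicate, Multiset.count_add]
    split_ifs <;> subst_vars <;> first | omega | exact absurd rfl hgh
  have hBh : (Multiset.replicate (U.count h) h + T).count h = U.count h := by
    rw [Multiset.count_add, Multiset.count_replicate_self, Multiset.count_eq_zero.2 hhT, add_zero]
  rcases hF.fullBlock_or hD hU hc (Multiset.count_pos.1 (by omega)) hh hgh hn hB hBh with h1 | h1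
  · have := h1.1 g
    rw [Multiset.count_cons_self, Multiset.count_add, Multiset.count_replicate,
      if_neg hgh, Multiset.count_eq_zero.2 hgT] at this
    omega
  · exact h1.1

/-- Both `g` and `h` turn out to have multiplicity two and satisfy `4g = 4h = 0`. If `U = g² h²`,
then `2g = 2h` and the covering criterion applies. A further element `e` would allow a zero-sum free
sequence of length `D`, built by adding one `g` and one `h` and dropping `e`. -/
theorem AlmostDissociated.doublingLeTwo_of_count_eq_two (hF : AlmostDissociated U)
    (hD : LengthBound G D) (hU : IsMinimalZeroSum U) (hc : U.card + 1 = D)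
    {g h : G} (hh : h ∈ U) (hgh : h ≠ g) (hg : U.count g = 2) (hnh : ¬ IsSimpleInvolution U h) :
    DoublingLeTwo G := by
  have hgU : g ∈ U := Multiset.count_pos.1 (by omega)
  have hn : ¬ IsSimpleInvolution U g := fun h => by have := h.1; omega
  have hhU := Multiset.count_pos.2 hh
  have h0 := (hF.isFullBlock_of_count_eq_two hD hU hc.ge (T := 0) hh hgh hg
    (Multiset.zero_le _) (by simp) (by simp)).2
  simp only [add_zero, Multiset.sum_replicate] at h0
  have hh2 : U.count h = 2 := by
    by_contra hne
    have h1 : U.count h = 1 := by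
      by_contra h1
      exact hne (hF.count_eq_two hD hU hc.ge hgU hgh.symm (by omega))
    rw [h1, one_smul] at h0
    exact hnh ⟨h1, h0⟩
  have key' := hF.isFullBlock_of_count_eq_two hD hU hc.ge (T := 0) hgU hgh.symm hh2
    (Multiset.zero_le _) (by simp) (by simp)
  have h0' := key'.2
  simp only [add_zero, Multiset.sum_replicate, hg] at h0'
  rw [hh2] at h0
  have hle : Multiset.replicate 2 g + Multiset.replicate 2 h ≤ U := by
    rw [Multiset.le_iff_count]
    intro x
    simp only [Multiset.count_replicate, Multiset.count_add]
    split_ifs <;> subst_vars <;> first | omega | exact absurd rfl hgh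
  obtain ⟨E, rfl⟩ := Multiset.le_iff_exists_add.1 hle
  have hEg : E.count g = 0 := by
    simp only [Multiset.count_add, Multiset.count_replicate, if_neg hgh,
      ↓reduceIte] at hg; omega
  have hEh : E.count h = 0 := by
    simp only [Multiset.count_add, Multiset.count_replicate,
      if_neg hgh.symm, ↓reduceIte] at hh2; omega
  have hz := hF.zeroSumFree_cons_erase hU hgU hh hgh hn
  have hcard := Multiset.card_erase_add_one hh
  by_cases hE : E = 0
  · subst hE
    have hs := hU.2.1
    simp only [add_zero, Multiset.sum_add, Multiset.sum_replicate] at hs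
    refine doublingLeTwo_of_cover (w := 2 • g) h0' ?_
      (hD.exists_sum_eq hz (by rw [Multiset.card_cons]; omega))
    intro x hx
    have hx : x = g ∨ x = h := by
      rcases Multiset.mem_cons.1 hx with hx | hx
      · exact Or.inl hx
      · have := Multiset.mem_of_mem_erase hx
        simp at this; tauto
    right
    rcases hx with rfl | rfl
    · rw [two_nsmul]
    · rw [← two_nsmul, ← add_left_inj (2 • x), h0, hs]
  · exfalso
    obtain ⟨e, he⟩ := Multiset.exists_mem_of_ne_zero hE
    have hEe := Multiset.count_pos.2 he
    have heg : g ≠ e := by rintro rfl; omega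
    have heh : h ≠ e := by rintro rfl; omega
    have h4 : (4 : ℕ) • g = 0 := by rw [show (4 : ℕ) • g = 2 • g + 2 • g by abel, h0']
    have h4' : (4 : ℕ) • h = 0 := by rw [show (4 : ℕ) • h = 2 • h + 2 • h by abel, h0]
    -- Because `4g = 4h = 0`, a block of three `g` or three `h` counts as `-g` or `-h`. A zero sum
    -- then gives a subsequence of `U` with the sum of `{g}`, `{h}` or `{g, h}`, neither equal nor
    -- complementary to it.
    have hzf : ZeroSumFree (Multiset.replicate 3 g + (Multiset.replicate 3 h + E.erase e)) := by
      intro T hT hT0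
      obtain ⟨T₁, T', h1, h', rfl⟩ := exists_add_of_le_add hT
      obtain ⟨T₂, R, h2, hR, rfl⟩ := exists_add_of_le_add h'
      obtain ⟨i, hi, rfl⟩ := Multiset.le_replicate_iff.1 h1
      obtain ⟨j, hj, rfl⟩ := Multiset.le_replicate_iff.1 h2
      have hRc := Multiset.le_iff_count.1 hR
      have hle : ∀ i j, i ≤ 2 → j ≤ 2 → Multiset.replicate i g + (Multiset.replicate j h + R) ≤
          Multiset.replicate 2 g + Multiset.replicate 2 h + E := by
        intro i j hi hj
        rw [add_assoc]
        exact add_le_add ((Multiset.replicate_le_replicate _).2 hi)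
          (add_le_add ((Multiset.replicate_le_replicate _).2 hj) (hR.trans (Multiset.erase_le _ _)))
      have hRg : R.count g = 0 := by
        have := hRc g; rw [Multiset.count_erase_of_ne heg] at this; omega
      have hRh : R.count h = 0 := by
        have := hRc h; rw [Multiset.count_erase_of_ne heh] at this; omega
      simp only [Multiset.sum_add, Multiset.sum_replicate] at hT0
      by_cases hi3 : i ≤ 2
      · by_cases hj3 : j ≤ 2
        · refine hU.eq_zero_of_card_lt (hle i j hi3 hj3) (by simpa using hT0) ?_
          have := Multiset.card_le_card hR
          have := Multiset.card_erase_add_one he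
          simp only [Multiset.card_add, Multiset.card_replicate]
          omega
        · obtain rfl : j = 3 := by omega
          rcases hF _ {h} (hle i 0 hi3 (by omega)) (Multiset.singleton_le.2 hh) (by
            simp only [Multiset.sum_add, Multiset.sum_replicate, Multiset.sum_singleton]
            rw [← sub_eq_zero, ← hT0, ← sub_eq_zero, ← neg_eq_zero, ← h4']; abel) with h5 | ⟨h5, -⟩
          · have := congrArg (Multiset.count h) h5
            simp only [Multiset.count_add, Multiset.count_replicate, Multiset.count_singleton,
              if_neg hgh.symm, ↓reduceIte] at this; omega
          · have := congrArg (Multiset.count h) h5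
            simp only [Multiset.count_add, Multiset.count_replicate, Multiset.count_singleton,
              if_neg hgh.symm, ↓reduceIte] at this; omega
      · obtain rfl : i = 3 := by omega
        by_cases hj3 : j ≤ 2
        · rcases hF _ {g} (hle 0 j (by omega) hj3) (Multiset.singleton_le.2 hgU) (by
            simp only [Multiset.sum_add, Multiset.sum_replicate, Multiset.sum_singleton]
            rw [← sub_eq_zero, ← hT0, ← sub_eq_zero, ← neg_eq_zero, ← h4]; abel) with h5 | ⟨h5, -⟩
          · have := congrArg (Multiset.count g) h5
            simp only [Multiset.count_add, Multiset.count_replicate, Multiset.count_singleton, if_neg hgh,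
              ↓reduceIte] at this; omega
          · have := congrArg (Multiset.count g) h5
            simp only [Multiset.count_add, Multiset.count_replicate, Multiset.count_singleton, if_neg hgh,
              ↓reduceIte] at this; omega
        · obtain rfl : j = 3 := by omega
          rcases hF _ ({g} + {h}) (hle 0 0 (by omega) (by omega)) (by
              simpa using (hle 1 1 (by omega) (by omega)).trans' (by
                rw [← add_assoc]; simp)) (by
            simp only [Multiset.sum_add, Multiset.sum_replicate, Multiset.sum_singleton]
            rw [← sub_eq_zero, ← hT0, ← sub_eq_zero, ← neg_eq_zero]
            have : (4 : ℕ) • g + 4 • h = 0 := by rw [h4, h4', add_zero]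
            rw [← this]; abel) with h5 | ⟨h5, -⟩
          · have := congrArg (Multiset.count g) h5
            simp only [Multiset.count_add, Multiset.count_replicate, Multiset.count_singleton, if_neg hgh,
              if_neg hgh.symm, ↓reduceIte] at this; omega
          · have := congrArg (Multiset.count g) h5
            simp only [Multiset.count_add, Multiset.count_replicate, Multiset.count_singleton, if_neg hgh,
              if_neg hgh.symm, ↓reduceIte] at this; omega
    have := hD.card_lt hzf
    have := Multiset.card_erase_add_one he
    simp only [Multiset.card_add, Multiset.card_replicate] at *
    omega

end AlmostDissociated

/-! ### Almost dissociated sequences of length `D - 1`: the remaining cases. -/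

section AlmostDissociated

variable {G : Type*} [AddCommGroup G] [DecidableEq G] {D : ℕ} {U : Multiset G}

theorem IsMinimalZeroSum.add_self_ne_zero (hU : IsMinimalZeroSum U) (h3 : 3 ≤ U.card) {g : G}
    (hg : g ∈ U) (hn : ¬ IsSimpleInvolution U g) : g + g ≠ 0 := fun h => by
  have h1 : U.count g ≠ 1 := fun h1 => hn ⟨h1, h⟩
  have := Multiset.count_pos.2 hg
  exact hU.nsmul_ne_zero (g := g) (n := 2) (j := 2) (Multiset.le_count_iff_replicate_le.1 (by omega))
    (by norm_num) le_rfl h3 (by rwa [two_nsmul])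

/-- This is `AlmostDissociated.fullBlock_or` with `B = {h}`; its second alternative would give `2h =
0`. -/
theorem AlmostDissociated.add_add_eq_zero (hF : AlmostDissociated U) (hD : LengthBound G D)
    (hU : IsMinimalZeroSum U) (hc : D ≤ U.card + 1) (h3 : 3 ≤ U.card) {g h : G} (hg : g ∈ U)
    (hh : h ∈ U) (hgh : h ≠ g) (hn : ¬ IsSimpleInvolution U g) (hnh : ¬ IsSimpleInvolution U h)
    (hch : U.count h = 1) : (g + h) + (g + h) = 0 := by
  have hB : g ::ₘ {h} ≤ U := by
    rw [← Multiset.singleton_add, Multiset.singleton_add, 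
      Multiset.cons_le_of_notMem (by simpa using hgh.symm)]
    exact ⟨hg, Multiset.singleton_le.2 hh⟩
  rcases hF.fullBlock_or hD hU hc hg hh hgh hn hB (by simp [hch]) with h1 | h1
  · simpa using h1.2
  · exact absurd (by simpa using h1.1.2) (hU.add_self_ne_zero h3 hh hnh)

/-- This is `AlmostDissociated.fullBlock_or` with `B = {h, x}`. The two alternatives say `2(g + h +
x) = 0` and `2(h + x) = 0`, to be compared with `2(g + h) = 0`. -/
theorem AlmostDissociated.count_eq_one_and (hF : AlmostDissociated U) (hD : LengthBound G D)
    (hU : IsMinimalZeroSum U) (hc : D ≤ U.card + 1) {g h x : G} (hg : g ∈ U)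
    (hh : h ∈ U) (hx : x ∈ U) (hgh : h ≠ g) (hxg : x ≠ g) (hxh : x ≠ h)
    (hn : ¬ IsSimpleInvolution U g) (hch : U.count h = 1) (hsum : (g + h) + (g + h) = 0) :
    U.count x = 1 ∧ (x + x = 0 ∨ x + x = g + g) := by
  have hB : g ::ₘ h ::ₘ {x} ≤ U := by
    rw [Multiset.cons_le_of_notMem (by simp [hgh.symm, hxg.symm]),
      Multiset.cons_le_of_notMem (by simp [hxh.symm])]
    exact ⟨hg, hh, Multiset.singleton_le.2 hx⟩
  rcases hF.fullBlock_or hD hU hc hg hh hgh hn hB (by simp [hch, hxh.symm]) with h1 | ⟨h1, -⟩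
  · refine ⟨?_, Or.inl ?_⟩
    · have := h1.1 x
      simp [hxg, hxh] at this; omega
    · have := h1.2
      simp only [Multiset.sum_cons, Multiset.sum_singleton] at this
      rw [← this, ← sub_eq_zero, ← neg_eq_zero, ← hsum]; abel
  · refine ⟨?_, Or.inr ?_⟩
    · have := h1.1 x
      simp [hxh] at this; omega
    · have := h1.2
      simp only [Multiset.sum_cons, Multiset.sum_singleton] at this
      rw [← sub_eq_zero, ← sub_eq_zero.2 (this.trans hsum.symm)]; abel

/-- All other elements of `U` have double 0 or `2g`, and `2h = -2g`, so it is enough to prove `4g =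
0`. A third element that is no involution gives this at once. Otherwise `3g` is a subsum of `g² E`
with a sequence `E` of involutions, and the number of copies of `g` used there decides. -/
theorem AlmostDissociated.doublingLeTwo_of_count_eq_one (hF : AlmostDissociated U)
    (hD : LengthBound G D) (hU : IsMinimalZeroSum U) (hc : U.card + 1 = D) (h4 : 4 ≤ U.card)
    {g h : G} (hg : g ∈ U) (hh : h ∈ U) (hgh : h ≠ g) (hn : ¬ IsSimpleInvolution U g)
    (hnh : ¬ IsSimpleInvolution U h) (hcg : U.count g = 1) (hch : U.count h = 1) :
    DoublingLeTwo G := by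
  have hsum := hF.add_add_eq_zero hD hU hc.ge (by omega) hg hh hgh hn hnh hch
  have hx := fun x hx hxg hxh =>
    hF.count_eq_one_and (x := x) hD hU hc.ge hg hh hx hgh hxg hxh hn hch hsum
  have hz := hF.zeroSumFree_cons_erase hU hg hh hgh hn
  have hcard := Multiset.card_erase_add_one hh
  have hcov := hD.exists_sum_eq hz (by rw [Multiset.card_cons]; omega)
  have main : 4 • g = 0 → DoublingLeTwo G := by
    intro h4g
    refine doublingLeTwo_of_cover (w := g + g) (by rw [← h4g]; abel) ?_ hcov
    intro x hx'
    rcases Multiset.mem_cons.1 hx' with rfl | hx'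
    · exact Or.inr rfl
    have hxU := Multiset.mem_of_mem_erase hx'
    by_cases hxg : x = g
    · exact Or.inr (by rw [hxg])
    by_cases hxh : x = h
    · subst hxh
      refine Or.inr ?_
      rw [← sub_eq_zero, ← sub_eq_zero.2 (hsum.trans h4g.symm)]; abel
    · exact (hx x hxU hxg hxh).2
  by_cases hex : ∃ x ∈ U, x ≠ g ∧ x ≠ h ∧ x + x ≠ 0
  · obtain ⟨x, hxU, hxg, hxh, hx0⟩ := hex
    have hxe := hx x hxU hxg hxh
    have h2 := hF.add_add_eq_zero hD hU hc.ge (by omega) hg hxU hxg hn (fun h => hx0 h.2) hxe.1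
    apply main
    rw [add_add_add_comm, hxe.2.resolve_left hx0] at h2
    rw [← h2]; abel
  push Not at hex
  obtain ⟨T, hT, hTs⟩ := hcov (3 • g)
  have hle : {g} + {h} ≤ U := by
    rw [Multiset.singleton_add, Multiset.cons_le_of_notMem (by simpa using hgh.symm)]
    exact ⟨hg, Multiset.singleton_le.2 hh⟩
  obtain ⟨E, rfl⟩ := Multiset.le_iff_exists_add.1 hle
  have hEg : g ∉ E := by
    rw [← Multiset.count_eq_zero]
    simp only [Multiset.count_add, Multiset.count_singleton, if_neg hgh.symm, ↓reduceIte] at hcg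
    omega
  have hEh : h ∉ E := by
    rw [← Multiset.count_eq_zero]
    simp only [Multiset.count_add, Multiset.count_singleton, if_neg hgh, ↓reduceIte] at hch
    omega
  have hE2 : ∀ x ∈ E, x + x = 0 := fun x hxE =>
    hex x (Multiset.mem_add.2 (Or.inr hxE)) (fun h => hEg (h ▸ hxE)) (fun h => hEh (h ▸ hxE))
  have her : ({g} + {h} + E).erase h = {g} + E := by
    rw [add_right_comm, add_comm _ ({h} : Multiset G), Multiset.singleton_add h,
      Multiset.erase_cons_head]
  rw [her, ← Multiset.singleton_add, ← add_assoc] at hT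
  obtain ⟨T₁, T₂, hT₁, hT₂, rfl⟩ := exists_add_of_le_add hT
  obtain ⟨i, hi, rfl⟩ := Multiset.le_replicate_iff.1
    (show T₁ ≤ Multiset.replicate 2 g from hT₁)
  have hT2 : T₂.sum + T₂.sum = 0 :=
    sum_add_sum_eq_zero fun x hx => hE2 x (Multiset.mem_of_le hT₂ hx)
  rw [Multiset.sum_add, Multiset.sum_replicate] at hTs
  have hg2 := hU.add_self_ne_zero (by omega) hg hn
  interval_cases i
  -- No copy of `g` is used, so `6g = 0`. Then `f = 4g + ∑ E` satisfies `3f = ∑ E` and `2f = 2g ≠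
  -- 0`, and `card_add_four_lt` contradicts `|E| = D - 3`.
  · have h6 : 3 • g + 3 • g = 0 := by rw [← hTs, zero_nsmul, zero_add, hT2]
    have hEs := sum_add_sum_eq_zero hE2
    have hE0 : E ≠ 0 := by
      rintro rfl
      simp at h4
    obtain ⟨e, he⟩ := Multiset.exists_mem_of_ne_zero hE0
    have := card_add_four_lt hD (E := E) (e := e) (f := 4 • g + E.sum)
      (hU.zeroSumFree_of_lt (Multiset.le_add_left _ _) (by simp)) hE2 he (by
        rw [show 3 • (4 • g + E.sum) = (3 • g + 3 • g) + (3 • g + 3 • g) + (E.sum + E.sum) + E.sum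
          by abel, h6, hEs]; simp) (by
        rw [show 4 • g + E.sum + (4 • g + E.sum) = (3 • g + 3 • g) + (E.sum + E.sum) + (g + g)
          by abel, h6, hEs]; simpa using hg2)
    simp at hc
    omega
  · apply main
    rw [show 4 • g = (3 • g - 1 • g) + (3 • g - 1 • g) by abel, ← hTs, add_sub_cancel_left, hT2]
  · exfalso
    apply hg2
    rw [show g + g = (3 • g - 2 • g) + (3 • g - 2 • g) by abel, ← hTs, add_sub_cancel_left, hT2]

/-- Here `U = g^n E` with involutions `E`, so `2n g = 0`. The case `n = 1` contradicts `2g ≠ 0`, and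
`n = 2` gives the claim by covering. For `n ≥ 3` the sequence `g^(2n-1)` with `E` minus `h` would be
zero-sum free of length `|U| + n - 2 ≥ D`. -/
theorem AlmostDissociated.doublingLeTwo_of_unique (hF : AlmostDissociated U)
    (hD : LengthBound G D) (hU : IsMinimalZeroSum U) (hc : U.card + 1 = D) (h4 : 4 ≤ U.card)
    {g h : G} (hg : g ∈ U) (hh : h ∈ U) (hgh : h ≠ g) (hn : ¬ IsSimpleInvolution U g)
    (hs : ∀ x ∈ U, x ≠ g → IsSimpleInvolution U x) : DoublingLeTwo G := by
  have hg2 := hU.add_self_ne_zero (by omega) hg hn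
  have hz := hF.zeroSumFree_cons_erase hU hg hh hgh hn
  have hcard := Multiset.card_erase_add_one hh
  have hcov := hD.exists_sum_eq hz (by rw [Multiset.card_cons]; omega)
  set n := U.count g with hn'
  obtain ⟨E, hE⟩ := Multiset.le_iff_exists_add.1 (Multiset.le_count_iff_replicate_le.1 hn'.le)
  have hEg : g ∉ E := by
    rw [← Multiset.count_eq_zero]
    have := congrArg (Multiset.count g) hE
    rw [Multiset.count_add, Multiset.count_replicate_self] at this
    omega
  have hE2 : ∀ x ∈ E, x + x = 0 := fun x hx =>
    (hs x (hE ▸ Multiset.mem_add.2 (Or.inr hx)) fun h => hEg (h ▸ hx)).2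
  have hhE : h ∈ E := by
    rw [hE] at hh
    rcases Multiset.mem_add.1 hh with h1 | h1
    · exact absurd (Multiset.eq_of_mem_replicate h1) hgh
    · exact h1
  have hEs := sum_add_sum_eq_zero hE2
  have hsum := hU.2.1
  rw [hE, Multiset.sum_add, Multiset.sum_replicate] at hsum
  have h2n : n • g + n • g = 0 := by
    rw [show n • g + n • g = (n • g + E.sum) + (n • g + E.sum) - (E.sum + E.sum) by abel, hsum, hEs]
    simp
  have hn1 : n ≠ 1 := fun h => by rw [h, one_smul] at h2n; exact hg2 h2n
  have hn0 : 0 < n := Multiset.count_pos.2 hg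
  by_cases hn2 : n = 2
  · rw [hn2] at h2n
    refine doublingLeTwo_of_cover (w := g + g) (by rw [← h2n]; abel) ?_ hcov
    intro x hx
    by_cases hxg : x = g
    · exact Or.inr (by rw [hxg])
    · refine Or.inl (hs x ?_ hxg).2
      exact Multiset.mem_of_mem_erase ((Multiset.mem_cons.1 hx).resolve_left hxg)
  exfalso
  have hzf : ZeroSumFree (Multiset.replicate (2 * n - 1) g + E.erase h) := by
    intro T hT hT0
    obtain ⟨T₁, R, h1, hR, rfl⟩ := exists_add_of_le_add hT
    obtain ⟨i, hi, rfl⟩ := Multiset.le_replicate_iff.1 h1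
    have hRE := hR.trans (Multiset.erase_le _ _)
    have hRc := Multiset.card_le_card hR
    have hEc := Multiset.card_erase_add_one hhE
    have hUc := congrArg Multiset.card hE
    rw [Multiset.card_add, Multiset.card_replicate] at hUc
    by_cases hin : i ≤ n
    · refine hU.eq_zero_of_card_lt ?_ hT0 (by simp; omega)
      rw [hE]
      exact add_le_add ((Multiset.replicate_le_replicate _).2 hin) hRE
    · exfalso
      obtain ⟨R', hR'⟩ := Multiset.le_iff_exists_add.1 hR
      have hE' : E = h ::ₘ (R + R') := by rw [← hR', Multiset.cons_erase hhE]
      have hR2 : R.sum + R.sum = 0 :=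
        sum_add_sum_eq_zero fun x hx => hE2 x (Multiset.mem_of_le hRE hx)
      rw [Multiset.sum_add, Multiset.sum_replicate] at hT0
      have hEsum : E.sum = R.sum + (h ::ₘ R').sum := by
        rw [hE']; simp only [Multiset.sum_cons, Multiset.sum_add]; abel
      have hin' : i • g = (i - n) • g + n • g := by rw [← add_nsmul]; congr 1; omega
      -- With more than `n` copies of `g`, remove `n` of them and replace `R` by its complement in
      -- `E`. Since `n g + ∑ E = 0`, this is a proper zero-sum subsequence of `U`, nonempty because
      -- it contains `h`.
      have := hU.eq_zero_of_card_lt (T := Multiset.replicate (i - n) g + h ::ₘ R') (by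
          rw [hE, hE']
          refine add_le_add ((Multiset.replicate_le_replicate _).2 (by omega)) ?_
          exact Multiset.cons_le_cons _ (Multiset.le_add_left _ _)) (by
          rw [Multiset.sum_add, Multiset.sum_replicate]
          have e1 : (i - n) • g + (h ::ₘ R').sum = (i • g + R.sum) - (n • g + n • g) -
              (R.sum + R.sum) + (n • g + E.sum) := by
            rw [hin', hEsum]; abel
          rw [e1, hT0, h2n, hR2, hsum]; simp) (by
          have := congrArg Multiset.card hE'
          simp at this ⊢; omega)
      have := congrArg Multiset.card this
      simp at this
  have := hD.card_lt hzf
  have hEc := Multiset.card_erase_add_one hhE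
  have hUc := congrArg Multiset.card hE
  simp at this hUc; omega

/-- The subsums of `U` without `h` have double 0. If they miss some `f`, adjoining `f` keeps the
sequence zero-sum free and raises its length to `D - 1`, so the group is covered and every double is
0 or `2f`. -/
theorem doublingLeTwo_of_involutions (hD : LengthBound G D) (hU : IsMinimalZeroSum U)
    (hc : U.card + 1 = D) (hs : ∀ x ∈ U, x + x = 0) : DoublingLeTwo G := by
  obtain ⟨h, hh⟩ := Multiset.exists_mem_of_ne_zero hU.1
  have hz := hU.erase hh
  have hcard := Multiset.card_erase_add_one hh
  have h2 : ∀ T ≤ U.erase h, T.sum + T.sum = 0 := fun T hT => sum_add_sum_eq_zero fun x hx =>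
    hs x (Multiset.mem_of_mem_erase (Multiset.mem_of_le hT hx))
  by_cases hcov : ∀ x, ∃ T ≤ U.erase h, T.sum = x
  · refine ⟨0, fun x => ?_⟩
    obtain ⟨T, hT, rfl⟩ := hcov x
    exact Or.inl (h2 T hT)
  push Not at hcov
  obtain ⟨f, hf⟩ := hcov
  have hzf : ZeroSumFree (f ::ₘ U.erase h) := by
    intro T hT h0
    by_cases hm : f ∈ T
    · obtain ⟨T', rfl⟩ := Multiset.exists_cons_of_mem hm
      have hT' := (Multiset.cons_le_cons_iff _).1 hT
      rw [Multiset.sum_cons] at h0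
      exact absurd (add_right_cancel ((h2 T' hT').trans h0.symm)) (hf T' hT')
    · exact hz T ((Multiset.le_cons_of_notMem hm).1 hT) h0
  refine ⟨f + f, fun x => ?_⟩
  obtain ⟨T, hT, rfl⟩ := hD.exists_sum_eq hzf (by rw [Multiset.card_cons]; omega) x
  by_cases hm : f ∈ T
  · obtain ⟨T', rfl⟩ := Multiset.exists_cons_of_mem hm
    right
    rw [Multiset.sum_cons, add_add_add_comm, h2 T' ((Multiset.cons_le_cons_iff _).1 hT), add_zero]
  · exact Or.inl (h2 T ((Multiset.le_cons_of_notMem hm).1 hT))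

/-- The cases are that no element, exactly one, or at least two different elements of `U` fail to be
simple involutions. `U = g^(D-1)` is the only source of `CyclicByTwo`. -/
theorem AlmostDissociated.doublingLeTwo_or_cyclicByTwo (hF : AlmostDissociated U)
    (hD : LengthBound G D) (hU : IsMinimalZeroSum U) (hc : U.card + 1 = D) (h4 : 4 ≤ U.card) :
    DoublingLeTwo G ∨ CyclicByTwo G := by
  by_cases hall : ∀ x ∈ U, IsSimpleInvolution U x
  · exact Or.inl (doublingLeTwo_of_involutions hD hU hc fun x hx => (hall x hx).2)
  push Not at hall
  obtain ⟨g, hg, hn⟩ := hall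
  by_cases hex : ∃ h ∈ U, h ≠ g
  · left
    obtain ⟨h, hh, hgh⟩ := hex
    by_cases huniq : ∀ x ∈ U, x ≠ g → IsSimpleInvolution U x
    · exact hF.doublingLeTwo_of_unique hD hU hc h4 hg hh hgh hn huniq
    push Not at huniq
    obtain ⟨x, hx, hxg, hnx⟩ := huniq
    have hg0 := Multiset.count_pos.2 hg
    have hx0 := Multiset.count_pos.2 hx
    by_cases hg2 : 2 ≤ U.count g
    · exact hF.doublingLeTwo_of_count_eq_two hD hU hc hx hxg
        (hF.count_eq_two hD hU hc.ge hx hxg hg2) hnx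
    by_cases hx2 : 2 ≤ U.count x
    · exact hF.doublingLeTwo_of_count_eq_two hD hU hc hg hxg.symm
        (hF.count_eq_two hD hU hc.ge hg hxg.symm hx2) hn
    exact hF.doublingLeTwo_of_count_eq_one hD hU hc h4 hg hx hxg hn hnx (by omega) (by omega)
  · right
    push Not at hex
    have hrep := Multiset.eq_replicate_card.2 hex
    refine hU.cyclicByTwo hD (by omega) (g := g) ?_ hc.ge
    conv_rhs => rw [hrep]
    exact (Multiset.replicate_le_replicate _).2 (by omega)

end AlmostDissociated

/-! ### Lengths `D` and `D - 1`: coincidences of subsums. -/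

section GapOddTotal

variable {G : Type*} [AddCommGroup G] {D : ℕ} {U V S : Multiset G} {p q z : G}

theorem NoShortZeroSum.zero_notMem {A : Multiset G} (h : NoShortZeroSum A) : (0 : G) ∉ A :=
  fun h0 => by
    have := h {0} (Multiset.singleton_le.2 h0) (by simp)
    simp at this

theorem IsMinimalZeroSum.notMem_of_sum_eq (hU : IsMinimalZeroSum U) {A : Multiset G} (hA : A ≤ U)
    {g h : G} (hh : h ∈ A) (hgh : h ≠ g) (hs : A.sum = g) : g ∉ A := fun hg => by
  obtain ⟨B, rfl⟩ := Multiset.exists_cons_of_mem hg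
  have hB : B.sum = 0 := by simpa using hs
  have := hU.eq_zero_of_card_lt ((Multiset.le_cons_self _ _).trans hA) hB
    (by have := Multiset.card_le_card hA; simp at this; omega)
  subst this
  simp at hh; exact hgh hh

theorem sum_eq_of_add_eq {A A' B B' : Multiset G} (hU : (A + A').sum = (B + B').sum)
    (hs : A.sum = B.sum) : A'.sum = B'.sum := by
  rw [Multiset.sum_add, Multiset.sum_add, hs] at hU
  exact add_left_cancel hU

theorem two_le_card_of_sum_eq {A : Multiset G} {g : G} (hg : g ∉ A) (hs : A.sum = g) (h0 : g ≠ 0) :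
    2 ≤ A.card := by
  by_contra hlt
  rcases Nat.eq_zero_or_pos A.card with h | h
  · rw [Multiset.card_eq_zero] at h; subst h; exact h0 (by simpa using hs.symm)
  · obtain ⟨a, rfl⟩ := Multiset.card_eq_one.1 (show A.card = 1 by omega)
    simp at hs hg; exact hg hs.symm

/-- The data of two minimal zero-sum sequences `U = S + {p, q}` and `V = S + {z}` of lengths `D` and
`D - 1`, such that `U + (-V)` has no factorization of length between `3` and `D - 2`. -/
structure OddGap (D : ℕ) (U V S : Multiset G) (p q z : G) : Prop where
  five_le : 5 ≤ D
  bound : LengthBound G D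
  left : IsMinimalZeroSum U
  right : IsMinimalZeroSum V
  left_eq : U = S + ({p} + {q})
  right_eq : V = S + {z}
  card_eq : S.card + 2 = D
  gap : LengthGap (D - 1) U V

variable (h : OddGap D U V S p q z)
include h

namespace OddGap

theorem card_left : U.card = D := by
  have := h.card_eq; rw [h.left_eq]; simp; omega

theorem card_right : V.card + 1 = D := by
  have := h.card_eq; rw [h.right_eq]; simp; omega

theorem symm : OddGap D U V S q p z :=
  { h with left_eq := by rw [h.left_eq, add_comm ({p} : Multiset G)] }

theorem noShort_left : NoShortZeroSum U :=
  h.left.noShortZeroSum (by have := h.card_left; have := h.five_le; omega)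

theorem noShort_right : NoShortZeroSum V :=
  h.right.noShortZeroSum (by have := h.card_right; have := h.five_le; omega)

theorem add_eq : p + q = z := by
  have h1 := h.left.2.1
  have h2 := h.right.2.1
  rw [h.left_eq] at h1
  rw [h.right_eq] at h2
  simp only [Multiset.sum_add, Multiset.sum_singleton] at h1 h2
  exact add_left_cancel (h1.trans h2.symm)

theorem ne_left : z ≠ p := fun hz => by
  have h1 := h.add_eq
  rw [hz, add_eq_left] at h1
  refine h.noShort_left.zero_notMem ?_
  rw [h.left_eq, h1]; simp

theorem ne_zero : z ≠ 0 := fun hz => h.noShort_right.zero_notMem (by rw [h.right_eq, hz]; simp)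

/-- Cancelling `A' + S` leaves `{p, q, b} = {z} + A`, and `z` differs from `p` and `q`. -/
theorem eq_of_erase_eq {A A' B' : Multiset G} {b : G} (hA : A + A' = U) (hB : b ::ₘ B' = V)
    (hAB : A' = B') : b = z ∧ A = {p} + {q} := by
  subst hAB
  have h1 : {p} + {q} + {b} = {z} + A := by
    have e1 := h.left_eq
    have e2 := h.right_eq
    rw [← hA] at e1
    rw [← hB, ← Multiset.singleton_add] at e2
    apply add_left_cancel (a := A' + S)
    have : A' + S + ({p} + {q} + {b}) = (S + ({p} + {q})) + ({b} + A') := by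
      abel
    rw [this, ← e1, e2]
    abel
  have hz : z ∈ ({p} + {q} + {b} : Multiset G) := by rw [h1]; simp
  have hzb : z = b := by
    simp only [Multiset.mem_add, Multiset.mem_singleton] at hz
    rcases hz with (hz | hz) | hz
    · exact absurd hz h.ne_left
    · exact absurd hz h.symm.ne_left
    · exact hz
  subst hzb
  refine ⟨rfl, ?_⟩
  rw [add_comm] at h1
  exact (add_left_cancel h1).symm

variable [DecidableEq G]

/-- Equal sums inside `S` would cut `U + (-V)` into three zero-sum pieces: `A` against `B`, the rest
of `S` against itself, and `p, q` against `z`. So at least `D - 1` factors occur, and the length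
inequality forces the rest of `S` to be all of `S`. -/
theorem disjoint_sums {A B : Multiset G} (hA : A ≤ S) (hB : B ≤ S) (hs : A.sum = B.sum)
    (hd : A ∩ B = 0) : A = 0 ∧ B = 0 := by
  by_contra! hne
  have hne : A ≠ 0 ∨ B ≠ 0 := by
    by_cases hA : A = 0
    · exact Or.inr (hne hA)
    · exact Or.inl hA
  obtain ⟨A', rfl⟩ := Multiset.le_iff_exists_add.1 hA
  obtain ⟨B', hB'⟩ := Multiset.le_iff_exists_add.1 hB
  have hs' := sum_eq_of_add_eq (congrArg Multiset.sum hB') hs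
  have hcard := congrArg Multiset.card hB'
  have hc := h.card_eq
  have h5 := h.five_le
  simp only [Multiset.card_add] at hcard hc
  have hne' : A' ≠ 0 ∨ B' ≠ 0 := by
    by_contra! h0
    obtain ⟨rfl, rfl⟩ := h0
    simp only [add_zero] at hB'
    subst hB'
    have : A.card ≤ (A ∩ A).card := Multiset.card_le_card (Multiset.le_inter le_rfl le_rfl)
    rw [hd] at this
    rw [Multiset.card_zero] at this hc
    omega
  obtain ⟨n₁, hn₁, h1⟩ := exists_pairFactorization_pos hs hne
  obtain ⟨n₂, hn₂, h2⟩ := exists_pairFactorization_pos hs' hne'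
  obtain ⟨n₃, hn₃, h3⟩ := exists_pairFactorization_pos (A := {p} + {q}) (B := {z})
    (by simpa using h.add_eq) (by simp)
  have hU1 : A ≤ U := h.left_eq ▸ (Multiset.le_add_right _ _).trans (Multiset.le_add_right _ _)
  have hU2 : A' ≤ U := h.left_eq ▸ (Multiset.le_add_left _ _).trans (Multiset.le_add_right _ _)
  have hU3 : {p} + {q} ≤ U := h.left_eq ▸ (Multiset.le_add_left _ _)
  have hV1 : B ≤ V := h.right_eq ▸ hB' ▸ (Multiset.le_add_right _ _).trans (Multiset.le_add_right _ _)
  have hV2 : B' ≤ V := h.right_eq ▸ hB' ▸ (Multiset.le_add_left _ _).trans (Multiset.le_add_right _ _)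
  have hV3 : {z} ≤ V := h.right_eq ▸ (Multiset.le_add_left _ _)
  have hgap := h.gap (n₁ + n₂ + n₃) (by
    rw [h.left_eq, h.right_eq, hB', ← hB']
    have := (h1.add h2).add h3
    rwa [← hB'] at this)
  have e1 := h1.three_mul_le (h.noShort_left.mono hU1) (h.noShort_right.mono hV1)
  have e2 := h2.three_mul_le (h.noShort_left.mono hU2) (h.noShort_right.mono hV2)
  have e3 := h3.three_mul_le (h.noShort_left.mono hU3) (h.noShort_right.mono hV3)
  have hi : ({p} + {q} : Multiset G) ∩ {z} = 0 := by
    rcases inter_eq_zero_or_exists_mem ({p} + {q} : Multiset G) {z} with h0 | ⟨x, hx, hx'⟩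
    · exact h0
    · simp only [Multiset.mem_singleton, Multiset.mem_add] at hx hx'
      subst hx'
      rcases hx with rfl | rfl
      · exact absurd rfl h.ne_left
      · exact absurd rfl h.symm.ne_left
  rw [hi] at e3
  rw [hd] at e1
  have hcA := card_inter_le A' B'
  simp at e1 e3
  have hpos : 0 < A.card ∨ 0 < B.card := by
    simpa [Multiset.card_pos] using hne
  omega

/-- After removing the common part, `z` lies in at most one of the two subsequences, so the other
lies in `S` and can be read inside `U`. Then `LengthGap.dichotomy` makes them complementary in `V`,
except for the relation `p + q = z`, which the hypothesis keeps out of `V`. -/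
theorem almostDissociated (hpq : ¬ ({p} + {q} : Multiset G) ≤ S) : AlmostDissociated V := by
  have hcU := h.card_left
  have hcV := h.card_right
  have hcS := h.card_eq
  have h5 := h.five_le
  have main : ∀ A B : Multiset G, A ≤ V → B ≤ V → A.sum = B.sum → A ∩ B = 0 → A ≠ B → z ∉ A →
      A + B = V := by
    intro A B hA hB hs hd hne hzA
    have hAS : A ≤ S := by
      rw [h.right_eq, add_comm, Multiset.singleton_add] at hA
      exact (Multiset.le_cons_of_notMem hzA).1 hA
    by_cases hA0 : A = 0
    · subst hA0
      rcases h.right.eq_or hB (by rw [← hs]; simp) with h0 | h0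
      · exact absurd h0.symm hne
      · rw [h0, zero_add]
    have hB0 : B ≠ 0 := by
      rintro rfl
      rcases h.right.eq_or hA (by rw [hs]; simp) with h0 | h0
      · exact hA0 h0
      · exact hzA (by rw [h0, h.right_eq]; simp)
    obtain ⟨A₁, hA₁⟩ := Multiset.le_iff_exists_add.1 hAS
    obtain ⟨B', hB'⟩ := Multiset.le_iff_exists_add.1 hB
    have hAU : A + (A₁ + ({p} + {q})) = U := by rw [h.left_eq, hA₁, add_assoc]
    set A' := A₁ + ({p} + {q}) with hA'
    have c1 := congrArg Multiset.card hAU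
    have c2 := congrArg Multiset.card hB'
    rw [Multiset.card_add] at c1 c2
    have c3 := Multiset.card_pos.2 hA0
    have c4 := Multiset.card_pos.2 hB0
    have hA'0 : A' ≠ 0 := by rw [hA']; simp
    have hi := card_inter_le A' B'
    have c5 := Multiset.card_le_card hAS
    rcases h.gap.dichotomy h.noShort_left h.noShort_right hAU hB'.symm hs
      (sum_eq_of_add_eq (by rw [hAU, ← hB', h.left.2.1, h.right.2.1]) hs) (Or.inl hA0)
      (Or.inl hA'0) with ⟨-, h1⟩ | ⟨n, n', h1, -, -, h2, h3⟩
    · have hd' : A' ∩ B' = 0 := by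
        rcases h1 with h1 | h1
        · exact h1
        · exfalso
          have hAS' : A = S := Multiset.eq_of_le_of_card_le hAS (by omega)
          have hBV : B = V := Multiset.eq_of_le_of_card_le hB (by omega)
          have : S ≤ A ∩ B := Multiset.le_inter hAS'.ge
            (by rw [hBV, h.right_eq]; exact Multiset.le_add_right _ _)
          rw [hd] at this
          have := Multiset.card_le_card this
          rw [Multiset.card_zero] at this
          omega
      have hzB : z ∈ B := by
        by_contra hzB
        have hBS : B ≤ S := by
          rw [h.right_eq, add_comm, Multiset.singleton_add] at hB
          exact (Multiset.le_cons_of_notMem hzB).1 hB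
        exact hA0 (h.disjoint_sums hAS hBS hs hd).1
      ext x
      have e1 := congrArg (Multiset.count x) hd
      have e2 := congrArg (Multiset.count x) hd'
      have e3 := congrArg (Multiset.count x) hA₁
      have e4 := congrArg (Multiset.count x) hB'
      have e5 := congrArg (Multiset.count x) h.right_eq
      rw [hA'] at e2
      simp only [Multiset.count_add, Multiset.count_inter, Multiset.count_zero,
        Multiset.count_singleton] at *
      by_cases hxz : x = z
      · subst hxz
        have := Multiset.count_pos.2 hzB
        rw [if_pos rfl] at e5
        omega
      · rw [if_neg hxz] at e5
        omega
    · exfalso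
      rw [hd] at h2
      simp only [Multiset.card_zero] at h2
      have hB1 : B.card = 1 := by omega
      have hA2 : A.card ≠ 1 := by
        intro hA1
        obtain ⟨a, rfl⟩ := Multiset.card_eq_one.1 hA1
        obtain ⟨b, rfl⟩ := Multiset.card_eq_one.1 hB1
        simp at hs hne
        exact hne hs
      obtain ⟨b, rfl⟩ := Multiset.card_eq_one.1 hB1
      have := h.eq_of_erase_eq hAU (by rw [← Multiset.singleton_add]; exact hB'.symm)
        (eq_of_card_inter (by omega) (by omega))
      exact hpq (this.2 ▸ hAS)
  intro A B hA hB hs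
  by_cases hne : A = B
  · exact Or.inl hne
  right
  have hAi : A ∩ B + (A - B) = A := by
    ext x; simp only [Multiset.count_add, Multiset.count_inter, Multiset.count_sub]; omega
  have hBi : A ∩ B + (B - A) = B := by
    ext x; simp only [Multiset.count_add, Multiset.count_inter, Multiset.count_sub]; omega
  have hs' : (A - B).sum = (B - A).sum := by
    have e1 := congrArg Multiset.sum hAi
    have e2 := congrArg Multiset.sum hBi
    rw [Multiset.sum_add] at e1 e2
    exact add_left_cancel (e1.trans (hs.trans e2.symm))
  have hd : (A - B) ∩ (B - A) = 0 := by
    ext x; simp only [Multiset.count_inter, Multiset.count_sub, Multiset.count_zero]; omega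
  have hne' : A - B ≠ B - A := fun h0 => hne (hAi.symm.trans (by rw [h0, hBi]))
  have hsum : (A - B) + (B - A) = V := by
    by_cases hz : z ∈ A - B
    · rw [add_comm]
      refine main _ _ ((Multiset.sub_le_self _ _).trans hB) ((Multiset.sub_le_self _ _).trans hA)
        hs'.symm ?_ hne'.symm fun hz' => ?_
      · rw [Multiset.inter_comm]; exact hd
      · have : z ∈ (A - B) ∩ (B - A) := Multiset.mem_inter.2 ⟨hz, hz'⟩
        rw [hd] at this; simp at this
    · exact main _ _ ((Multiset.sub_le_self _ _).trans hA) ((Multiset.sub_le_self _ _).trans hB)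
        hs' hd hne' hz
  have key : ∀ x, A.count x = 0 ∨ B.count x = 0 := by
    intro x
    have e1 := congrArg (Multiset.count x) hsum
    have e2 := Multiset.le_iff_count.1 hA x
    have e3 := Multiset.le_iff_count.1 hB x
    simp only [Multiset.count_add, Multiset.count_sub] at e1
    omega
  refine ⟨?_, fun x hx hx' => ?_⟩
  · rw [← hsum]
    ext x
    have := key x
    simp only [Multiset.count_add, Multiset.count_sub]; omega
  · have := Multiset.count_pos.2 hx
    have := Multiset.count_pos.2 hx'
    have := key x
    omega

/-- The elements of `V` as subsums of `U`. -/
theorem disjoint_or {A A' B' : Multiset G} {g : G} (hA : A + A' = U) (hB : g ::ₘ B' = V)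
    (hs : A.sum = g) (hg : g ∉ A) : A' ∩ B' = 0 ∨ g = z ∧ A = {p} + {q} := by
  have hcU := h.card_left
  have hcV := h.card_right
  have h5 := h.five_le
  have c1 := congrArg Multiset.card hA
  have c2 := congrArg Multiset.card hB
  simp only [Multiset.card_add, Multiset.card_cons] at c1 c2
  have hg0 : g ≠ 0 := by
    rintro rfl
    exact h.noShort_right.zero_notMem (by rw [← hB]; simp)
  have h2 := two_le_card_of_sum_eq hg hs hg0
  have hi := card_inter_le A' B'
  have hB1 : {g} + B' = V := by rw [← hB, Multiset.singleton_add]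
  have hd : A ∩ {g} = 0 := by
    rcases inter_eq_zero_or_exists_mem A {g} with h0 | ⟨x, hx, hx'⟩
    · exact h0
    · rw [Multiset.mem_singleton] at hx'; subst hx'; exact absurd hx hg
  rcases h.gap.dichotomy h.noShort_left h.noShort_right hA hB1 (by simpa using hs)
      (sum_eq_of_add_eq (by rw [hA, hB1, h.left.2.1, h.right.2.1]) (by simpa using hs))
      (Or.inr (by simp)) (Or.inr (fun h0 => by simp [h0] at c2; omega)) with
    ⟨-, h1⟩ | ⟨n, n', h1, -, -, h2, h3⟩
  · left
    rcases h1 with h1 | h1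
    · exact h1
    · omega
  · right
    rw [hd] at h2
    simp only [Multiset.card_zero, Multiset.card_singleton] at h2
    exact h.eq_of_erase_eq hA hB (eq_of_card_inter (by omega) (by omega))

end OddGap

end GapOddTotal

/-! ### Lengths `D` and `D - 1`: the case that `p` and `q` both occur in the common part. -/

section GapOddTotal

variable {G : Type*} [AddCommGroup G] {D : ℕ} {U V S : Multiset G} {p q z : G}

namespace OddGap

theorem mem_right (h : OddGap D U V S p q z) (hp : p ∈ S) (hq : q ∈ S) {x : G} (hx : x ∈ U) :
    x ∈ S := by
  rw [h.left_eq] at hx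
  simp only [Multiset.mem_add, Multiset.mem_singleton] at hx
  rcases hx with hx | rfl | rfl
  · exact hx
  · exact hp
  · exact hq

variable [DecidableEq G]

/-- If `g` is no sum of two elements that are exchanged, then all other elements of `U` are needed
in a subsum that gives `g`. -/
theorem eq_add_replicate (h : OddGap D U V S p q z) (hp : p ∈ S) (hq : q ∈ S) {g b : G}
    (hg : g ∈ S) (hb : b ∈ U) (hbg : b ≠ g) (hgz : g ≠ z) :
    V.count g = 1 ∧ ∃ A, A + Multiset.replicate (U.count g) g = U ∧ A.sum = g := by
  obtain ⟨A, hA, hbA, hs⟩ := h.bound.exists_mem_sum_eq h.left h.card_left.ge hb g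
  have hgA := h.left.notMem_of_sum_eq hA hbA hbg hs
  obtain ⟨A', hA'⟩ := Multiset.le_iff_exists_add.1 hA
  have hgV : g ∈ V := by rw [h.right_eq]; exact Multiset.mem_add.2 (Or.inl hg)
  have hgU : g ∈ U := by rw [h.left_eq]; exact Multiset.mem_add.2 (Or.inl hg)
  rcases h.disjoint_or hA'.symm (Multiset.cons_erase hgV) hs hgA with hd | ⟨hd, -⟩
  swap
  · exact absurd hd hgz
  -- Every element of `U` lies in `S`, hence in `V`. Disjointness of `A'` from `V` without one `g`
  -- therefore leaves only copies of `g` in `A'`, and a single `g` in `V`.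
  have hcg : A'.count g = U.count g := by
    rw [hA', Multiset.count_add, Multiset.count_eq_zero.2 hgA, zero_add]
  have hgU' := Multiset.count_pos.2 hgU
  constructor
  · have e1 := congrArg (Multiset.count g) hd
    rw [Multiset.count_inter, Multiset.count_zero, Multiset.count_erase_self] at e1
    have := Multiset.count_pos.2 hgV
    omega
  · refine ⟨A, ?_, hs⟩
    conv_rhs => rw [hA']
    congr 1
    rw [← hcg, eq_comm, Multiset.eq_replicate]
    have hall : ∀ x ∈ A', x = g := by
      intro x hx
      by_contra hxg
      have hxU : x ∈ U := hA' ▸ Multiset.mem_add.2 (Or.inr hx)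
      have hxV : x ∈ V.erase g := by
        rw [Multiset.mem_erase_of_ne hxg, h.right_eq]
        exact Multiset.mem_add.2 (Or.inl (h.mem_right hp hq hxU))
      have : x ∈ A' ∩ V.erase g := Multiset.mem_inter.2 ⟨hx, hxV⟩
      rw [hd] at this; simp at this
    exact ⟨(Multiset.count_eq_card.2 fun x hx => (hall x hx).symm).symm, hall⟩

/-- Since `p` occurs once in `V`, it occurs twice in `U`. The rest of `U` has sum `p`, so the total
is `3p`. -/
theorem three_nsmul_eq_zero (h : OddGap D U V S p q z) (hp : p ∈ S) (hq : q ∈ S) (hpq : q ≠ p) :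
    V.count p = 1 ∧ 3 • p = 0 := by
  have hqU : q ∈ U := by rw [h.left_eq]; simp
  obtain ⟨h1, A, hA, hs⟩ := h.eq_add_replicate hp hq hp hqU hpq h.ne_left.symm
  refine ⟨h1, ?_⟩
  have hU := h.left.2.1
  have e1 := congrArg (Multiset.count p) h.left_eq
  have e2 := congrArg (Multiset.count p) h.right_eq
  simp [hpq.symm, h.ne_left.symm] at e1 e2
  rw [← hA, Multiset.sum_add, Multiset.sum_replicate, hs, e1, ← e2, h1] at hU
  rw [← hU]; abel

/-- Unless `U` is a power of `p`, one finds `U = p² q² S'` with `3p = 3q = 0` and involutions `S'`.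
Doubling the sum gives `4(p + q) = 0`, so `z = p + q = 0`, which is impossible. -/
theorem cyclicByTwo (h : OddGap D U V S p q z) (hpq : ({p} + {q} : Multiset G) ≤ S) :
    CyclicByTwo G := by
  have hp : p ∈ S := Multiset.mem_of_le hpq (by simp)
  have hq : q ∈ S := Multiset.mem_of_le hpq (by simp)
  have h5 := h.five_le
  by_cases hall : ∀ x ∈ U, x = p
  · refine h.left.cyclicByTwo h.bound (by omega) (g := p) ?_ (by have := h.card_left; omega)
    conv_rhs => rw [Multiset.eq_replicate_card.2 hall, h.card_left]
    exact (Multiset.replicate_le_replicate _).2 (by omega)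
  exfalso
  push Not at hall
  obtain ⟨b, hb, hbp⟩ := hall
  have hc1 := (h.eq_add_replicate hp hq hp hb hbp h.ne_left.symm).1
  have hle := Multiset.le_iff_count.1 (hpq.trans (h.right_eq ▸ Multiset.le_add_right S {z})) p
  have hne : q ≠ p := by
    rintro rfl
    simp [hc1] at hle
  have h3p := (h.three_nsmul_eq_zero hp hq hne).2
  have h3q := h.symm.three_nsmul_eq_zero hq hp hne.symm
  obtain ⟨S', hS'⟩ := Multiset.le_iff_exists_add.1 hpq
  have hzS : z ∉ S := fun hz => by
    have hd := h.disjoint_sums hpq (Multiset.singleton_le.2 hz) (by simpa using h.add_eq) (by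
      rcases inter_eq_zero_or_exists_mem ({p} + {q} : Multiset G) {z} with h0 | ⟨x, hx, hx'⟩
      · exact h0
      · simp only [Multiset.mem_singleton, Multiset.mem_add] at hx hx'
        subst hx'
        rcases hx with rfl | rfl
        · exact absurd rfl h.ne_left
        · exact absurd rfl h.symm.ne_left)
    simp at hd
  have hcS : ∀ x, V.count x = S.count x + ({z} : Multiset G).count x := fun x => by
    rw [← Multiset.count_add, ← h.right_eq]
  have hcS' : ∀ x, S.count x = (({p} + {q} : Multiset G)).count x + S'.count x := fun x => by
    rw [← Multiset.count_add, ← hS']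
  have hpS' : p ∉ S' := by
    rw [← Multiset.count_eq_zero]
    have e1 := hcS p
    have e2 := hcS' p
    simp [hne.symm] at e2
    omega
  have hqS' : q ∉ S' := by
    rw [← Multiset.count_eq_zero]
    have e1 := hcS q
    have e2 := hcS' q
    simp [hne] at e2
    omega
  have hS2 : ∀ x ∈ S', x + x = 0 := by
    intro x hx
    have hxS : x ∈ S := hS' ▸ Multiset.mem_add.2 (Or.inr hx)
    have hxz : x ≠ z := fun h0 => hzS (h0 ▸ hxS)
    have hxp : x ≠ p := fun h0 => hpS' (h0 ▸ hx)
    have hxq : x ≠ q := fun h0 => hqS' (h0 ▸ hx)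
    obtain ⟨h1, A, hA, hs⟩ := h.eq_add_replicate hp hq hxS (b := p)
      (by rw [h.left_eq]; simp) hxp.symm hxz
    have e1 := congrArg (Multiset.count x) h.left_eq
    have e2 := hcS x
    simp [hxp, hxq, hxz] at e1 e2
    have hU := h.left.2.1
    rw [← hA, Multiset.sum_add, Multiset.sum_replicate, hs, e1, ← e2, h1, one_smul] at hU
    exact hU
  have hS2 := sum_add_sum_eq_zero hS2
  have hU := h.left.2.1
  rw [h.left_eq, hS'] at hU
  simp only [Multiset.sum_add, Multiset.sum_singleton] at hU
  apply h.ne_zero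
  rw [← h.add_eq]
  have : p + q = (S'.sum + S'.sum) + (3 • p + 3 • q) + (3 • p + 3 • q) -
      ((p + q + S'.sum + (p + q)) + (p + q + S'.sum + (p + q))) - (p + q) := by abel
  have h4 : (p + q) + (p + q) = 0 := by
    rw [hS2, h3p, h3q.2, hU] at this
    simp only [add_zero, sub_zero, zero_sub] at this
    exact eq_neg_iff_add_eq_zero.1 this
  rw [show p + q = 3 • p + 3 • q - ((p + q) + (p + q)) by abel, h4, h3p, h3q.2]; simp

theorem doublingLeTwo_or_cyclicByTwo (h : OddGap D U V S p q z) :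
    DoublingLeTwo G ∨ CyclicByTwo G := by
  by_cases hpq : ({p} + {q} : Multiset G) ≤ S
  · exact Or.inr (h.cyclicByTwo hpq)
  · have := h.five_le
    have := h.card_right
    exact (h.almostDissociated hpq).doublingLeTwo_or_cyclicByTwo h.bound h.right h.card_right
      (by omega)

end OddGap

end GapOddTotal

/-! ### Two sequences of length `D`: exchange of elements. -/

section GapEvenTotal

variable {G : Type*} [AddCommGroup G]

theorem IsMinimalZeroSum.map_neg {U : Multiset G} (hU : IsMinimalZeroSum U) :
    IsMinimalZeroSum (U.map Neg.neg) := by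
  refine ⟨fun h => hU.1 (Multiset.map_eq_zero.1 h), by rw [sum_map_neg_eq, hU.2.1, neg_zero],
    fun T hT hT0 hs => ?_⟩
  obtain ⟨N, hN, rfl⟩ := exists_le_map hT
  rw [sum_map_neg_eq, neg_eq_zero] at hs
  rw [hU.2.2 N hN (fun h => hT0 (by simp [h])) hs]

theorem PairFactorization.symm {A B : Multiset G} {n : ℕ} (h : PairFactorization A B n) :
    PairFactorization B A n := by
  induction h with
  | zero => exact .zero
  | cons hW _ ih =>
    refine .cons ?_ ih
    have := hW.map_neg
    rwa [Multiset.map_add, Multiset.map_map, show (Neg.neg ∘ Neg.neg : G → G) = id by ext; simp,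
      Multiset.map_id, add_comm] at this

theorem doublingLeTwo_of_cover_cons {M : Multiset G} {f : G} (hM : ∀ x ∈ M, x + x = 0)
    (hc : ∀ x, ∃ T ≤ f ::ₘ M, T.sum = x) : DoublingLeTwo G := by
  classical
  have h2 : ∀ T ≤ M, T.sum + T.sum = 0 := fun T hT =>
    sum_add_sum_eq_zero fun x hx => hM x (Multiset.mem_of_le hT hx)
  refine ⟨f + f, fun x => ?_⟩
  obtain ⟨T, hT, rfl⟩ := hc x
  by_cases hm : f ∈ T
  · obtain ⟨T', rfl⟩ := Multiset.exists_cons_of_mem hm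
    right
    rw [Multiset.sum_cons, add_add_add_comm, h2 T' ((Multiset.cons_le_cons_iff _).1 hT), add_zero]
  · exact Or.inl (h2 T ((Multiset.le_cons_of_notMem hm).1 hT))

variable {D : ℕ} {U V S E F : Multiset G}

/-- The data of two minimal zero-sum sequences `U = S + E` and `V = S + F` of maximal length,
where `E` and `F` have no common element, such that `U + (-V)` has no factorization of length
between `3` and `D - 2`. -/
structure EvenGap (D : ℕ) (U V S E F : Multiset G) : Prop where
  five_le : 5 ≤ D
  bound : LengthBound G D
  left : IsMinimalZeroSum U
  right : IsMinimalZeroSum V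
  left_eq : U = S + E
  right_eq : V = S + F
  card_left : U.card = D
  card_right : V.card = D
  disjoint : ∀ x ∈ E, x ∉ F
  gap : LengthGap (D - 1) U V

namespace EvenGap

/-- The element `g` is the sum of `h` and an element with which it can be exchanged. -/
def Exchanged (S E F : Multiset G) (g h : G) : Prop :=
  ∃ R ≤ S, ∃ t f d₁ d₂, {h} + {t} + {f} = E + R ∧ {g} + {d₁} + {d₂} = F + R ∧ g = h + t ∧
    f = d₁ + d₂

variable (h : EvenGap D U V S E F)
include h

theorem symm : EvenGap D V U S F E :=
  { five_le := h.five_le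
    bound := h.bound
    left := h.right
    right := h.left
    left_eq := h.right_eq
    right_eq := h.left_eq
    card_left := h.card_right
    card_right := h.card_left
    disjoint := fun x hF hE => h.disjoint x hE hF
    gap := fun n hn => h.gap n hn.symm }

theorem noShort_left : NoShortZeroSum U :=
  h.left.noShortZeroSum (by have := h.card_left; have := h.five_le; omega)

theorem noShort_right : NoShortZeroSum V := h.symm.noShort_left

theorem mem_left_of_mem {x : G} (hx : x ∈ S) : x ∈ U := by
  rw [h.left_eq]; exact Multiset.mem_add.2 (Or.inl hx)

theorem mem_right_of_mem {x : G} (hx : x ∈ S) : x ∈ V := h.symm.mem_left_of_mem hx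

theorem mem_left_of_mem' {x : G} (hx : x ∈ E) : x ∈ U := by
  rw [h.left_eq]; exact Multiset.mem_add.2 (Or.inr hx)

theorem mem_right_of_mem' {x : G} (hx : x ∈ F) : x ∈ V := h.symm.mem_left_of_mem' hx

theorem ne_zero_left {x : G} (hx : x ∈ U) : x ≠ 0 := fun h0 =>
  h.noShort_left.zero_notMem (h0 ▸ hx)

theorem ne_zero_right {x : G} (hx : x ∈ V) : x ≠ 0 := h.symm.ne_zero_left hx

theorem sum_eq : E.sum = F.sum := by
  have h1 := h.left.2.1
  have h2 := h.right.2.1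
  rw [h.left_eq, Multiset.sum_add] at h1
  rw [h.right_eq, Multiset.sum_add] at h2
  exact add_left_cancel (h1.trans h2.symm)

theorem card_eq : E.card = F.card := by
  have h1 := h.card_left
  have h2 := h.card_right
  rw [h.left_eq, Multiset.card_add] at h1
  rw [h.right_eq, Multiset.card_add] at h2
  omega

variable [DecidableEq G]

/-- Three zero-sum pieces arise. The first two allow one factor each, and the last one contributes
`3n₃ ≤ 3D - 10`. So there are at least three but fewer than `D - 1` factors. -/
theorem false_of_two_sums {A₁ A₂ A₃ B : Multiset G} {g₁ g₂ : G} (hA : A₁ + A₂ + A₃ = U)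
    (hB : {g₁} + {g₂} + B = V) (h1 : A₁.card = 2) (h2 : A₂.card = 2) (hs1 : A₁.sum = g₁)
    (hs2 : A₂.sum = g₂) : False := by
  have c1 := congrArg Multiset.card hA
  have c2 := congrArg Multiset.card hB
  rw [h.card_left] at c1
  rw [h.card_right] at c2
  have h5 := h.five_le
  simp only [Multiset.card_add, Multiset.card_singleton] at c1 c2
  have hs3 : A₃.sum = B.sum := by
    refine sum_eq_of_add_eq (A := A₁ + A₂) (B := {g₁} + {g₂})
      (by rw [hA, hB, h.left.2.1, h.right.2.1]) ?_
    simp only [Multiset.sum_add, Multiset.sum_singleton, hs1, hs2]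
  have hg : ∀ g ∈ V, ∀ A ≤ U, A.card = 2 → A.sum = g → A ∩ {g} = 0 := by
    intro g hg A hA hc hs
    rcases inter_eq_zero_or_exists_mem A {g} with h0 | ⟨x, hx, hx'⟩
    · exact h0
    exfalso
    rw [Multiset.mem_singleton] at hx'
    subst hx'
    obtain ⟨A', rfl⟩ := Multiset.exists_cons_of_mem hx
    obtain ⟨y, rfl⟩ := Multiset.card_eq_one.1 (show A'.card = 1 by simpa using hc)
    refine h.ne_zero_left (Multiset.mem_of_le hA (show y ∈ _ by simp)) ?_
    simpa using hs
  have hA1 : A₁ ≤ U := by rw [← hA, add_assoc]; exact Multiset.le_add_right _ _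
  have hA2 : A₂ ≤ U := by rw [← hA, add_right_comm]; exact Multiset.le_add_left _ _
  have hA3 : A₃ ≤ U := by rw [← hA]; exact Multiset.le_add_left _ _
  have hg1 : g₁ ∈ V := by rw [← hB]; simp
  have hg2 : g₂ ∈ V := by rw [← hB]; simp
  have hB3 : B ≤ V := by rw [← hB]; exact Multiset.le_add_left _ _
  obtain ⟨n₁, hn₁, p1⟩ := exists_pairFactorization_pos (A := A₁) (B := {g₁}) (by simpa using hs1)
    (by simp)
  obtain ⟨n₂, hn₂, p2⟩ := exists_pairFactorization_pos (A := A₂) (B := {g₂}) (by simpa using hs2)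
    (by simp)
  obtain ⟨n₃, hn₃, p3⟩ := exists_pairFactorization_pos (A := A₃) (B := B) hs3
    (by right; rintro rfl; simp at c2; omega)
  have hgap := h.gap (n₁ + n₂ + n₃) (by rw [← hA, ← hB]; exact (p1.add p2).add p3)
  have e1 := p1.three_mul_le (h.noShort_left.mono hA1)
    (h.noShort_right.mono (Multiset.singleton_le.2 hg1))
  have e2 := p2.three_mul_le (h.noShort_left.mono hA2)
    (h.noShort_right.mono (Multiset.singleton_le.2 hg2))
  have e3 := p3.three_mul_le (h.noShort_left.mono hA3) (h.noShort_right.mono hB3)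
  rw [hg g₁ hg1 A₁ hA1 h1 hs1] at e1
  rw [hg g₂ hg2 A₂ hA2 h2 hs2] at e2
  have := card_inter_le A₃ B
  simp only [Multiset.card_zero, Multiset.card_singleton] at *
  omega

/-- The elements of `V` as subsums of `U`. -/
theorem disjoint_or {A A' B' : Multiset G} {g : G} (hA : A + A' = U) (hB : g ::ₘ B' = V)
    (hs : A.sum = g) (hg : g ∉ A) : A' ∩ B' = 0 ∨
      (A.card = 2 ∧ ∃ C f d₁ d₂, A' = C + {f} ∧ B' = C + ({d₁} + {d₂}) ∧ f = d₁ + d₂) := by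
  have hcU := h.card_left
  have hcV := h.card_right
  have h5 := h.five_le
  have c1 := congrArg Multiset.card hA
  have c2 := congrArg Multiset.card hB
  simp only [Multiset.card_add, Multiset.card_cons] at c1 c2
  have hg0 : g ≠ 0 := h.ne_zero_right (by rw [← hB]; simp)
  have hA2 := two_le_card_of_sum_eq hg hs hg0
  have hi := card_inter_le A' B'
  have hB1 : {g} + B' = V := by rw [← hB, Multiset.singleton_add]
  have hd : A ∩ {g} = 0 := by
    rcases inter_eq_zero_or_exists_mem A {g} with h0 | ⟨x, hx, hx'⟩
    · exact h0
    · rw [Multiset.mem_singleton] at hx'; subst hx'; exact absurd hx hg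
  have hs' : A'.sum = B'.sum :=
    sum_eq_of_add_eq (by rw [hA, hB1, h.left.2.1, h.right.2.1]) (by simpa using hs)
  rcases h.gap.dichotomy h.noShort_left h.noShort_right hA hB1 (by simpa using hs) hs'
      (Or.inr (by simp)) (Or.inr (fun h0 => by simp [h0] at c2; omega)) with
    ⟨-, h1⟩ | ⟨n, n', h1, -, -, h2, h3⟩
  · left
    rcases h1 with h1 | h1
    · exact h1
    · omega
  · right
    rw [hd] at h2
    simp only [Multiset.card_zero, Multiset.card_singleton] at h2
    obtain ⟨X, hX⟩ := Multiset.le_iff_exists_add.1 (Multiset.inter_le_left : A' ∩ B' ≤ A')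
    obtain ⟨Y, hY⟩ := Multiset.le_iff_exists_add.1 (Multiset.inter_le_right : A' ∩ B' ≤ B')
    have c3 := congrArg Multiset.card hX
    have c4 := congrArg Multiset.card hY
    rw [Multiset.card_add] at c3 c4
    have hXY : X.sum = Y.sum := by
      have e1 := congrArg Multiset.sum hX
      have e2 := congrArg Multiset.sum hY
      rw [Multiset.sum_add] at e1 e2
      exact add_left_cancel (e1.symm.trans (hs'.trans e2))
    -- The length inequality yields `|A' ∩ B'| ≥ D - 3`, while `|A'| ≤ D - 2`. Once `X` is nonempty,
    -- everything is determined: `|A| = 2`, `|X| = 1`, `|Y| = 2`.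
    have hX0 : X.card ≠ 0 := by
      intro h0
      rw [Multiset.card_eq_zero.1 h0, Multiset.sum_zero] at hXY
      have hYB : Y ≤ B' := by rw [hY]; exact Multiset.le_add_left _ _
      have := h.right.eq_zero_of_card_lt (hYB.trans (by rw [← hB]; exact Multiset.le_cons_self _ _))
        hXY.symm (by have := Multiset.card_le_card hYB; omega)
      rw [this, Multiset.card_zero] at c4
      omega
    refine ⟨by omega, A' ∩ B', ?_⟩
    obtain ⟨f, rfl⟩ := Multiset.card_eq_one.1 (show X.card = 1 by omega)
    obtain ⟨d₁, d₂, rfl⟩ := Multiset.card_eq_two.1 (show Y.card = 2 by omega)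
    exact ⟨f, d₁, d₂, hX, hY, by simpa using hXY⟩

/-- Removing the common part `C` from `U` and `V` must leave `E` and `F`, which are disjoint,
together with the same remainder `R` of `S`. -/
theorem exchange {A B' C : Multiset G} {g f d₁ d₂ : G} (hA : A + (C + {f}) = U)
    (hB : g ::ₘ B' = V) (hB' : B' = C + ({d₁} + {d₂})) :
    ∃ R ≤ S, A + {f} = E + R ∧ {g} + {d₁} + {d₂} = F + R := by
  have e1 := h.left_eq
  have e2 := h.right_eq
  rw [← hA] at e1
  rw [← hB, ← Multiset.singleton_add, hB'] at e2
  have key : ∀ x, E.count x = 0 ∨ F.count x = 0 := by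
    intro x
    by_cases hx : x ∈ E
    · exact Or.inr (Multiset.count_eq_zero.2 (h.disjoint x hx))
    · exact Or.inl (Multiset.count_eq_zero.2 hx)
  have hE : E ≤ A + {f} := by
    rw [Multiset.le_iff_count]
    intro x
    have e3 := congrArg (Multiset.count x) e1
    have e4 := congrArg (Multiset.count x) e2
    simp only [Multiset.count_add] at e3 e4 ⊢
    have := key x
    omega
  obtain ⟨R, hR⟩ := Multiset.le_iff_exists_add.1 hE
  have hS : S = C + R := by
    apply add_right_cancel (b := E)
    rw [← e1, add_assoc, add_comm R E, ← hR]; abel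
  refine ⟨R, by rw [hS]; exact Multiset.le_add_left _ _, hR, ?_⟩
  apply add_left_cancel (a := C)
  rw [hS] at e2
  calc C + ({g} + {d₁} + {d₂}) = {g} + (C + ({d₁} + {d₂})) := by abel
    _ = _ := by rw [e2]; abel

/-- If `g` is not a sum of two exchanged elements, then all elements of `S` other than `g` are
needed in a subsum of `U` that gives `g`. -/
theorem exists_sum_eq_zero {A A' : Multiset G} {g b : G} (hg : g ∈ S) (hgE : g ∉ E)
    (hA : A + A' = U) (hgA : g ∉ A) (hs : A.sum = g) (hbA : b ∈ A) (hd : A' ∩ V.erase g = 0) :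
    V.count g = 1 ∧ ∃ E₂ ≤ E, (b ∉ S → E₂ ≤ E.erase b) ∧ g + g + E₂.sum = 0 := by
  have hgV := h.mem_right_of_mem hg
  have hgU := h.mem_left_of_mem hg
  have hcg : A'.count g = U.count g := by
    rw [← hA, Multiset.count_add, Multiset.count_eq_zero.2 hgA, zero_add]
  have hgU' := Multiset.count_pos.2 hgU
  have hgV' := Multiset.count_pos.2 hgV
  have e1 := congrArg (Multiset.count g) hd
  rw [Multiset.count_inter, Multiset.count_zero, Multiset.count_erase_self] at e1
  have hV1 : V.count g = 1 := by omega
  have hgE' := Multiset.count_eq_zero.2 hgE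
  have hS1 : S.count g = 1 := by
    have := congrArg (Multiset.count g) h.right_eq
    have := Multiset.count_pos.2 hg
    rw [Multiset.count_add] at *
    omega
  have hle : ∀ x, x ≠ g → x ∈ S → A'.count x = 0 := by
    intro x hxg hxS
    have hx3 := congrArg (Multiset.count x) hd
    rw [Multiset.count_inter, Multiset.count_zero, Multiset.count_erase_of_ne hxg] at hx3
    have := Multiset.count_pos.2 (h.mem_right_of_mem hxS)
    omega
  have hcount : ∀ x, A.count x + A'.count x = U.count x ∧ U.count x = S.count x + E.count x :=
    fun x => ⟨by rw [← hA, Multiset.count_add], by rw [h.left_eq, Multiset.count_add]⟩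
  refine ⟨hV1, A'.erase g, ?_, fun hbS => ?_, ?_⟩
  · rw [Multiset.le_iff_count]
    intro x
    have := hcount x
    by_cases hxg : x = g
    · subst hxg
      rw [Multiset.count_erase_self]
      omega
    rw [Multiset.count_erase_of_ne hxg]
    by_cases hxS : x ∈ S
    · rw [hle x hxg hxS]; exact Nat.zero_le _
    · have := Multiset.count_eq_zero.2 hxS
      omega
  · have hbA' := Multiset.count_pos.2 hbA
    have hbS' := Multiset.count_eq_zero.2 hbS
    have hbg : b ≠ g := fun h0 => hgA (h0 ▸ hbA)
    rw [Multiset.le_iff_count]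
    intro x
    have := hcount x
    by_cases hxg : x = g
    · subst hxg
      rw [Multiset.count_erase_self]
      omega
    rw [Multiset.count_erase_of_ne hxg]
    by_cases hxS : x ∈ S
    · rw [hle x hxg hxS]; exact Nat.zero_le _
    · have hxS' := Multiset.count_eq_zero.2 hxS
      by_cases hxb : x = b
      · subst hxb
        rw [Multiset.count_erase_self]
        omega
      · rw [Multiset.count_erase_of_ne hxb]; omega
  · have hgA' : g ∈ A' := Multiset.count_pos.1 (by omega)
    have hU := h.left.2.1
    rw [← hA, ← Multiset.cons_erase hgA', Multiset.sum_add, Multiset.sum_cons, hs] at hU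
    rw [← hU]; abel

theorem exchanged_of_mem {A A' : Multiset G} {g b s : G} (hg : g ∈ V) (hA : A + A' = U)
    (hs : A.sum = g) (hgA : g ∉ A) (hbA : b ∈ A) (hs' : s ∈ A') (hsV : s ∈ V.erase g) :
    Exchanged S E F g b := by
  rcases h.disjoint_or hA (Multiset.cons_erase hg) hs hgA with hd | ⟨h2, C, f, d₁, d₂, h3, h4, h5⟩
  · have : s ∈ A' ∩ V.erase g := Multiset.mem_inter.2 ⟨hs', hsV⟩
    rw [hd] at this; simp at this
  · rw [h3] at hA
    obtain ⟨R, hR, h6, h7⟩ := h.exchange hA (Multiset.cons_erase hg) h4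
    obtain ⟨A₁, rfl⟩ := Multiset.exists_cons_of_mem hbA
    obtain ⟨t, rfl⟩ := Multiset.card_eq_one.1 (show A₁.card = 1 by simpa using h2)
    refine ⟨R, hR, t, f, d₁, d₂, h6, h7, ?_, h5⟩
    rw [← hs]; simp

theorem exists_sum_or_exchanged {g b : G} (hg : g ∈ V) (hb : b ∈ U) (hne : b ≠ g) :
    Exchanged S E F g b ∨ ∃ A A', A + A' = U ∧ b ∈ A ∧ g ∉ A ∧ A.sum = g ∧
      A' ∩ V.erase g = 0 := by
  obtain ⟨A, hA, hbA, hs⟩ := h.bound.exists_mem_sum_eq h.left h.card_left.ge hb g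
  have hgA := h.left.notMem_of_sum_eq hA hbA hne hs
  obtain ⟨A', hA'⟩ := Multiset.le_iff_exists_add.1 hA
  rcases inter_eq_zero_or_exists_mem A' (V.erase g) with hd | ⟨s, hs', hsV⟩
  · exact Or.inr ⟨A, A', hA'.symm, hbA, hgA, hs, hd⟩
  · exact Or.inl (h.exchanged_of_mem hg hA'.symm hs hgA hbA hs' hsV)

/-- Choose a subsum of `U` equal to `g` that avoids `g`. A second copy of `g` in `V` then lies in
both complements, which rules out the disjoint alternative. -/
theorem exchanged_of_two_le_count {g b : G} (hg : g ∈ U) (hc : 2 ≤ V.count g) (hb : b ∈ U)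
    (hne : b ≠ g) : Exchanged S E F g b := by
  rcases h.exists_sum_or_exchanged (Multiset.count_pos.1 (by omega)) hb hne with
    h1 | ⟨A, A', hA, hbA, hgA, hs, hd⟩
  · exact h1
  exfalso
  have : g ∈ A' ∩ V.erase g := by
    rw [← hA] at hg
    refine Multiset.mem_inter.2 ⟨(Multiset.mem_add.1 hg).resolve_left hgA,
      Multiset.count_pos.1 ?_⟩
    rw [Multiset.count_erase_self]; omega
  rw [hd] at this; simp at this

theorem exists_sum_eq_zero_or_exchanged {g b : G} (hg : g ∈ S) (hgE : g ∉ E) (hb : b ∈ U)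
    (hne : b ≠ g) : Exchanged S E F g b ∨
      (V.count g = 1 ∧ ∃ E₂ ≤ E, (b ∉ S → E₂ ≤ E.erase b) ∧ g + g + E₂.sum = 0) := by
  rcases h.exists_sum_or_exchanged (h.mem_right_of_mem hg) hb hne with
    h1 | ⟨A, A', hA, hbA, hgA, hs, hd⟩
  · exact Or.inl h1
  · exact Or.inr (h.exists_sum_eq_zero hg hgE hA hgA hs hbA hd)

end EvenGap

end GapEvenTotal

/-! ### Two sequences of length `D` that are equal or differ in two elements. -/

section EvenGapCases

variable {G : Type*} [AddCommGroup G]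

/-- A group covered by the subsums of a sequence over `⟨g⟩ ∪ (g' + ⟨g⟩)` with an involution `g'`. -/
theorem cyclicByTwo_of_cover {M : Multiset G} {g t : G} (ht : t + t = 0)
    (hM : ∀ x ∈ M, ∃ k : ℤ, x = k • g ∨ x = k • g + t) (hc : ∀ x, ∃ T ≤ M, T.sum = x) :
    CyclicByTwo G := by
  refine ⟨g, t, ht, fun x => ?_⟩
  obtain ⟨T, hT, rfl⟩ := hc x
  have hT' : ∀ x ∈ T, ∃ k : ℤ, x = k • g ∨ x = k • g + t :=
    fun x hx => hM x (Multiset.mem_of_le hT hx)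
  clear hT
  induction T using Multiset.induction with
  | empty => exact ⟨0, Or.inl (by simp)⟩
  | cons a T ih =>
    obtain ⟨k, hk⟩ := hT' a (Multiset.mem_cons_self _ _)
    obtain ⟨l, hl⟩ := ih fun x hx => hT' x (Multiset.mem_cons_of_mem hx)
    refine ⟨k + l, ?_⟩
    rw [Multiset.sum_cons]
    rcases hk with hk | hk <;> rcases hl with hl | hl <;> rw [hk, hl]
    · left; module
    · right; module
    · right; module
    · left
      rw [show k • g + t + (l • g + t) = (k + l) • g + (t + t) by module, ht, add_zero]

theorem eq_replicate_of_forall {α : Type*} {M : Multiset α} {a : α} (h : ∀ x ∈ M, x = a) :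
    M = Multiset.replicate M.card a := Multiset.eq_replicate_card.2 h

namespace EvenGap

variable {D : ℕ} {U V S E F : Multiset G}

theorem cover (h : EvenGap D U V S E F) (x : G) : ∃ T ≤ U, T.sum = x := by
  classical
  have h5 := h.five_le
  obtain ⟨a, ha⟩ := Multiset.card_pos_iff_exists_mem.1 (show 0 < U.card by rw [h.card_left]; omega)
  obtain ⟨T, hT, hs⟩ := h.bound.exists_sum_eq_erase h.left h.card_left.ge ha x
  exact ⟨T, hT.trans (Multiset.erase_le _ _), hs⟩

theorem cyclicByTwo_of_forall (h : EvenGap D U V S E F) {T : Multiset G} {g : G} (hT : T ≤ U)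
    (hg : ∀ x ∈ T, x = g) (hc : D ≤ T.card + 2) : CyclicByTwo G := by
  refine h.left.cyclicByTwo h.bound (by have := h.five_le; omega) (g := g) ?_
    (by rw [h.card_left]; omega)
  refine le_trans ?_ hT
  rw [eq_replicate_of_forall hg]
  exact (Multiset.replicate_le_replicate _).2 (by omega)

theorem pair_le_of_exchanged (h : EvenGap D U V S 0 0) {g b : G} (hx : Exchanged S 0 0 g b) :
    ({b} + {g - b} : Multiset G) ≤ U := by
  obtain ⟨R, hR, t, f, d₁, d₂, h1, h2, h3, h4⟩ := hx
  rw [zero_add] at h1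
  rw [show g - b = t by rw [h3]; abel, h.left_eq, add_zero]
  exact (Multiset.le_add_right _ _).trans (h1.trans_le hR)

/-- Two different pairs with sum `g` are disjoint. Matching them against each other leaves room for
at most `1 + (D - 3)` factors, and minimality of both halves would force `|U| = 4`. -/
theorem eq_or_eq_of_pairs [DecidableEq G] (h : EvenGap D U U U 0 0) {g a b : G}
    (ha : ({a} + {g - a} : Multiset G) ≤ U) (hb : ({b} + {g - b} : Multiset G) ≤ U) :
    b = a ∨ b = g - a := by
  by_contra! hne
  obtain ⟨A', hA'⟩ := Multiset.le_iff_exists_add.1 ha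
  obtain ⟨B', hB'⟩ := Multiset.le_iff_exists_add.1 hb
  have h5 := h.five_le
  have hc := h.card_left
  have c1 := congrArg Multiset.card hA'
  have c2 := congrArg Multiset.card hB'
  simp only [Multiset.card_add, Multiset.card_singleton] at c1 c2
  have hd : ∀ x, ({a} + {g - a} : Multiset G).count x = 0 ∨
      ({b} + {g - b} : Multiset G).count x = 0 := by
    intro x
    by_cases hx : x ∈ ({a} + {g - a} : Multiset G)
    · right
      rw [Multiset.count_eq_zero]
      intro hx'
      simp only [Multiset.mem_add, Multiset.mem_singleton] at hx hx'
      rcases hx with rfl | rfl <;> rcases hx' with hx' | hx'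
      · exact hne.1 hx'.symm
      · exact hne.2 (by rw [hx']; abel)
      · exact hne.2 hx'.symm
      · exact hne.1 (sub_right_injective hx').symm
    · exact Or.inl (Multiset.count_eq_zero.2 hx)
  have hi : ({a} + {g - a} : Multiset G) ∩ ({b} + {g - b}) = 0 := by
    ext x
    rw [Multiset.count_inter, Multiset.count_zero]
    have := hd x; omega
  have hi' : A' ∩ B' + (({a} + {g - a}) + ({b} + {g - b})) = U := by
    ext x
    have e1 := congrArg (Multiset.count x) hA'
    have e2 := congrArg (Multiset.count x) hB'
    have := hd x
    simp only [Multiset.count_add, Multiset.count_inter] at *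
    omega
  have c3 := congrArg Multiset.card hi'
  simp only [Multiset.card_add, Multiset.card_singleton] at c3
  have hs : ({a} + {g - a} : Multiset G).sum = ({b} + {g - b} : Multiset G).sum := by simp
  rcases h.gap.dichotomy h.noShort_left h.noShort_left hA'.symm hB'.symm hs
    (sum_eq_of_add_eq (by rw [← hA', ← hB']) hs) (Or.inl (by simp))
    (Or.inl (by rintro rfl; simp at c1; omega)) with ⟨-, h1⟩ | ⟨n, n', h1, -, -, h2, h3⟩
  · rcases h1 with h1 | h1
    · rw [h1] at c3; simp at c3; omega
    · omega
  · rw [hi] at h2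
    simp at h2
    omega

/-- If `g` in `U` is not an involution, each `b ≠ g` in `U` belongs to a pair in `U` with sum `g`,
and there is only one such pair. So `U` has support in `{g, b, g - b}`. Repeating this with `b` in
place of `g`, unless `2b = 0`, relates `b` to `g` up to an involution. -/
theorem doublingLeTwo_or_cyclicByTwo_of_eq (h : EvenGap D U U U 0 0) :
    DoublingLeTwo G ∨ CyclicByTwo G := by
  classical
  have key : ∀ g ∈ U, ∀ b ∈ U, b ≠ g → g + g = 0 ∨ ({b} + {g - b} : Multiset G) ≤ U := by
    intro g hg b hb hne
    rcases h.exists_sum_eq_zero_or_exchanged hg (by simp) hb hne with h1 | ⟨-, E₂, hE, -, h1⟩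
    · exact Or.inr (h.pair_le_of_exchanged h1)
    · left
      rw [Multiset.le_zero.1 hE] at h1
      simpa using h1
  by_cases hall : ∀ g ∈ U, g + g = 0
  · exact Or.inl (doublingLeTwo_of_cover (w := 0) (by simp) (fun x hx => Or.inl (hall x hx)) h.cover)
  push Not at hall
  obtain ⟨g, hg, hg2⟩ := hall
  right
  by_cases hall : ∀ x ∈ U, x = g
  · exact h.cyclicByTwo_of_forall le_rfl hall (by rw [h.card_left]; omega)
  push Not at hall
  obtain ⟨b, hb, hbg⟩ := hall
  have hp := (key g hg b hb hbg).resolve_left hg2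
  have hsupp : ∀ x ∈ U, x = g ∨ x = b ∨ x = g - b := by
    intro x hx
    by_cases hxg : x = g
    · exact Or.inl hxg
    · exact Or.inr (h.eq_or_eq_of_pairs hp ((key g hg x hx hxg).resolve_left hg2))
  by_cases hb2 : b + b = 0
  · refine cyclicByTwo_of_cover (g := g) hb2 (fun x hx => ?_) h.cover
    rcases hsupp x hx with rfl | rfl | rfl
    · exact ⟨1, Or.inl (by simp)⟩
    · exact ⟨0, Or.inr (by simp)⟩
    · refine ⟨1, Or.inr ?_⟩
      rw [one_smul, sub_eq_iff_eq_add, add_assoc, hb2, add_zero]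
  have hq := (key b hb g hg (Ne.symm hbg)).resolve_left hb2
  have hq' := Multiset.mem_of_le hq (show b - g ∈ _ by simp)
  rcases hsupp _ hq' with h1 | h1 | h1
  · refine cyclicByTwo_of_cover (g := g) (t := 0) (by simp) (fun x hx => ?_) h.cover
    have hb' : b = (2 : ℤ) • g := by rw [sub_eq_iff_eq_add] at h1; rw [h1]; module
    rcases hsupp x hx with rfl | rfl | rfl
    · exact ⟨1, by simp⟩
    · exact ⟨2, Or.inl hb'⟩
    · exact ⟨-1, Or.inl (by rw [hb']; module)⟩
  · exact absurd (sub_eq_self.1 h1) (h.ne_zero_left hg)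
  · have h2 : (g - b) + (g - b) = 0 := by nth_rewrite 2 [← h1]; abel
    refine cyclicByTwo_of_cover (g := g) h2 (fun x hx => ?_) h.cover
    rcases hsupp x hx with rfl | rfl | rfl
    · exact ⟨1, Or.inl (by simp)⟩
    · refine ⟨1, Or.inr ?_⟩
      rw [← h1]; module
    · exact ⟨0, Or.inr (by simp)⟩

section Two

variable {x y u v : G} (h : EvenGap D U V S ({x} + {y}) ({u} + {v}))
include h

theorem swap_left : EvenGap D U V S ({y} + {x}) ({u} + {v}) := by
  rwa [show ({x} + {y} : Multiset G) = {y} + {x} from add_comm _ _] at h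

theorem swap_right : EvenGap D U V S ({x} + {y}) ({v} + {u}) := by
  rwa [show ({u} + {v} : Multiset G) = {v} + {u} from add_comm _ _] at h

theorem add_eq_add : x + y = u + v := by
  have := h.sum_eq
  simpa using this

theorem pair_ne : x ≠ u ∧ x ≠ v ∧ y ≠ u ∧ y ≠ v := by
  have h1 := h.disjoint x (by simp)
  have h2 := h.disjoint y (by simp)
  simp only [Multiset.mem_add, Multiset.mem_singleton, not_or] at h1 h2
  exact ⟨h1.1, h1.2, h2.1, h2.2⟩

theorem pair_ne_zero : x ≠ 0 ∧ y ≠ 0 ∧ u ≠ 0 ∧ v ≠ 0 :=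
  ⟨h.ne_zero_left (h.mem_left_of_mem' (by simp)), h.ne_zero_left (h.mem_left_of_mem' (by simp)),
    h.ne_zero_right (h.mem_right_of_mem' (by simp)), h.ne_zero_right (h.mem_right_of_mem' (by simp))⟩

omit h in
theorem exists_of_exchanged {g b : G} (hx : Exchanged S ({x} + {y}) ({u} + {v}) g b) :
    ∃ r ∈ S, ∃ t f d₁ d₂, ({b} + {t} + {f} : Multiset G) = {x} + {y} + {r} ∧
      ({g} + {d₁} + {d₂} : Multiset G) = {u} + {v} + {r} ∧ g = b + t ∧ f = d₁ + d₂ := by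
  obtain ⟨R, hR, t, f, d₁, d₂, h1, h2, h3, h4⟩ := hx
  have c := congrArg Multiset.card h1
  simp only [Multiset.card_add, Multiset.card_singleton] at c
  obtain ⟨r, rfl⟩ := Multiset.card_eq_one.1 (show R.card = 1 by omega)
  exact ⟨r, Multiset.singleton_le.1 hR, t, f, d₁, d₂, h1, h2, h3, h4⟩

/-- As `u` occurs twice in `V`, every `b ≠ u` in `U` is one of two elements with sum `u` among `x,
y, r`. The third of these is `x` or `y`, because `f = r` would give `v = 0`. -/
theorem support_of_mem [DecidableEq G] (hu : u ∈ S) {b : G} (hb : b ∈ U) (hbu : b ≠ u) :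
    (u - x ∈ S ∧ (b = x ∨ b = u - x)) ∨ (u - y ∈ S ∧ (b = y ∨ b = u - y)) := by
  have hc : 2 ≤ V.count u := by
    have := Multiset.count_pos.2 hu
    rw [h.right_eq, Multiset.count_add, Multiset.count_add, Multiset.count_singleton_self]
    omega
  obtain ⟨r, hr, t, f, d₁, d₂, h1, h2, h3, h4⟩ := exists_of_exchanged
    (h.exchanged_of_two_le_count (h.mem_left_of_mem hu) hc hb hbu)
  have h2' : d₁ + d₂ = v + r := by
    have := congrArg Multiset.sum h2
    simp only [Multiset.sum_add, Multiset.sum_singleton, add_assoc] at this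
    exact add_left_cancel this
  have hfm : f ∈ ({x} + {y} + {r} : Multiset G) := by rw [← h1]; simp
  have main : ∀ x y, ({b} + {t} + {f} : Multiset G) = {x} + {y} + {r} → f = y →
      u - x ∈ S ∧ (b = x ∨ b = u - x) := by
    rintro x y h1 rfl
    have h5 : ({b} + {t} : Multiset G) = {x} + {r} := by
      apply add_right_cancel (b := {f})
      rw [h1]; abel
    have h6 : b + t = x + r := by simpa using congrArg Multiset.sum h5
    have h7 : r = u - x := by rw [h3, h6]; abel
    refine ⟨h7 ▸ hr, ?_⟩
    have : b ∈ ({x} + {r} : Multiset G) := by rw [← h5]; simp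
    rw [← h7]
    simpa using this
  simp only [Multiset.mem_add, Multiset.mem_singleton] at hfm
  rcases hfm with (hf | hf) | hf
  · exact Or.inr (main y x (by rw [h1]; abel) hf)
  · exact Or.inl (main x y h1 hf)
  · exact absurd (by rw [← h2', ← h4, hf] : v + r = r) (by simpa using h.pair_ne_zero.2.2.2)

/-- Two disjoint pairs `x, u - x` and `y, u - y` in `U` would be matched against the two copies of
`u` in `V`, contrary to `false_of_two_sums`. This leaves no room for `x ≠ y` or for a second copy of
`u - x` in `S`. -/
theorem structure_of_mem [DecidableEq G] (hu : u ∈ S) :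
    x = y ∧ u - x ∈ S ∧ S.count (u - x) = 1 ∧ ∀ b ∈ U, b = u ∨ b = x ∨ b = u - x := by
  obtain ⟨hn1, hn2, hn3, hn4⟩ := h.pair_ne
  obtain ⟨hx0, hy0, hu0, hv0⟩ := h.pair_ne_zero
  have hz := h.add_eq_add
  have hux : u - x ∈ S := by
    rcases h.support_of_mem hu (h.mem_left_of_mem' (show x ∈ _ by simp)) hn1 with h1 | ⟨h1, h2 | h2⟩
    · exact h1.1
    · rw [h2]; exact h1
    · exact absurd (by rw [← sub_add_cancel u y, ← h2] at hz; simpa using hz) hv0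
  have huy : u - y ∈ S := by
    rcases h.support_of_mem hu (h.mem_left_of_mem' (show y ∈ _ by simp)) hn3 with
      ⟨h1, h2 | h2⟩ | h1
    · rw [h2]; exact h1
    · exact absurd (by rw [h2] at hz; simpa using hz) hv0
    · exact h1.1
  have hVu : ∃ B, {u} + {u} + B = V := by
    refine ⟨S.erase u + {v}, ?_⟩
    obtain ⟨S', rfl⟩ := Multiset.exists_cons_of_mem hu
    rw [h.right_eq, Multiset.erase_cons_head, ← Multiset.singleton_add]; abel
  obtain ⟨B, hB⟩ := hVu
  have hfalse : ∀ a b, ({a} + {b} : Multiset G) ≤ S → a = u - x → b = u - y → False := by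
    rintro a b hab rfl rfl
    obtain ⟨T, hT⟩ := Multiset.le_iff_exists_add.1 hab
    refine h.false_of_two_sums (A₁ := {x} + {u - x}) (A₂ := {y} + {u - y}) (A₃ := T) ?_ hB
      (by simp) (by simp) (by simp) (by simp)
    rw [h.left_eq, hT]; abel
  have hxy : x = y := by
    by_contra hne
    refine hfalse _ _ ?_ rfl rfl
    rw [Multiset.singleton_add, Multiset.cons_le_of_notMem (by simpa [sub_right_inj] using hne)]
    exact ⟨hux, Multiset.singleton_le.2 huy⟩
  subst hxy
  refine ⟨rfl, hux, ?_, fun b hb => ?_⟩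
  · have := Multiset.count_pos.2 hux
    by_contra hc
    refine hfalse _ _ ?_ rfl rfl
    rw [show ({u - x} + {u - x} : Multiset G) = Multiset.replicate 2 (u - x) from rfl,
      ← Multiset.le_count_iff_replicate_le]
    omega
  · by_cases hbu : b = u
    · exact Or.inl hbu
    · right
      rcases h.support_of_mem hu hb hbu with h1 | h1
      · exact h1.2
      · exact h1.2

/-- The support of `U` lies in `{u, x, u - x}`, which suffices if `2(u - x) = 0`. Otherwise `x` is
not in `S`, as symmetry would put both `u - x` and `x - u` there. So `V` contains `u` at least `D -
2` times. -/
theorem cyclicByTwo_of_mem [DecidableEq G] (hu : u ∈ S) : CyclicByTwo G := by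
  obtain ⟨h1, h2, h3, h4⟩ := h.structure_of_mem hu
  have h5 := h.five_le
  by_cases hr : (u - x) + (u - x) = 0
  · refine cyclicByTwo_of_cover (g := x) hr (fun b hb => ?_) h.cover
    rcases h4 b hb with rfl | rfl | rfl
    · exact ⟨1, Or.inr (by simp)⟩
    · exact ⟨1, Or.inl (by simp)⟩
    · exact ⟨0, Or.inr (by simp)⟩
  have hxS : x ∉ S := by
    intro hx
    obtain ⟨-, h5, -, -⟩ := h.symm.structure_of_mem hx
    have hle : ({u - x} + {x - u} : Multiset G) ≤ S := by
      rw [Multiset.singleton_add, Multiset.cons_le_of_notMem]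
      · exact ⟨h2, Multiset.singleton_le.2 h5⟩
      · rw [Multiset.mem_singleton]
        intro h6
        exact hr (by nth_rewrite 2 [h6]; abel)
    have := h.left.eq_zero_of_card_lt (hle.trans (by rw [h.left_eq]; exact Multiset.le_add_right _ _))
      (by simp) (by rw [h.card_left]; have := h.five_le; simp; omega)
    simp at this
  have c1 := h.card_right
  have c2 := Multiset.card_erase_add_one h2
  rw [h.right_eq] at c1
  simp only [Multiset.card_add, Multiset.card_singleton] at c1
  refine h.symm.cyclicByTwo_of_forall (T := S.erase (u - x) + {u}) (g := u) ?_ (fun b hb => ?_) ?_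
  · rw [h.right_eq]
    exact add_le_add (Multiset.erase_le _ _) (Multiset.le_add_right _ _)
  · rw [Multiset.mem_add, Multiset.mem_singleton] at hb
    rcases hb with hb | hb
    · have hbS := Multiset.mem_of_mem_erase hb
      rcases h4 b (h.mem_left_of_mem hbS) with h6 | rfl | rfl
      · exact h6
      · exact absurd hbS hxS
      · have := Multiset.count_pos.2 hb
        rw [Multiset.count_erase_self] at this
        omega
    · exact hb
  · rw [Multiset.card_add, Multiset.card_singleton]; omega

/-- Since `g` is neither `u` nor `v`, it is the added element `r`. Then `f = u + v = x + y`, which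
can only be `g`. -/
theorem eq_of_exchanged (hu : u ∉ S) (hv : v ∉ S) {g b : G} (hg : g ∈ S)
    (hgb : Exchanged S ({x} + {y}) ({u} + {v}) g b) : g = x + y ∧ (b = x ∨ b = y) := by
  obtain ⟨hx0, hy0, hu0, hv0⟩ := h.pair_ne_zero
  obtain ⟨r, hr, t, f, d₁, d₂, h1, h2, h3, h4⟩ := exists_of_exchanged hgb
  have hgr : g ∈ ({u} + {v} + {r} : Multiset G) := by rw [← h2]; simp
  simp only [Multiset.mem_add, Multiset.mem_singleton] at hgr
  rcases hgr with (rfl | rfl) | rfl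
  · contradiction
  · contradiction
  have h6 : d₁ + d₂ = u + v := by
    have := congrArg Multiset.sum h2
    simp only [Multiset.sum_add, Multiset.sum_singleton] at this
    rw [add_assoc, add_comm g] at this
    exact add_right_cancel this
  rw [h6, ← h.add_eq_add] at h4
  have hf : f ∈ ({x} + {y} + {g} : Multiset G) := by rw [← h1]; simp
  have hfg : f = g := by
    simp only [Multiset.mem_add, Multiset.mem_singleton] at hf
    rcases hf with (hf | hf) | hf
    · exact absurd (by rw [← h4, hf] : x + y = x) (by simpa using hy0)
    · exact absurd (by rw [← h4, hf] : x + y = y) (by simpa using hx0)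
    · exact hf
  subst hfg
  have hbm : b ∈ ({x} + {y} : Multiset G) := by rw [← add_right_cancel h1]; simp
  exact ⟨h4, by simpa using hbm⟩

theorem add_self_eq_zero_or [DecidableEq G] (hx : x ∉ S) (hy : y ∉ S) (hu : u ∉ S) (hv : v ∉ S)
    {g : G} (hg : g ∈ S) (hgz : g ≠ x + y) : g + g = 0 ∨ g + g + x = 0 := by
  rcases h.exists_sum_eq_zero_or_exchanged hg (by
      intro hg'
      rcases (by simpa using hg' : g = x ∨ g = y) with rfl | rfl <;> contradiction)
      (h.mem_left_of_mem' (show y ∈ _ by simp)) (by rintro rfl; contradiction) with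
    h1 | ⟨-, E₂, -, hE, h1⟩
  · exact absurd (h.eq_of_exchanged hu hv hg h1).1 hgz
  · have hE := hE hy
    rw [add_comm, Multiset.singleton_add, Multiset.erase_cons_head, Multiset.le_singleton] at hE
    rcases hE with rfl | rfl
    · exact Or.inl (by simpa using h1)
    · exact Or.inr (by simpa using h1)

/-- Assume that none of `x, y, u, v` is in `S`. For `g ≠ x + y` in `S`, the relations from `U` and
from `V` say `2g ∈ {0, -x}` and `2g ∈ {0, -u}`, so `2g = 0`. If `x + y` is not in `S`, covering by
`S` and `y` finishes. The remaining work concerns `x + y` in `S`. -/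
theorem doublingLeTwo_or_cyclicByTwo_of_card_two : DoublingLeTwo G ∨ CyclicByTwo G := by
  classical
  have h5 := h.five_le
  by_cases hu : u ∈ S
  · exact Or.inr (h.cyclicByTwo_of_mem hu)
  by_cases hv : v ∈ S
  · exact Or.inr (h.swap_right.cyclicByTwo_of_mem hv)
  by_cases hx : x ∈ S
  · exact Or.inr (h.symm.cyclicByTwo_of_mem hx)
  by_cases hy : y ∈ S
  · exact Or.inr (h.swap_left.symm.cyclicByTwo_of_mem hy)
  obtain ⟨hn1, hn2, hn3, hn4⟩ := h.pair_ne
  obtain ⟨hx0, hy0, hu0, hv0⟩ := h.pair_ne_zero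
  have hz := h.add_eq_add
  have hgood : ∀ g ∈ S, g ≠ x + y → g + g = 0 := by
    intro g hg hgz
    rcases h.add_self_eq_zero_or hx hy hu hv hg hgz with h1 | h1
    · exact h1
    rcases h.symm.add_self_eq_zero_or hu hv hx hy hg (hz ▸ hgz) with h2 | h2
    · exact h2
    · exact absurd (add_left_cancel (h1.trans h2.symm)) hn1
  have c1 := h.card_left
  rw [h.left_eq] at c1
  simp only [Multiset.card_add, Multiset.card_singleton] at c1
  by_cases hzS : x + y ∈ S
  · by_cases hall : ∀ g ∈ S, g = x + y
    · right
      exact h.cyclicByTwo_of_forall (T := S) (by rw [h.left_eq]; exact Multiset.le_add_right _ _)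
        hall (by omega)
    left
    push Not at hall
    obtain ⟨e, he, hez⟩ := hall
    have hcz : V.count (x + y) = 1 := by
      rcases h.exists_sum_eq_zero_or_exchanged hzS (by simp [hx0, hy0]) (h.mem_left_of_mem he)
        hez with h1 | h1
      · rcases (h.eq_of_exchanged hu hv hzS h1).2 with rfl | rfl <;> contradiction
      · exact h1.1
    obtain ⟨S', hS'⟩ := Multiset.exists_cons_of_mem hzS
    have hzS' : x + y ∉ S' := by
      rw [h.right_eq, hS', Multiset.count_add, Multiset.count_cons_self] at hcz
      exact Multiset.count_eq_zero.1 (by omega)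
    have heS' : e ∈ S' := by
      rw [hS'] at he
      exact (Multiset.mem_cons.1 he).resolve_left hez
    have hS2 : ∀ g ∈ S', g + g = 0 := fun g hg =>
      hgood g (hS' ▸ Multiset.mem_cons_of_mem hg) (fun h0 => hzS' (h0 ▸ hg))
    have hSU : S' + ({x + y} + ({x} + {y})) = U := by
      rw [h.left_eq, hS', ← Multiset.singleton_add]; abel
    have hsum : S'.sum + (2 • (x + y)) = 0 := by
      have := h.left.2.1
      rw [← hSU] at this
      simp only [Multiset.sum_add, Multiset.sum_singleton] at this
      rw [two_nsmul]; exact this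
    have hzsf : ZeroSumFree S' := h.left.zeroSumFree_of_lt
      (by rw [← hSU]; exact Multiset.le_add_right _ _) (by rw [← hSU]; simp; omega)
    have hS0 : S'.sum ≠ 0 := fun h0 => by
      have := hzsf S' le_rfl h0
      simp [this] at heS'
    have hz2 : 2 • (x + y) ≠ 0 := fun h0 => hS0 (by rw [h0, add_zero] at hsum; exact hsum)
    have hz4 : 4 • (x + y) = 0 := by
      have e1 : S'.sum = -(2 • (x + y)) := eq_neg_of_add_eq_zero_left hsum
      have e2 := sum_add_sum_eq_zero hS2
      rw [e1] at e2
      rw [← neg_eq_zero, ← e2]; abel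
    have cS := Multiset.card_erase_add_one heS'
    rw [hS', Multiset.card_cons] at c1
    -- This says that `(x + y)³` with `S'` minus `e` is zero-sum free; its length is `D - 1`. Odd
    -- `j` is excluded by doubling, and for `j = 2` the terms `x + y, x, y` replace the two copies
    -- inside `U`.
    have hsub : ∀ T ≤ S'.erase e, ∀ j ≤ 3, j • (x + y) + T.sum = 0 → j = 0 ∧ T = 0 := by
      intro T hT j hj h0
      have hT2 : T.sum + T.sum = 0 := sum_add_sum_eq_zero fun g hg =>
        hS2 g (Multiset.mem_of_mem_erase (Multiset.mem_of_le hT hg))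
      have hj2 : (2 * j) • (x + y) = 0 := by
        have : (2 * j) • (x + y) = (j • (x + y) + T.sum) + (j • (x + y) + T.sum)
            - (T.sum + T.sum) := by rw [two_mul, add_nsmul]; abel
        rw [this, h0, hT2]; simp
      interval_cases j
      · exact ⟨rfl, hzsf T (hT.trans (Multiset.erase_le _ _)) (by simpa using h0)⟩
      · exact absurd hj2 hz2
      · exfalso
        have hTU : T + ({x + y} + ({x} + {y})) ≤ U := by
          rw [← hSU]; exact add_le_add (hT.trans (Multiset.erase_le _ _)) le_rfl
        have := h.left.eq_zero_of_card_lt hTU (by rw [← h0]; simp; abel) (by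
          rw [h.card_left]
          have := Multiset.card_le_card hT
          simp; omega)
        simpa using congrArg Multiset.card this
      · exfalso
        rw [show (2 * 3) • (x + y) = 4 • (x + y) + 2 • (x + y) by abel, hz4, zero_add] at hj2
        exact hz2 hj2
    refine doublingLeTwo_of_cover (M := Multiset.replicate 3 (x + y) + S'.erase e)
      (w := 2 • (x + y)) (by rw [← hz4]; abel) (fun g hg => ?_) fun g => ?_
    · rcases Multiset.mem_add.1 hg with hg | hg
      · rw [Multiset.eq_of_mem_replicate hg, two_nsmul]; exact Or.inr rfl
      · exact Or.inl (hS2 g (Multiset.mem_of_mem_erase hg))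
    · refine h.bound.exists_sum_eq ?_ ?_ g
      · intro T hT h0
        obtain ⟨T₁, T₂, hT₁, hT₂, rfl⟩ := exists_add_of_le_add hT
        obtain ⟨j, hj, rfl⟩ := Multiset.le_replicate_iff.1 hT₁
        rw [Multiset.sum_add, Multiset.sum_replicate] at h0
        obtain ⟨rfl, rfl⟩ := hsub T₂ hT₂ j hj h0
        simp
      · simp only [Multiset.card_add, Multiset.card_replicate]; omega
  · left
    refine doublingLeTwo_of_cover_cons (M := S) (f := y) (fun g hg => hgood g hg ?_) fun g => ?_
    · rintro rfl; exact hzS hg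
    · obtain ⟨T, hT, hs⟩ := h.bound.exists_sum_eq_erase h.left h.card_left.ge
        (h.mem_left_of_mem' (show x ∈ _ by simp)) g
      refine ⟨T, hT.trans (le_of_eq ?_), hs⟩
      rw [h.left_eq, add_left_comm, Multiset.singleton_add, Multiset.erase_cons_head, add_comm,
        Multiset.singleton_add]

end Two

end EvenGap

end EvenGapCases

/-! ### Two sequences of length `D` that differ in three elements. -/

section EvenGapThree

variable {G : Type*} [AddCommGroup G]

namespace EvenGap

variable {D : ℕ} {U V S E F : Multiset G}

/-- With three elements in `E` no `R` is left in an exchange. If `g` is not in `S`, it is a subsum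
of `U` without some `s` in `S`, and this `s` lies in both complements, so an exchange takes place.
-/
theorem exists_of_mem_of_card_three (h : EvenGap D U V S E F) (hE : E.card = 3) {g : G}
    (hg : g ∈ F) : ∃ b t f d₁ d₂, ({b} + {t} + {f} : Multiset G) = E ∧
      ({g} + {d₁} + {d₂} : Multiset G) = F ∧ g = b + t ∧ f = d₁ + d₂ := by
  classical
  have h5 := h.five_le
  have hex : ∃ b, Exchanged S E F g b := by
    by_cases hgS : g ∈ S
    · obtain ⟨b, hb⟩ := Multiset.card_pos_iff_exists_mem.1 (show 0 < E.card by omega)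
      refine ⟨b, h.exchanged_of_two_le_count (h.mem_left_of_mem hgS) ?_ (h.mem_left_of_mem' hb) ?_⟩
      · have := Multiset.count_pos.2 hgS
        have := Multiset.count_pos.2 hg
        rw [h.right_eq, Multiset.count_add]; omega
      · rintro rfl; exact h.disjoint _ hb hg
    · have c1 := h.card_left
      rw [h.left_eq, Multiset.card_add] at c1
      obtain ⟨s, hs⟩ := Multiset.card_pos_iff_exists_mem.1 (show 0 < S.card by omega)
      have hgU : g ∉ U := by
        rw [h.left_eq, Multiset.mem_add]
        rintro (h1 | h1)
        · exact hgS h1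
        · exact h.disjoint _ h1 hg
      have hsU := h.mem_left_of_mem hs
      obtain ⟨A, hA, hsum⟩ := h.bound.exists_sum_eq_erase h.left h.card_left.ge hsU g
      have hgV := h.mem_right_of_mem' hg
      obtain ⟨A', hA'⟩ := Multiset.le_iff_exists_add.1 hA
      have hgA : g ∉ A := fun h1 => hgU (Multiset.mem_of_mem_erase (Multiset.mem_of_le hA h1))
      obtain ⟨b, hb⟩ := Multiset.exists_mem_of_ne_zero (show A ≠ 0 by
        rintro rfl; exact h.ne_zero_right hgV (by simpa using hsum.symm))
      refine ⟨b, h.exchanged_of_mem (A' := s ::ₘ A') hgV ?_ hsum hgA hb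
        (Multiset.mem_cons_self _ _) ?_⟩
      · rw [Multiset.add_cons, ← hA', Multiset.cons_erase hsU]
      · rw [Multiset.mem_erase_of_ne (by rintro rfl; exact hgU hsU)]
        exact h.mem_right_of_mem hs
  obtain ⟨b, R, hR, t, f, d₁, d₂, h1, h2, h3, h4⟩ := hex
  have c := congrArg Multiset.card h1
  simp only [Multiset.card_add, Multiset.card_singleton] at c
  obtain rfl := Multiset.card_eq_zero.1 (show R.card = 0 by omega)
  rw [add_zero] at h1 h2
  exact ⟨b, t, f, d₁, d₂, h1, h2, h3, h4⟩

theorem exists_sum_eq_add (h : EvenGap D U V S E F) (hE : E.card = 3) {g : G} (hg : g ∈ F) :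
    ∃ f ∈ E, E.sum = g + f := by
  obtain ⟨b, t, f, d₁, d₂, h1, -, h3, -⟩ := h.exists_of_mem_of_card_three hE hg
  refine ⟨f, by rw [← h1]; simp, ?_⟩
  rw [← h1, h3]; simp only [Multiset.sum_add, Multiset.sum_singleton]

theorem sum_ne_zero (h : EvenGap D U V S E F) (hE : E.card = 3) : E.sum ≠ 0 := fun h0 => by
  have := h.left.eq_zero_of_card_lt (by rw [h.left_eq]; exact Multiset.le_add_left _ _) h0 (by
    rw [h.card_left]; have := h.five_le; omega)
  rw [this] at hE; simp at hE

theorem form_of_two_left {b t f g d₁ d₂ : G} {E F : Multiset G} (h1 : {b} + {t} + {f} = E)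
    (h2 : {g} + {d₁} + {d₂} = F) (hs0 : b + t + f ≠ 0) (h3 : g = b + t) (h4 : f = d₁ + d₂)
    (e₁ : b + t + f = d₁ + b) (e₂ : b + t + f = d₂ + b)
    (ht : b + t + f - t = g ∨ b + t + f - t = d₁ ∨ b + t + f - t = d₂) :
    ∃ a b, E = {a} + {a} + {b} ∧ F = {a + b} + {-a} + {-a} ∧ 3 • a = 0 := by
  have k1 : d₁ = t + f := add_right_cancel (e₁.symm.trans (by abel))
  have k2 : d₂ = t + f := add_right_cancel (e₂.symm.trans (by abel))
  have k3 : t + t + f = 0 := by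
    rw [k1, k2] at h4
    have : f + 0 = f + (t + t + f) := by rw [add_zero]; nth_rewrite 1 [h4]; abel
    exact (add_left_cancel this).symm
  have ht' : b + f = b + t ∨ b + f = t + f := by
    rw [show b + t + f - t = b + f by abel, h3, k1, k2] at ht
    simpa using ht
  rcases ht' with h6 | h6
  · have h6 := add_left_cancel h6
    subst h6
    refine ⟨f, b, ?_, ?_, by rw [← k3]; abel⟩
    · rw [← h1]; abel
    · have : f + f = -f := eq_neg_of_add_eq_zero_left k3
      rw [← h2, k1, k2, h3, this, add_comm b f]
  · have h6 := add_right_cancel h6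
    exact absurd (by rw [h6, k3]) hs0

theorem form_of_left_right {b t f g d₁ d₂ : G} {E F : Multiset G} (h1 : {b} + {t} + {f} = E)
    (h2 : {g} + {d₁} + {d₂} = F) (hs0 : b + t + f ≠ 0) (h3 : g = b + t) (h4 : f = d₁ + d₂)
    (e₁ : b + t + f = d₁ + b) (e₂ : b + t + f = d₂ + f)
    (ht : b + t + f - t = g ∨ b + t + f - t = d₁ ∨ b + t + f - t = d₂) :
    ∃ a b, E = {a} + {a} + {b} ∧ F = {a + b} + {-a} + {-a} ∧ 3 • a = 0 := by
  have k1 : d₁ = t + f := add_right_cancel (e₁.symm.trans (by abel))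
  have k2 : d₂ = b + t := add_right_cancel (e₂.symm.trans (by abel))
  have k3 : b + t + t = 0 := by
    rw [k1, k2] at h4
    have : f + 0 = f + (b + t + t) := by rw [add_zero]; nth_rewrite 1 [h4]; abel
    exact (add_left_cancel this).symm
  have ht' : b + f = b + t ∨ b + f = t + f := by
    rw [show b + t + f - t = b + f by abel, h3, k1, k2] at ht
    tauto
  rcases ht' with h6 | h6
  · have h6 := add_left_cancel h6
    subst h6
    exact absurd k3 hs0
  · have h6 := add_right_cancel h6
    subst h6
    have : b + b = -b := eq_neg_of_add_eq_zero_left k3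
    exact ⟨b, f, h1.symm, by rw [← h2, k1, k2, h3, this]; abel, by rw [← k3]; abel⟩

/-- With the common sum `τ` of `E` and `F`, each element of `F` is `τ` minus an element of `E`, and
conversely. The cases are which elements of `E` belong to `d₁` and `d₂`. Together with `f = d₁ + d₂`
and `τ ≠ 0`, only one shape survives. -/
theorem exists_form_of_card_three (h : EvenGap D U V S E F) (hE : E.card = 3) :
    ∃ a b, E = {a} + {a} + {b} ∧ F = {a + b} + {-a} + {-a} ∧ 3 • a = 0 := by
  have hF : F.card = 3 := h.card_eq ▸ hE
  have hs0 := h.sum_ne_zero hE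
  obtain ⟨g, hg⟩ := Multiset.card_pos_iff_exists_mem.1 (show 0 < F.card by omega)
  obtain ⟨b, t, f, d₁, d₂, h1, h2, h3, h4⟩ := h.exists_of_mem_of_card_three hE hg
  have hτ : E.sum = b + t + f := by rw [← h1]; simp only [Multiset.sum_add, Multiset.sum_singleton]
  have hmE : ∀ x ∈ E, x = b ∨ x = t ∨ x = f := fun x hx => by
    rw [← h1] at hx; simpa [or_assoc] using hx
  have hmF : ∀ x ∈ F, x = g ∨ x = d₁ ∨ x = d₂ := fun x hx => by
    rw [← h2] at hx; simpa [or_assoc] using hx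
  have hb : b + t + f - b ∈ F := by
    obtain ⟨y, hy, h5⟩ := h.symm.exists_sum_eq_add hF (show b ∈ E by rw [← h1]; simp)
    rw [← hτ, h.sum_eq, h5, add_sub_cancel_left]; exact hy
  have ht : b + t + f - t ∈ F := by
    obtain ⟨y, hy, h5⟩ := h.symm.exists_sum_eq_add hF (show t ∈ E by rw [← h1]; simp)
    rw [← hτ, h.sum_eq, h5, add_sub_cancel_left]; exact hy
  obtain ⟨f₁, hf₁, e₁⟩ := h.exists_sum_eq_add hE (show d₁ ∈ F by rw [← h2]; simp)
  obtain ⟨f₂, hf₂, e₂⟩ := h.exists_sum_eq_add hE (show d₂ ∈ F by rw [← h2]; simp)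
  have hb := hmF _ hb
  have ht := hmF _ ht
  rw [hτ] at e₁ e₂ hs0
  have hbt : b + t + f = t + b + f := by abel
  have h1' : ({t} + {b} + {f} : Multiset G) = E := by rw [← h1]; abel
  have h2' : ({g} + {d₂} + {d₁} : Multiset G) = F := by rw [← h2]; abel
  have h3' : g = t + b := by rw [h3, add_comm]
  have h4' : f = d₂ + d₁ := by rw [h4, add_comm]
  have hzero : b + t + f = d₁ + b → b + t + f = d₂ + t → False := fun e₁ e₂ => hs0 (by
    have : (b + t + f) + (b + t + f) = (b + t + f) + 0 := by
      nth_rewrite 1 [e₁]; nth_rewrite 1 [e₂]; rw [h4]; abel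
    exact add_left_cancel this)
  have hzero' : b + t + f = d₁ + t → b + t + f = d₂ + b → False := fun e₁ e₂ => hs0 (by
    have : (b + t + f) + (b + t + f) = (b + t + f) + 0 := by
      nth_rewrite 1 [e₁]; nth_rewrite 1 [e₂]; rw [h4]; abel
    exact add_left_cancel this)
  rcases hmE _ hf₁ with r₁ | r₁ | r₁ <;> rcases hmE _ hf₂ with r₂ | r₂ | r₂ <;> rw [r₁] at e₁ <;>
    rw [r₂] at e₂
  · exact form_of_two_left h1 h2 hs0 h3 h4 e₁ e₂ ht
  · exact (hzero e₁ e₂).elim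
  · exact form_of_left_right h1 h2 hs0 h3 h4 e₁ e₂ ht
  · exact (hzero' e₁ e₂).elim
  · rw [hbt] at e₁ e₂ hb hs0
    exact form_of_two_left h1' h2 hs0 h3' h4 e₁ e₂ hb
  · rw [hbt] at e₁ e₂ hb hs0
    exact form_of_left_right h1' h2 hs0 h3' h4 e₁ e₂ hb
  · exact form_of_left_right h1 h2' hs0 h3 h4' e₂ e₁ (ht.imp_right Or.symm)
  · rw [hbt] at e₁ e₂ hb hs0
    exact form_of_left_right h1' h2' hs0 h3' h4' e₂ e₁ (hb.imp_right Or.symm)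
  · have k1 : d₁ = b + t := (add_right_cancel e₁).symm
    have k2 : d₂ = b + t := (add_right_cancel e₂).symm
    rw [k1, k2, h3] at hb ht
    have hb : t + f = t + b := by
      rw [show b + t + f - b = t + f by abel] at hb
      rw [add_comm t b]; tauto
    have ht : b + f = b + t := by
      rw [show b + t + f - t = b + f by abel] at ht
      tauto
    have hb := add_left_cancel hb
    have ht := add_left_cancel ht
    rw [k1, k2, ← hb, ← ht] at h4
    rw [← hb, ← ht] at hs0
    have : f + 0 = f + (f + f + f) := by rw [add_zero]; nth_rewrite 1 [h4]; abel
    exact absurd (add_left_cancel this).symm hs0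

/-- Since `b` occurs twice in `U`, any other element of `S` is exchanged and lies in `F`. An `a + b`
in `S` allows two disjoint pairs `a, b` against two copies of `a + b`, and `-a` cancels `a` inside
`U`. So `U` contains `b` at least `D - 2` times. -/
theorem cyclicByTwo_of_mem_of_card_three {a b : G} (h : EvenGap D U V S ({a} + {a} + {b}) F)
    (hF : F = {a + b} + {-a} + {-a}) (hb : b ∈ S) : CyclicByTwo G := by
  classical
  subst hF
  have h5 := h.five_le
  have c1 := h.card_left
  rw [h.left_eq] at c1
  simp only [Multiset.card_add, Multiset.card_singleton] at c1
  have haU : a ∈ U := h.mem_left_of_mem' (by simp)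
  have hall : ∀ s ∈ S, s = b := by
    intro s hs
    by_contra hsb
    obtain ⟨R, hR, t, f, d₁, d₂, h1, -, -, -⟩ := h.symm.exchanged_of_two_le_count
      (h.mem_right_of_mem hb) (by
        have := Multiset.count_pos.2 hb
        rw [h.left_eq, Multiset.count_add, Multiset.count_add _ _ {b}, Multiset.count_singleton_self]
        omega)
      (h.mem_right_of_mem hs) hsb
    have c := congrArg Multiset.card h1
    simp only [Multiset.card_add, Multiset.card_singleton] at c
    obtain rfl := Multiset.card_eq_zero.1 (show R.card = 0 by omega)
    rw [add_zero] at h1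
    have hs' : s ∈ ({a + b} + {-a} + {-a} : Multiset G) := by rw [← h1]; simp
    have hs' : s = a + b ∨ s = -a := by simpa using hs'
    rcases hs' with rfl | rfl
    · obtain ⟨S', rfl⟩ := Multiset.exists_cons_of_mem hb
      have hs' := (Multiset.mem_cons.1 hs).resolve_left hsb
      obtain ⟨S'', rfl⟩ := Multiset.exists_cons_of_mem hs'
      refine h.false_of_two_sums (A₁ := {a} + {b}) (A₂ := {a} + {b}) (A₃ := (a + b) ::ₘ S'')
        (B := b ::ₘ S'' + ({-a} + {-a})) (g₁ := a + b) (g₂ := a + b) ?_ ?_ (by simp) (by simp)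
        (by simp) (by simp)
      · rw [h.left_eq, ← Multiset.singleton_add b, ← Multiset.singleton_add (a + b)]; abel
      · rw [h.right_eq]
        simp only [← Multiset.singleton_add]; abel
    · have hle : ({a} + {-a} : Multiset G) ≤ U := by
        rw [h.left_eq, add_comm S]
        refine add_le_add ?_ (Multiset.singleton_le.2 hs)
        rw [add_assoc]
        exact Multiset.le_add_right _ _
      have := h.left.eq_zero_of_card_lt hle (by simp) (by rw [h.card_left]; simp; omega)
      simpa using congrArg Multiset.card this
  refine h.cyclicByTwo_of_forall (T := S + {b}) (g := b) ?_ (fun x hx => ?_) ?_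
  · rw [h.left_eq]
    exact add_le_add le_rfl (Multiset.le_add_left _ _)
  · rcases Multiset.mem_add.1 hx with hx | hx
    · exact hall x hx
    · exact Multiset.mem_singleton.1 hx
  · simp only [Multiset.card_add, Multiset.card_singleton]; omega

theorem not_exchanged_of_notMem {g b : G} (hE : E.card = 3) (hgF : g ∉ F) : ¬ Exchanged S E F g b := by
  rintro ⟨R, hR, t, f, d₁, d₂, h1, h2, -, -⟩
  have c := congrArg Multiset.card h1
  simp only [Multiset.card_add, Multiset.card_singleton] at c
  obtain rfl := Multiset.card_eq_zero.1 (show R.card = 0 by omega)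
  exact hgF (by rw [add_zero] at h2; rw [← h2]; simp)

omit [AddCommGroup G] in
theorem le_pair_cases {a b : G} {T : Multiset G} (h : T ≤ {a} + {b}) :
    T = 0 ∨ T = {a} ∨ T = {b} ∨ T = {a} + {b} := by
  classical
  obtain ⟨T₁, T₂, h1, h2, rfl⟩ := exists_add_of_le_add h
  rcases Multiset.le_singleton.1 h1 with rfl | rfl <;>
    rcases Multiset.le_singleton.1 h2 with rfl | rfl <;> simp

/-- No exchange is possible for `g`, so `-2g` is a subsum of `{a, b}` and also one of `{a, a}`.
Comparing the two leaves 0 and `a`. -/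
theorem add_self_eq_zero_or_of_card_three {a b : G}
    (h : EvenGap D U V S ({a} + {a} + {b}) F) (hF : F = {a + b} + {-a} + {-a}) (ha3 : 3 • a = 0)
    (ha : a ∉ S) (hb : b ∉ S) {g : G} (hg : g ∈ S) (hgF : g ∉ F) : g + g = 0 ∨ g + g + a = 0 := by
  classical
  have ha0 : a ≠ 0 := h.ne_zero_left (h.mem_left_of_mem' (by simp))
  have hb0 : b ≠ 0 := h.ne_zero_left (h.mem_left_of_mem' (by simp))
  have hab0 : a + b ≠ 0 := h.ne_zero_right (h.mem_right_of_mem' (by rw [hF]; simp))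
  have hab : a ≠ b := by
    rintro rfl
    exact h.sum_ne_zero (by simp) (by
      simp only [Multiset.sum_add, Multiset.sum_singleton]
      rw [← ha3]; abel)
  have hgE : g ∉ ({a} + {a} + {b} : Multiset G) := by
    intro hg'
    rcases (by simpa using hg' : g = a ∨ g = b) with rfl | rfl <;> contradiction
  have k1 := (h.exists_sum_eq_zero_or_exchanged hg hgE
    (h.mem_left_of_mem' (show a ∈ _ by simp)) (by rintro rfl; contradiction)).resolve_left
    (not_exchanged_of_notMem (by simp) hgF)
  have k2 := (h.exists_sum_eq_zero_or_exchanged hg hgE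
    (h.mem_left_of_mem' (show b ∈ _ by simp)) (by rintro rfl; contradiction)).resolve_left
    (not_exchanged_of_notMem (by simp) hgF)
  obtain ⟨-, E₁, -, k1, s1⟩ := k1
  obtain ⟨-, E₂, -, k2, s2⟩ := k2
  have k1 := k1 ha
  have k2 := k2 hb
  rw [add_assoc, Multiset.singleton_add, Multiset.erase_cons_head] at k1
  rw [add_comm, Multiset.singleton_add, Multiset.erase_cons_head] at k2
  by_contra! hne
  have hs1 : E₁.sum = E₂.sum := add_left_cancel (s1.trans s2.symm)
  have h2a : a + a = -a := eq_neg_of_add_eq_zero_left (by rw [← ha3]; abel)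
  rcases le_pair_cases k2 with rfl | rfl | rfl | rfl
  · exact hne.1 (by simpa using s2)
  · exact hne.2 (by simpa using s2)
  · exact hne.2 (by simpa using s2)
  rcases le_pair_cases k1 with rfl | rfl | rfl | rfl
  · exact hne.1 (by simpa using s1)
  · exact hne.2 (by simpa using s1)
  · simp only [Multiset.sum_add, Multiset.sum_singleton] at hs1
    exact hab0 (by rw [hs1, ← ha3]; abel)
  · simp only [Multiset.sum_add, Multiset.sum_singleton] at hs1
    exact hab (add_left_cancel hs1).symm

/-- Interchanging `U` and `V` replaces `a, b` by `-a, a + b`. If neither `b` nor `a + b` is in `S`,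
both versions of the previous restriction make `S` consist of involutions. Then `3b = ∑ S` and `2b =
-a ≠ 0`, so `card_add_four_lt` contradicts `|S| = D - 3`. -/
theorem cyclicByTwo_of_card_three (h : EvenGap D U V S E F) (hE : E.card = 3) :
    CyclicByTwo G := by
  obtain ⟨a, b, rfl, rfl, ha3⟩ := h.exists_form_of_card_three hE
  have hF' : ({a} + {a} + {b} : Multiset G) = {-a + (a + b)} + {-(-a)} + {-(-a)} := by
    rw [neg_neg, neg_add_cancel_left]; abel
  have h' : EvenGap D V U S ({-a} + {-a} + {a + b}) ({a} + {a} + {b}) := by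
    have := h.symm
    rwa [show ({a + b} + {-a} + {-a} : Multiset G) = {-a} + {-a} + {a + b} by abel] at this
  by_cases hb : b ∈ S
  · exact h.cyclicByTwo_of_mem_of_card_three rfl hb
  by_cases hab : a + b ∈ S
  · exact h'.cyclicByTwo_of_mem_of_card_three hF' hab
  have h5 := h.five_le
  have hopp : ∀ W : Multiset G, IsMinimalZeroSum W → 3 ≤ W.card → ∀ x, ({x} + {-x} : Multiset G) ≤ W →
      False := by
    intro W hW hc x hx
    have := hW.eq_zero_of_card_lt hx (by simp) (by simp; omega)
    simpa using congrArg Multiset.card this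
  have ha : a ∉ S := fun ha => hopp V h.right (by rw [h.card_right]; omega) a (by
    rw [h.right_eq]
    exact add_le_add (Multiset.singleton_le.2 ha) (Multiset.le_add_left _ _))
  have hna : -a ∉ S := fun hna => hopp U h.left (by rw [h.card_left]; omega) a (by
    rw [h.left_eq, add_comm]
    exact add_le_add (Multiset.singleton_le.2 hna) ((Multiset.le_add_right _ _).trans
      (Multiset.le_add_right _ _)))
  have hne : a ≠ -a := fun h0 => h.disjoint a (by simp) (by rw [← h0]; simp)
  have hS2 : ∀ g ∈ S, g + g = 0 := by
    intro g hg
    have hgE : g ∉ ({a} + {a} + {b} : Multiset G) := by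
      intro hg'
      rcases (by simpa using hg' : g = a ∨ g = b) with rfl | rfl <;> contradiction
    have hgF : g ∉ ({a + b} + {-a} + {-a} : Multiset G) := by
      intro hg'
      rcases (by simpa using hg' : g = a + b ∨ g = -a) with rfl | rfl <;> contradiction
    rcases h.add_self_eq_zero_or_of_card_three rfl ha3 ha hb hg hgF with h1 | h1
    · exact h1
    rcases h'.add_self_eq_zero_or_of_card_three hF' (by rw [smul_neg, ha3, neg_zero]) hna hab hg hgE
      with h2 | h2
    · exact h2
    · exact absurd (add_left_cancel (h1.trans h2.symm)) hne
  have c1 := h.card_left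
  rw [h.left_eq] at c1
  simp only [Multiset.card_add, Multiset.card_singleton] at c1
  obtain ⟨e, he⟩ := Multiset.card_pos_iff_exists_mem.1 (show 0 < S.card by omega)
  have hsum := h.left.2.1
  rw [h.left_eq] at hsum
  simp only [Multiset.sum_add, Multiset.sum_singleton] at hsum
  have hSS := sum_add_sum_eq_zero hS2
  have hSn : S.sum = -(a + a + b) := eq_neg_of_add_eq_zero_left hsum
  have h4 : a + a + b + (a + a + b) = 0 := by
    rw [hSn] at hSS
    rw [← neg_eq_zero, ← hSS]; abel
  have hbb : b + b = -a := by
    have : b + b = (a + a + b + (a + a + b)) - 3 • a - a := by abel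
    rw [this, h4, ha3]; simp
  have := card_add_four_lt h.bound (h.left.zeroSumFree_of_lt (S := S)
    (by rw [h.left_eq]; exact Multiset.le_add_right _ _) (by rw [h.card_left]; omega)) hS2 he
    (f := b) ?_ ?_
  · omega
  · have e1 : S.sum = -S.sum := eq_neg_of_add_eq_zero_left hSS
    rw [e1, hSn, neg_neg]
    have : a + a + b = 3 • a - a + b := by abel
    rw [this, ha3, show 3 • b = b + b + b by abel, hbb]; abel
  · rw [hbb, neg_ne_zero]
    exact h.ne_zero_left (h.mem_left_of_mem' (by simp))

end EvenGap

end EvenGapThree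

/-! ### From length gaps to the group, and from almost dissociated sequences to length gaps. -/

section Gap

variable {G : Type*} [AddCommGroup G] {D : ℕ} {U V : Multiset G}

theorem EvenGap.doublingLeTwo_or_cyclicByTwo {S E F : Multiset G} (h : EvenGap D U V S E F)
    (hE : E.card ≤ 3) : DoublingLeTwo G ∨ CyclicByTwo G := by
  have hc := h.card_eq
  interval_cases hn : E.card
  · obtain rfl := Multiset.card_eq_zero.1 hn
    obtain rfl := Multiset.card_eq_zero.1 hc.symm
    have h1 := h.left_eq
    have h2 := h.right_eq
    rw [add_zero] at h1 h2
    subst h1 h2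
    exact h.doublingLeTwo_or_cyclicByTwo_of_eq
  · obtain ⟨x, rfl⟩ := Multiset.card_eq_one.1 hn
    obtain ⟨y, rfl⟩ := Multiset.card_eq_one.1 hc.symm
    have h1 := h.sum_eq
    have h2 := h.disjoint x (by simp)
    simp at h1 h2
    exact absurd h1 h2
  · obtain ⟨x, y, rfl⟩ := Multiset.card_eq_two.1 hn
    obtain ⟨u, v, rfl⟩ := Multiset.card_eq_two.1 hc.symm
    exact EvenGap.doublingLeTwo_or_cyclicByTwo_of_card_two h
  · exact Or.inr (h.cyclicByTwo_of_card_three hn)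

theorem doublingLeTwo_or_cyclicByTwo_of_odd [DecidableEq G] (h5 : 5 ≤ D) (hD : LengthBound G D)
    (hU : IsMinimalZeroSum U) (hV : IsMinimalZeroSum V) (hg : LengthGap (D - 1) U V)
    (h1 : U.card = D) (h2 : V.card + 1 = D) (h3 : D ≤ (U ∩ V).card + 2) :
    DoublingLeTwo G ∨ CyclicByTwo G := by
  obtain ⟨E, hE⟩ := Multiset.le_iff_exists_add.1 (Multiset.inter_le_left : U ∩ V ≤ U)
  obtain ⟨F, hF⟩ := Multiset.le_iff_exists_add.1 (Multiset.inter_le_right : U ∩ V ≤ V)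
  have c1 := congrArg Multiset.card hE
  have c2 := congrArg Multiset.card hF
  rw [Multiset.card_add] at c1 c2
  have hF0 : F.card ≠ 0 := by
    intro h0
    have hVU : V ≤ U := by
      rw [hF, Multiset.card_eq_zero.1 h0, add_zero]; exact Multiset.inter_le_left
    have := hU.2.2 V hVU hV.1 hV.2.1
    rw [this] at h2; omega
  obtain ⟨z, rfl⟩ := Multiset.card_eq_one.1 (show F.card = 1 by omega)
  obtain ⟨p, q, rfl⟩ := Multiset.card_eq_two.1 (show E.card = 2 by omega)
  exact OddGap.doublingLeTwo_or_cyclicByTwo (z := z)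
    ⟨h5, hD, hU, hV, hE, hF, by simp at c2; omega, hg⟩

theorem PairFactorization.le_card_of_zeroSumFree {A B : Multiset G} {n : ℕ}
    (h : PairFactorization A B n) (hB : ZeroSumFree B) : n ≤ A.card := by
  induction h with
  | zero => simp
  | @cons X Y A B n hW h ih =>
    have := ih (hB.mono (Multiset.le_add_left _ _))
    have hX : X.card ≠ 0 := by
      intro h0
      rw [Multiset.card_eq_zero.1 h0, zero_add] at hW
      have hY := hB Y (Multiset.le_add_right _ _) (by
        have := hW.2.1
        rwa [sum_map_neg_eq, neg_eq_zero] at this)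
      exact hW.1 (by simp [hY])
    rw [Multiset.card_add]; omega

theorem HasFactorization.eq_one {S : Multiset G} {n : ℕ} (h : HasFactorization S n)
    (hS : IsMinimalZeroSum S) : n = 1 := by
  cases h with
  | zero => exact absurd rfl hS.1
  | @cons W S n hW h =>
    have := hS.2.2 W (Multiset.le_add_right _ _) hW.1 hW.2.1
    have hS0 : S = 0 := by simpa using this
    subst hS0
    cases n with
    | zero => rfl
    | succ n =>
      generalize hZ : (0 : Multiset G) = Z at h
      cases h with
      | @cons W' S' _ hW' _ =>
        have := congrArg Multiset.card hZ
        have := Multiset.card_pos.2 hW'.1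
        simp at *; omega

/-- A factor inside `U` or inside `-V` would be all of it, leaving only one more factor. So with at
least three factors the first one meets both sides; what it leaves of `V` is zero-sum free, and each
factor uses a term of `U`. -/
theorem PairFactorization.le_card {n : ℕ} (h : PairFactorization U V n) (hU : IsMinimalZeroSum U)
    (hV : IsMinimalZeroSum V) (h3 : 3 ≤ n) : n ≤ U.card := by
  cases h with
  | zero => omega
  | @cons X Y A B n hW h =>
    have hX : X ≠ 0 := by
      rintro rfl
      rw [zero_add] at hW
      have h0 := hW.2.1
      rw [sum_map_neg_eq, neg_eq_zero] at h0
      have hY := hV.2.2 Y (Multiset.le_add_right _ _) (by rintro rfl; exact hW.1 rfl) h0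
      have hB : B = 0 := by simpa using hY
      subst hB
      have := h.hasFactorization
      rw [Multiset.map_zero, add_zero] at this
      rw [zero_add] at hU
      have := this.eq_one hU
      omega
    have hY : Y ≠ 0 := by
      rintro rfl
      rw [Multiset.map_zero, add_zero] at hW
      have hX := hU.2.2 X (Multiset.le_add_right _ _) hX hW.2.1
      have hA : A = 0 := by simpa using hX
      subst hA
      have := h.symm.hasFactorization
      rw [Multiset.map_zero, add_zero] at this
      rw [zero_add] at hV
      have := this.eq_one hV
      omega
    have := h.le_card_of_zeroSumFree (hV.zeroSumFree_of_lt (Multiset.le_add_left _ _) (by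
      have := Multiset.card_pos.2 hY
      rw [Multiset.card_add]; omega))
    have := Multiset.card_pos.2 hX
    rw [Multiset.card_add]; omega

/-- Two minimal zero-sum sequences such that all factorizations of `U + (-V)` of length at least
three have length at least `D - 1`, and such a factorization exists. -/
theorem LengthGap.doublingLeTwo_or_cyclicByTwo (h5 : 5 ≤ D) (hD : LengthBound G D)
    (hU : IsMinimalZeroSum U) (hV : IsMinimalZeroSum V) (hg : LengthGap (D - 1) U V) {n : ℕ}
    (hn : PairFactorization U V n) (hDn : D ≤ n + 1) : DoublingLeTwo G ∨ CyclicByTwo G := by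
  classical
  have hU1 := hD U hU
  have hV1 := hD V hV
  have hi := card_inter_le U V
  have e := hn.three_mul_le
  have hnU := hn.le_card hU hV (by omega)
  have hnV := hn.symm.le_card hV hU (by omega)
  have e := hn.three_mul_le (hU.noShortZeroSum (by omega)) (hV.noShortZeroSum (by omega))
  -- Both lengths are at least `n ≥ D - 1`, and `3(D - 1) ≤ |U| + |V| + |U ∩ V|`. So the
  -- intersection has at least `D - 3` elements for lengths `D, D`, at least `D - 2` for `D, D - 1`,
  -- and is everything for `D - 1, D - 1`.
  rcases (show (U.card = D ∧ V.card = D) ∨ (U.card = D ∧ V.card + 1 = D) ∨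
    (U.card + 1 = D ∧ V.card = D) ∨ (U.card + 1 = D ∧ V.card + 1 = D) by omega) with
    ⟨h1, h2⟩ | ⟨h1, h2⟩ | ⟨h1, h2⟩ | ⟨h1, h2⟩
  · obtain ⟨E, hE⟩ := Multiset.le_iff_exists_add.1 (Multiset.inter_le_left : U ∩ V ≤ U)
    obtain ⟨F, hF⟩ := Multiset.le_iff_exists_add.1 (Multiset.inter_le_right : U ∩ V ≤ V)
    have c1 := congrArg Multiset.card hE
    rw [Multiset.card_add] at c1
    refine EvenGap.doublingLeTwo_or_cyclicByTwo (S := U ∩ V) (E := E) (F := F)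
      ⟨h5, hD, hU, hV, hE, hF, h1, h2, fun x hx hx' => ?_, hg⟩ (by omega)
    have e1 := congrArg (Multiset.count x) hE
    have e2 := congrArg (Multiset.count x) hF
    simp only [Multiset.count_add, Multiset.count_inter] at e1 e2
    have := Multiset.count_pos.2 hx
    have := Multiset.count_pos.2 hx'
    omega
  · exact doublingLeTwo_or_cyclicByTwo_of_odd h5 hD hU hV hg h1 h2 (by omega)
  · rw [Multiset.inter_comm] at e
    exact doublingLeTwo_or_cyclicByTwo_of_odd h5 hD hV hU (fun n hn => hg n hn.symm) h2 h1
      (by omega)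
  · obtain rfl := eq_of_card_inter (A := U) (B := V) (by omega) (by omega)
    exact (LengthGap.almostDissociated hU (by omega) (by omega) hg).doublingLeTwo_or_cyclicByTwo
      hD hU h1 (by omega)

/-- Two minimal zero-sum sequences such that all factorizations of `U + (-V)` of length at least
three have length at least `D`, and such a factorization exists. -/
theorem LengthGap.cyclic_or_elementary (h3 : 3 ≤ D) (hD : LengthBound G D)
    (hU : IsMinimalZeroSum U) (hV : IsMinimalZeroSum V) (hg : LengthGap D U V) {n : ℕ}
    (hn : PairFactorization U V n) (hDn : D ≤ n) :
    (∃ g : G, ∀ x : G, ∃ k : ℤ, x = k • g) ∨ ∀ x : G, x + x = 0 := by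
  classical
  have hU1 := hD U hU
  have hV1 := hD V hV
  have hi := card_inter_le U V
  have hnU := hn.le_card hU hV (by omega)
  have hnV := hn.symm.le_card hV hU (by omega)
  have e := hn.three_mul_le (hU.noShortZeroSum (by omega)) (hV.noShortZeroSum (by omega))
  obtain rfl := eq_of_card_inter (A := U) (B := V) (by omega) (by omega)
  exact (LengthGap.almostDissociated hU (by omega) (by omega) hg).cyclic_or_elementary hD hU
    (by omega)

theorem pairFactorization_self (A : Multiset G) (hA : ∀ x ∈ A, x ≠ 0) :
    PairFactorization A A A.card := by
  induction A using Multiset.induction with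
  | empty => exact .zero
  | cons a A ih =>
    have := PairFactorization.cons (X := {a}) (Y := {a}) ?_
      (ih fun x hx => hA x (Multiset.mem_cons_of_mem hx))
    · simpa using this
    · have ha := hA a (Multiset.mem_cons_self _ _)
      have hz : ZeroSumFree ({a} : Multiset G) := fun T hT h0 => by
        rcases Multiset.le_singleton.1 hT with rfl | rfl
        · rfl
        · exact absurd (by simpa using h0) ha
      have := hz.cons_neg_sum
      rw [Multiset.sum_singleton] at this
      rwa [Multiset.map_singleton, add_comm, Multiset.singleton_add]

/-- A factor `X + (-Y)` has `X = Y`, and is then a pair `x, -x`, or `X` and `Y` are complementary in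
`U`. In the latter case the other factors make up `Y + (-X)`, the negative of this factor, so there
is exactly one of them. Otherwise all factors are pairs and there are `|U|` of them. -/
theorem AlmostDissociated.lengthGap (hF : AlmostDissociated U) :
    LengthGap U.card U U := by
  classical
  -- pieces of a factorization that are not pairs of opposite elements
  have key : ∀ A B n, PairFactorization A B n → A ≤ U → B ≤ U →
      (A = B ∧ A.card = n) ∨ ∃ X Y, X ≤ U ∧ Y ≤ U ∧ IsMinimalZeroSum (X + Y.map Neg.neg) ∧ X + Y = U ∧
        ∃ m, n = m + 1 ∧ ∃ A' B', A = X + A' ∧ B = Y + B' ∧ PairFactorization A' B' m := by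
    intro A B n h hA hB
    induction h with
    | zero => simp
    | @cons X Y A B n hW h ih =>
      have hX := (Multiset.le_add_right X A).trans hA
      have hY := (Multiset.le_add_right Y B).trans hB
      have hs := hW.2.1
      rw [Multiset.sum_add, sum_map_neg_eq, add_neg_eq_zero] at hs
      rcases hF X Y hX hY hs with rfl | ⟨h1, -⟩
      · rcases ih ((Multiset.le_add_left _ _).trans hA) ((Multiset.le_add_left _ _).trans hB) with
          ⟨rfl, h2⟩ | ⟨X', Y', h1, h2, h3, h4, m, rfl, A', B', rfl, rfl, h5⟩
        · left
          refine ⟨rfl, ?_⟩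
          have hX0 : X ≠ 0 := by rintro rfl; exact hW.1 rfl
          obtain ⟨x, hx⟩ := Multiset.exists_mem_of_ne_zero hX0
          have : ¬ 3 ≤ X.card + X.card := fun hc => not_isMinimalZeroSum_of_mem hx hx hc hW
          have := Multiset.card_pos.2 hX0
          rw [Multiset.card_add]; omega
        · right
          exact ⟨X', Y', h1, h2, h3, h4, m + 1, rfl, X + A', X + B', by abel, by abel, .cons hW h5⟩
      · right
        exact ⟨X, Y, hX, hY, hW, h1, n, rfl, A, B, rfl, rfl, h⟩
  intro n hn
  rcases key U U n hn le_rfl le_rfl with h | ⟨X, Y, hX, hY, h1, h2, m, rfl, A', B', hA', hB', h3⟩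
  · exact Or.inr h.2.le
  · left
    rw [← h2] at hA' hB'
    have e1 := add_left_cancel hA'
    rw [add_comm] at hB'
    have e2 := add_left_cancel hB'
    subst e1 e2
    have := h3.hasFactorization.eq_one ?_
    · omega
    · have := h1.map_neg
      rwa [Multiset.map_add, Multiset.map_map, show (Neg.neg ∘ Neg.neg : G → G) = id by ext; simp,
        Multiset.map_id, add_comm] at this

end Gap

/-! ### The Davenport constant of a finite group; cyclic groups, elementary 2-groups and small
values. -/

section Davenport

variable {G : Type*} [AddCommGroup G]

/-- Each new term `a` enlarges the set of subsums. Otherwise translation by `a` maps this finite set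
into itself, hence onto it, and 0 is the sum of a subsequence containing `a`. -/
theorem ZeroSumFree.card_lt_ncard [Finite G] {S : Multiset G} (hS : ZeroSumFree S) :
    S.card < {x | ∃ T ≤ S, T.sum = x}.ncard := by
  induction S using Multiset.induction with
  | empty => exact (Set.ncard_pos (Set.toFinite _)).2 ⟨0, 0, le_rfl, by simp⟩
  | cons a S ih =>
    have ih := ih (hS.mono (Multiset.le_cons_self _ _))
    rw [Multiset.card_cons]
    refine lt_of_le_of_lt ih (Set.ncard_lt_ncard (Set.ssubset_iff_subset_ne.2 ⟨?_, fun he => ?_⟩)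
      (Set.toFinite _))
    · rintro x ⟨T, hT, rfl⟩
      exact ⟨T, hT.trans (Multiset.le_cons_self _ _), rfl⟩
    · have hmaps : Set.MapsTo (a + ·) {x | ∃ T ≤ S, T.sum = x} {x | ∃ T ≤ S, T.sum = x} := by
        rintro x ⟨T, hT, rfl⟩
        rw [he]
        exact ⟨a ::ₘ T, Multiset.cons_le_cons _ hT, by simp⟩
      obtain ⟨x, ⟨T, hT, rfl⟩, hx⟩ := Set.surj_on_of_inj_on_of_ncard_le (fun x _ => a + x)
        (fun x hx => hmaps hx) (fun x y _ _ hxy => add_left_cancel hxy) le_rfl (Set.toFinite _) 0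
        ⟨0, Multiset.zero_le _, Multiset.sum_zero⟩
      have := hS (a ::ₘ T) (Multiset.cons_le_cons _ hT) (by simpa using hx.symm)
      exact Multiset.cons_ne_zero this

theorem ZeroSumFree.card_lt_natCard [Finite G] {S : Multiset G} (hS : ZeroSumFree S) :
    S.card < Nat.card G :=
  hS.card_lt_ncard.trans_le (Set.ncard_le_card _)

theorem lengthBound_of_zeroSumFree {D : ℕ} (h : ∀ S : Multiset G, ZeroSumFree S → S.card < D) :
    LengthBound G D := fun U hU => by
  obtain ⟨a, ha⟩ := Multiset.exists_mem_of_ne_zero hU.1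
  obtain ⟨U', rfl⟩ := Multiset.exists_cons_of_mem ha
  have := h U' hU.zeroSumFree_of_cons
  rw [Multiset.card_cons]; omega

variable (G) in
theorem lengthBound_natCard [Finite G] : LengthBound G (Nat.card G) :=
  lengthBound_of_zeroSumFree fun _ hS => hS.card_lt_natCard

theorem isMinimalZeroSum_zero : IsMinimalZeroSum ({0} : Multiset G) := by
  refine ⟨by simp, by simp, fun T hT h0 _ => ?_⟩
  exact (Multiset.le_singleton.1 hT).resolve_left h0

variable (G) in
theorem exists_davenportConstant_eq [Finite G] : ∃ D : ℕ, davenportConstant G = D ∧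
    LengthBound G D ∧ ∃ U : Multiset G, IsMinimalZeroSum U ∧ U.card = D := by
  classical
  have hb := lengthBound_natCard G
  set p : ℕ → Prop := fun n => ∃ U : Multiset G, IsMinimalZeroSum U ∧ U.card = n with hp
  have h1 : p 1 := ⟨{0}, isMinimalZeroSum_zero, by simp⟩
  have h1' : 1 ≤ Nat.card G := by simpa using hb _ isMinimalZeroSum_zero
  have hs := Nat.findGreatest_spec h1' h1
  have hD : LengthBound G (Nat.findGreatest p (Nat.card G)) := fun U hU =>
    Nat.le_findGreatest (hb U hU) ⟨U, hU, rfl⟩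
  refine ⟨Nat.findGreatest p (Nat.card G), ?_, hD, hs⟩
  apply le_antisymm
  · apply sSup_le
    rintro x ⟨S, hS, rfl⟩
    exact_mod_cast hD S hS
  · obtain ⟨U, hU, hc⟩ := hs
    exact le_sSup ⟨U, hU, by rw [hc]⟩

variable {D : ℕ}

theorem zeroSumFree_singleton {a : G} (ha : a ≠ 0) : ZeroSumFree ({a} : Multiset G) :=
  fun T hT h0 => by
    rcases Multiset.le_singleton.1 hT with rfl | rfl
    · rfl
    · exact absurd (by simpa using h0) ha

theorem three_le_of_lengthBound [Finite G] (hD : LengthBound G D) (hG : 3 ≤ Nat.card G) :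
    3 ≤ D := by
  by_contra hlt
  have : Nontrivial G := (Finite.one_lt_card_iff_nontrivial).1 (by omega)
  obtain ⟨a, ha⟩ := exists_ne (0 : G)
  have hcov := hD.exists_sum_eq (zeroSumFree_singleton ha) (by simp; omega)
  have hsub : (Set.univ : Set G) ⊆ {0, a} := fun x _ => by
    obtain ⟨T, hT, rfl⟩ := hcov x
    rcases Multiset.le_singleton.1 hT with rfl | rfl <;> simp
  have h1 := Set.ncard_le_ncard hsub (Set.toFinite _)
  have h2 := Set.ncard_insert_le (0 : G) {a}
  rw [Set.ncard_univ] at h1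
  rw [Set.ncard_singleton] at h2
  omega

theorem zeroSumFree_replicate {g : G} {n : ℕ} (h : ∀ j, 0 < j → j ≤ n → j • g ≠ 0) :
    ZeroSumFree (Multiset.replicate n g) := fun T hT h0 => by
  obtain ⟨j, hj, rfl⟩ := Multiset.le_replicate_iff.1 hT
  rw [Multiset.sum_replicate] at h0
  by_contra hne
  exact h j (Nat.pos_of_ne_zero fun h => hne (by simp [h])) hj h0

theorem isMinimalZeroSum_replicate [Finite G] (g : G) :
    IsMinimalZeroSum (Multiset.replicate (addOrderOf g) g) := by
  have hpos := addOrderOf_pos g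
  refine ⟨fun h => ?_, by simp [addOrderOf_nsmul_eq_zero], fun T hT hT0 h0 => ?_⟩
  · have := congrArg Multiset.card h
    rw [Multiset.card_replicate, Multiset.card_zero] at this; omega
  · obtain ⟨j, hj, rfl⟩ := Multiset.le_replicate_iff.1 hT
    rw [Multiset.sum_replicate] at h0
    have hj0 : 0 < j := Nat.pos_of_ne_zero fun h => hT0 (by simp [h])
    rw [le_antisymm hj (Nat.le_of_dvd hj0 (addOrderOf_dvd_of_nsmul_eq_zero h0))]

/-- Two exponents between 0 and the order of `g` that are congruent modulo the order are equal or
are the two ends. -/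
theorem almostDissociated_replicate [Finite G] (g : G) :
    AlmostDissociated (Multiset.replicate (addOrderOf g) g) := by
  intro A B hA hB hs
  obtain ⟨i, hi, rfl⟩ := Multiset.le_replicate_iff.1 hA
  obtain ⟨j, hj, rfl⟩ := Multiset.le_replicate_iff.1 hB
  rw [Multiset.sum_replicate, Multiset.sum_replicate] at hs
  rw [nsmul_eq_nsmul_iff_modEq] at hs
  by_cases hij : i = j
  · exact Or.inl (by rw [hij])
  right
  rcases hi.lt_or_eq with hi | rfl <;> rcases hj.lt_or_eq with hj | rfl
  · exact absurd (hs.eq_of_lt_of_lt hi hj) hij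
  · have : i = 0 := Nat.eq_zero_of_dvd_of_lt
      ((Nat.modEq_zero_iff_dvd).1 (hs.trans (by simp [Nat.ModEq]))) hi
    subst this
    simp
  · have : j = 0 := Nat.eq_zero_of_dvd_of_lt
      ((Nat.modEq_zero_iff_dvd).1 (hs.symm.trans (by simp [Nat.ModEq]))) hj
    subst this
    simp
  · exact absurd rfl hij

theorem exists_almostDissociated_of_cyclic [Finite G] (hD : LengthBound G D) {U : Multiset G}
    (hU : IsMinimalZeroSum U) (hc : U.card = D)
    (hG : ∃ g : G, ∀ x : G, ∃ k : ℤ, x = k • g) :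
    ∃ U : Multiset G, IsMinimalZeroSum U ∧ AlmostDissociated U ∧ U.card = D := by
  obtain ⟨g, hg⟩ := hG
  refine ⟨_, isMinimalZeroSum_replicate g, almostDissociated_replicate g, ?_⟩
  have h1 := hD _ (isMinimalZeroSum_replicate g)
  have h2 := lengthBound_natCard G U hU
  have h3 : Nat.card G ≤ addOrderOf g := by
    rw [← Nat.card_zmultiples, ← Nat.card_univ (α := G)]
    refine Nat.card_mono (Set.toFinite _) fun x _ => ?_
    obtain ⟨k, hk⟩ := hg x
    exact ⟨k, hk.symm⟩
  rw [Multiset.card_replicate] at *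
  omega

/-- All multiplicities in `U` are one, and subsequences with equal sums have a zero-sum symmetric
difference, which is empty or all of `U`. -/
theorem almostDissociated_of_elementary {U : Multiset G} (hU : IsMinimalZeroSum U)
    (h3 : 3 ≤ U.card) (hG : ∀ x : G, x + x = 0) : AlmostDissociated U := by
  classical
  have hnd : ∀ x, U.count x ≤ 1 := by
    intro x
    by_contra hx
    have hle : Multiset.replicate 2 x ≤ U := Multiset.le_count_iff_replicate_le.1 (by omega)
    have := hU.eq_zero_of_card_lt hle (by simp [hG]) (by
      rw [Multiset.card_replicate]; omega)
    simpa using congrArg Multiset.card this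
  intro A B hA hB hs
  have hle : A - B + (B - A) ≤ U := by
    rw [Multiset.le_iff_count] at *
    intro x
    have := hA x; have := hB x; have := hnd x
    rw [Multiset.count_add, Multiset.count_sub, Multiset.count_sub]; omega
  have h0 : (A - B + (B - A)).sum = 0 := by
    have e1 : A - B + A ∩ B = A := by
      ext x; rw [Multiset.count_add, Multiset.count_sub, Multiset.count_inter]; omega
    have e2 : B - A + A ∩ B = B := by
      ext x; rw [Multiset.count_add, Multiset.count_sub, Multiset.count_inter]; omega
    rw [Multiset.sum_add]
    have e3 : (A - B).sum = (B - A).sum := by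
      apply add_right_cancel (b := (A ∩ B).sum)
      rw [← Multiset.sum_add, ← Multiset.sum_add, e1, e2, hs]
    rw [e3, hG]
  have hcount : ∀ x, A.count x ≤ U.count x ∧ B.count x ≤ U.count x := fun x =>
    ⟨Multiset.le_iff_count.1 hA x, Multiset.le_iff_count.1 hB x⟩
  rcases hU.eq_or hle h0 with h | h
  · left
    ext x
    have := congrArg (Multiset.count x) h
    rw [Multiset.count_add, Multiset.count_sub, Multiset.count_sub, Multiset.count_zero] at this
    omega
  · right
    constructor
    · ext x
      have := congrArg (Multiset.count x) h
      rw [Multiset.count_add, Multiset.count_sub, Multiset.count_sub] at this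
      have := hcount x; have := hnd x
      rw [Multiset.count_add]; omega
    · intro x hx hx'
      have := congrArg (Multiset.count x) h
      rw [Multiset.count_add, Multiset.count_sub, Multiset.count_sub] at this
      have := hcount x; have := hnd x
      have := Multiset.count_pos.2 hx
      have := Multiset.count_pos.2 hx'
      omega

/-- In a group that is not cyclic `g³` cannot be zero-sum free, because its subsums would cover the
group; so every element with `2g ≠ 0` has `3g = 0`. Given such a `g` and some `b` outside `⟨g⟩`,
also `3b = 0`, since `2b = 0` would make `g + b` violate this. Then `g² b²` is zero-sum free of
length 4. -/
theorem cyclic_or_elementary_of_le_four [Finite G] (hD : LengthBound G D) (h4 : D ≤ 4) :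
    (∃ g : G, ∀ x : G, ∃ k : ℤ, x = k • g) ∨ ∀ x : G, x + x = 0 := by
  classical
  by_cases hE : ∀ x : G, x + x = 0
  · exact Or.inr hE
  left
  push Not at hE
  obtain ⟨g, hg⟩ := hE
  have hg0 : g ≠ 0 := by rintro rfl; simp at hg
  by_contra hcyc
  push Not at hcyc
  have horder : ∀ g : G, g ≠ 0 → g + g ≠ 0 → g + g + g = 0 := by
    intro g hg0 hg
    by_contra h3
    obtain ⟨x, hx⟩ := hcyc g
    obtain ⟨T, hT, hs⟩ := hD.exists_sum_eq (S := Multiset.replicate 3 g)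
      (zeroSumFree_replicate fun j h1 h2 => by
        interval_cases j
        · simpa using hg0
        · simpa [two_nsmul] using hg
        · rwa [show 3 • g = g + g + g by abel]) (by simp; omega) x
    obtain ⟨j, -, rfl⟩ := Multiset.le_replicate_iff.1 hT
    exact hx j (by rw [← hs]; simp)
  have hg3 := horder g hg0 hg
  have hg2 : g + g = -g := eq_neg_of_add_eq_zero_left hg3
  obtain ⟨b, hb⟩ := hcyc g
  have hb0 : b ≠ 0 := fun h => hb 0 (by simpa using h)
  have hbb : b + b ≠ 0 := by
    intro hb2
    have h1 : (g + b) + (g + b) = -g := by rw [add_add_add_comm, hb2, add_zero, hg2]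
    have := horder (g + b) (fun h => hb (-1) (by rw [neg_one_zsmul]; exact eq_neg_of_add_eq_zero_right h))
      (by rw [h1]; simpa using hg0)
    rw [h1, neg_add_cancel_left] at this
    exact hb0 this
  have hb3 := horder b hb0 hbb
  have hb2 : b + b = -b := eq_neg_of_add_eq_zero_left hb3
  have hz : ZeroSumFree (Multiset.replicate 2 g + Multiset.replicate 2 b) := by
    intro T hT h0
    obtain ⟨T₁, T₂, h1, h2, rfl⟩ := exists_add_of_le_add hT
    obtain ⟨i, hi, rfl⟩ := Multiset.le_replicate_iff.1 h1
    obtain ⟨j, hj, rfl⟩ := Multiset.le_replicate_iff.1 h2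
    rw [Multiset.sum_add, Multiset.sum_replicate, Multiset.sum_replicate] at h0
    interval_cases j
    · rw [zero_nsmul, add_zero] at h0
      interval_cases i
      · simp
      · exact absurd (by simpa using h0) hg0
      · exact absurd (by simpa [two_nsmul] using h0) hg
    · exact absurd (by rw [one_nsmul] at h0; rw [eq_neg_of_add_eq_zero_right h0]; simp) (hb (-(i : ℤ)))
    · refine absurd ?_ (hb (i : ℤ))
      rw [two_nsmul, hb2, ← sub_eq_add_neg, sub_eq_zero] at h0
      simpa using h0.symm
  have := hD.card_lt hz
  simp at this
  omega

end Davenport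

/-! ### A bound for the Davenport constant from the group ring over the field with two elements. -/

section GroupRing

variable {G : Type*} [AddCommGroup G]

instance charP_addMonoidAlgebra_zmod_two : CharP (AddMonoidAlgebra (ZMod 2) G) 2 :=
  charP_of_injective_algebraMap (FaithfulSMul.algebraMap_injective (ZMod 2) _) 2

/-- The element `1 + X ^ g` of the group ring over the field with two elements. -/
noncomputable def oneAddSingle (g : G) : AddMonoidAlgebra (ZMod 2) G :=
  1 + AddMonoidAlgebra.single g 1

theorem oneAddSingle_add (g h : G) :
    oneAddSingle (g + h) = oneAddSingle g + AddMonoidAlgebra.single g 1 * oneAddSingle h := by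
  have hc : (AddMonoidAlgebra.single g 1 + AddMonoidAlgebra.single g 1 :
      AddMonoidAlgebra (ZMod 2) G) = 0 := CharTwo.add_self_eq_zero _
  rw [oneAddSingle, oneAddSingle, oneAddSingle, mul_add, mul_one, AddMonoidAlgebra.single_mul_single,
    one_mul, add_assoc, ← add_assoc (AddMonoidAlgebra.single g 1), hc, zero_add]

theorem oneAddSingle_zero : oneAddSingle (0 : G) = 0 := by
  rw [oneAddSingle, ← AddMonoidAlgebra.one_def]; exact CharTwo.add_self_eq_zero _

theorem oneAddSingle_sq (g : G) : oneAddSingle g ^ 2 = oneAddSingle (g + g) := by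
  rw [oneAddSingle, CharTwo.add_sq, oneAddSingle, one_pow, sq, AddMonoidAlgebra.single_mul_single,
    one_mul]

theorem oneAddSingle_neg (g : G) :
    oneAddSingle (-g) = AddMonoidAlgebra.single (-g) 1 * oneAddSingle g := by
  have := oneAddSingle_add (-g) g
  rw [neg_add_cancel, oneAddSingle_zero] at this
  exact CharTwo.add_eq_zero.1 this.symm

/-- By `oneAddSingle_add` and `oneAddSingle_neg`, the elements `g` with `1 + X^g` in an ideal form a
subgroup. -/
theorem oneAddSingle_mem_of_closure {I : Ideal (AddMonoidAlgebra (ZMod 2) G)} {s : Set G}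
    (hs : ∀ g ∈ s, oneAddSingle g ∈ I) {g : G} (hg : g ∈ AddSubgroup.closure s) :
    oneAddSingle g ∈ I := by
  induction hg using AddSubgroup.closure_induction with
  | mem x hx => exact hs x hx
  | zero => rw [oneAddSingle_zero]; exact I.zero_mem
  | add x y _ _ hx hy => rw [oneAddSingle_add]; exact I.add_mem hx (I.mul_mem_left _ hy)
  | neg x _ hx => rw [oneAddSingle_neg]; exact I.mul_mem_left _ hx

theorem exists_sum_eq_of_coeff_ne_zero {S : Multiset G} {x : G}
    (h : (S.map oneAddSingle).prod.coeff x ≠ 0) : ∃ T ≤ S, T.sum = x := by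
  induction S using Multiset.induction generalizing x with
  | empty =>
    rw [Multiset.map_zero, Multiset.prod_zero, AddMonoidAlgebra.one_def] at h
    refine ⟨0, le_rfl, ?_⟩
    by_contra hx
    exact h (by rw [AddMonoidAlgebra.coeff_single, Finsupp.single_eq_of_ne (by simpa [eq_comm] using hx)])
  | cons a S ih =>
    rw [Multiset.map_cons, Multiset.prod_cons, oneAddSingle, add_mul, one_mul] at h
    by_cases h1 : (S.map oneAddSingle).prod.coeff x = 0
    · have h2 : (S.map oneAddSingle).prod.coeff (-a + x) ≠ 0 := by
        intro h2
        apply h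
        have h3 := AddMonoidAlgebra.coeff_single_mul_apply (S.map oneAddSingle).prod (1 : ZMod 2) a x
        rw [h2, mul_zero] at h3
        rw [AddMonoidAlgebra.coeff_add, Finsupp.add_apply, h1, h3, add_zero]
      obtain ⟨T, hT, hs⟩ := ih h2
      exact ⟨a ::ₘ T, Multiset.cons_le_cons _ hT, by rw [Multiset.sum_cons, hs]; abel⟩
    · obtain ⟨T, hT, hs⟩ := ih h1
      exact ⟨T, hT.trans (Multiset.le_cons_self _ _), hs⟩

/-- The exponents that occur in the product are subsums, and only the empty one is 0. So the product
attached to a zero-sum free sequence does not vanish, which limits its length once the ideal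
containing the factors is nilpotent. -/
theorem ZeroSumFree.coeff_zero {S : Multiset G} (hS : ZeroSumFree S) :
    (S.map oneAddSingle).prod.coeff 0 = 1 := by
  induction S using Multiset.induction with
  | empty =>
    rw [Multiset.map_zero, Multiset.prod_zero, AddMonoidAlgebra.one_def]
    rw [AddMonoidAlgebra.coeff_single, Finsupp.single_eq_same]
  | cons a S ih =>
    have ih := ih (hS.mono (Multiset.le_cons_self _ _))
    have h2 : (S.map oneAddSingle).prod.coeff (-a + 0) = 0 := by
      by_contra h2
      obtain ⟨T, hT, hs⟩ := exists_sum_eq_of_coeff_ne_zero h2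
      have := hS (a ::ₘ T) (Multiset.cons_le_cons _ hT) (by rw [Multiset.sum_cons, hs]; simp)
      exact Multiset.cons_ne_zero this
    have h3 := AddMonoidAlgebra.coeff_single_mul_apply (S.map oneAddSingle).prod (1 : ZMod 2) a 0
    rw [h2, mul_zero] at h3
    rw [Multiset.map_cons, Multiset.prod_cons, oneAddSingle, add_mul, one_mul]
    rw [AddMonoidAlgebra.coeff_add, Finsupp.add_apply, ih, h3, add_zero]

theorem multiset_prod_mem_pow_card {R : Type*} [CommRing R] {I : Ideal R} {S : Multiset R}
    (hS : ∀ x ∈ S, x ∈ I) : S.prod ∈ I ^ S.card := by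
  induction S using Multiset.induction with
  | empty => simp
  | cons a S ih =>
    rw [Multiset.prod_cons, Multiset.card_cons, pow_succ']
    exact Ideal.mul_mem_mul (hS a (Multiset.mem_cons_self _ _))
      (ih fun x hx => hS x (Multiset.mem_cons_of_mem hx))

theorem sum_pow_card_succ_eq_zero {R ι : Type*} [CommSemiring R] (s : Finset ι) (J : ι → R)
    (hJ : ∀ i ∈ s, J i ^ 2 = 0) : (∑ i ∈ s, J i) ^ (s.card + 1) = 0 := by
  classical
  induction s using Finset.induction_on with
  | empty => simp
  | insert a s ha ih =>
    rw [Finset.sum_insert ha, Finset.card_insert_of_notMem ha]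
    exact (Commute.all _ _).add_pow_eq_zero_of_add_le_succ_of_pow_eq_zero
      (hJ a (Finset.mem_insert_self _ _)) (ih fun i hi => hJ i (Finset.mem_insert_of_mem hi))
      (by omega)

/-- An upper bound for the Davenport constant of a group that is generated by involutions and one
element of order dividing four. -/
theorem lengthBound_of_closure {ι : Type*} [Fintype ι] (e : ι → G) (f : G)
    (he : ∀ i, e i + e i = 0) (hf : (f + f) + (f + f) = 0)
    (hG : AddSubgroup.closure (Set.range e ∪ {f}) = ⊤) : LengthBound G (Fintype.card ι + 4) := by
  refine lengthBound_of_zeroSumFree fun S hS => ?_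
  by_contra! hc
  set J : ι → Ideal (AddMonoidAlgebra (ZMod 2) G) := fun i => Ideal.span {oneAddSingle (e i)}
  set K : Ideal (AddMonoidAlgebra (ZMod 2) G) := Ideal.span {oneAddSingle f}
  have hJ : ∀ i, J i ^ 2 = 0 := fun i => by
    change Ideal.span {oneAddSingle (e i)} ^ 2 = 0
    rw [Ideal.span_singleton_pow, oneAddSingle_sq, he, oneAddSingle_zero]
    simp
  have hK : K ^ 4 = 0 := by
    change Ideal.span {oneAddSingle f} ^ 4 = 0
    rw [Ideal.span_singleton_pow, show 4 = 2 * 2 from rfl, pow_mul, oneAddSingle_sq,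
      oneAddSingle_sq, hf, oneAddSingle_zero]
    simp
  -- The sum of the `J i` is nilpotent with exponent `|ι| + 1` and `K` with exponent 4, so their sum
  -- is with exponent `(|ι| + 1) + 4 - 1`.
  have hI : (∑ i, J i + K) ^ (Fintype.card ι + 4) = 0 :=
    (Commute.all _ _).add_pow_eq_zero_of_add_le_succ_of_pow_eq_zero
      (sum_pow_card_succ_eq_zero Finset.univ J fun i _ => hJ i) hK (by rw [Finset.card_univ])
  have hmem : ∀ g : G, oneAddSingle g ∈ ∑ i, J i + K := by
    intro g
    refine oneAddSingle_mem_of_closure (s := Set.range e ∪ {f}) ?_ (by rw [hG]; trivial)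
    rintro g (⟨i, rfl⟩ | hg)
    · refine (show J i ≤ ∑ i, J i + K from ?_) (Ideal.subset_span rfl)
      refine le_trans ?_ (le_sup_left (b := K))
      exact Finset.single_le_sum (f := J) (fun i _ => bot_le) (Finset.mem_univ i)
    · rw [Set.mem_singleton_iff.1 hg]
      exact (le_sup_right (a := ∑ i, J i) (b := K)) (Ideal.subset_span rfl)
  have h1 := multiset_prod_mem_pow_card (I := ∑ i, J i + K) (S := S.map oneAddSingle) (by
    intro x hx
    obtain ⟨g, -, rfl⟩ := Multiset.mem_map.1 hx
    exact hmem g)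
  rw [Multiset.card_map] at h1
  have h2 := Ideal.pow_le_pow_right hc h1
  rw [hI] at h2
  have h3 := hS.coeff_zero
  rw [Ideal.zero_eq_bot, Ideal.mem_bot] at h2
  rw [h2] at h3
  exact zero_ne_one h3

end GroupRing

/-! ### Transport along isomorphisms. -/

section Transfer

variable {G H : Type*} [AddCommGroup G] [AddCommGroup H]

theorem AlmostDissociated.isMinimalZeroSum {U : Multiset G} (hF : AlmostDissociated U)
    (hU : U ≠ 0) (h0 : U.sum = 0) : IsMinimalZeroSum U := by
  refine ⟨hU, h0, fun T hT hT0 hs => ?_⟩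
  rcases hF T 0 hT (Multiset.zero_le _) (by rw [hs, Multiset.sum_zero]) with h | ⟨h, -⟩
  · exact absurd h hT0
  · simpa using h

theorem IsMinimalZeroSum.map {U : Multiset G} (hU : IsMinimalZeroSum U) (e : G ≃+ H) :
    IsMinimalZeroSum (U.map e) := by
  refine ⟨fun h => hU.1 (Multiset.map_eq_zero.1 h), by rw [← map_multiset_sum, hU.2.1, map_zero],
    fun T hT hT0 hs => ?_⟩
  obtain ⟨N, hN, rfl⟩ := exists_le_map hT
  rw [← map_multiset_sum, map_eq_zero_iff e e.injective] at hs
  rw [hU.2.2 N hN (fun h => hT0 (by simp [h])) hs]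

theorem LengthBound.map {D : ℕ} (hD : LengthBound G D) (e : G ≃+ H) : LengthBound H D :=
  fun U hU => by simpa using hD _ (hU.map e.symm)

theorem AlmostDissociated.map {U : Multiset G} (hU : AlmostDissociated U) (e : G ≃+ H) :
    AlmostDissociated (U.map e) := by
  intro A B hA hB hs
  obtain ⟨A, hA', rfl⟩ := exists_le_map hA
  obtain ⟨B, hB', rfl⟩ := exists_le_map hB
  rw [← map_multiset_sum, ← map_multiset_sum] at hs
  rcases hU A B hA' hB' (e.injective hs) with rfl | ⟨h1, h2⟩
  · exact Or.inl rfl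
  · right
    refine ⟨by rw [← Multiset.map_add, h1], fun x hx hx' => ?_⟩
    obtain ⟨a, ha, rfl⟩ := Multiset.mem_map.1 hx
    obtain ⟨b, hb, hab⟩ := Multiset.mem_map.1 hx'
    exact h2 a ha (e.injective hab ▸ hb)

end Transfer

/-! ### A bound for the Davenport constant from an elementary 2-quotient of order at most four. -/

section KleinQuotient

variable {G Q : Type*} [AddCommGroup G] [AddCommGroup Q] [Finite Q]

/-- If three terms `a, b, c` had no nonempty subsum in the kernel, then `0, f a, f b, f c, f a + f
b` would be five different elements of `Q`. -/
theorem exists_le_map_sum_eq_zero (hQ : ∀ q : Q, q + q = 0) (hc : Nat.card Q ≤ 4) (f : G →+ Q)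
    {S : Multiset G} (hS : 3 ≤ S.card) : ∃ T ≤ S, T ≠ 0 ∧ f T.sum = 0 := by
  obtain ⟨T, hT⟩ := Multiset.card_pos_iff_exists_mem.1
    (show 0 < (Multiset.powersetCard 3 S).card by rw [Multiset.card_powersetCard]; exact Nat.choose_pos hS)
  obtain ⟨hTS, hT⟩ := Multiset.mem_powersetCard.1 hT
  obtain ⟨a, b, c, rfl⟩ := Multiset.card_eq_three.1 hT
  by_contra! hcon
  have hcon : ∀ T ≤ ({a, b, c} : Multiset G), T ≠ 0 → f T.sum ≠ 0 := fun T hT =>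
    hcon T (hT.trans hTS)
  have key : ∀ x y : Q, x = y → x + y = 0 := fun x y h => by rw [h, hQ]
  have h1 := hcon {a} (by simp) (by simp)
  have h2 := hcon {b} (by simp) (by simp)
  have h3 := hcon {c} (by simp) (by simp)
  have h12 := hcon {a, b} (by
    rw [show ({a, b, c} : Multiset G) = {a, b} + {c} from rfl]; exact Multiset.le_add_right _ _)
    (by simp)
  have h13 := hcon {a, c} (by
    rw [show ({a, b, c} : Multiset G) = b ::ₘ {a, c} from Multiset.cons_swap _ _ _]
    exact Multiset.le_cons_self _ _) (by simp)
  have h23 := hcon {b, c} (Multiset.le_cons_self _ _) (by simp)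
  have h123 := hcon {a, b, c} le_rfl (by simp)
  simp only [Multiset.insert_eq_cons, Multiset.sum_cons, Multiset.sum_singleton, map_add] at *
  have hn : [0, f a, f b, f c, f a + f b].Nodup := by
    simp only [List.nodup_cons, List.mem_cons, List.not_mem_nil, or_false, not_or,
      List.nodup_nil, and_true, not_false_eq_true]
    refine ⟨⟨Ne.symm h1, Ne.symm h2, Ne.symm h3, Ne.symm h12⟩, ⟨fun h => h12 (key _ _ h),
      fun h => h13 (key _ _ h), fun h => h2 (by simpa using h)⟩, ⟨fun h => h23 (key _ _ h),
      fun h => h1 (by simpa using h)⟩, fun h => h123 ?_⟩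
    rw [h, ← add_assoc]; exact hQ _
  have := Fintype.ofFinite Q
  have := hn.length_le_card
  rw [Nat.card_eq_fintype_card] at hc
  simp at this
  omega

theorem exists_pair_le_map_sum_eq_zero (hQ : ∀ q : Q, q + q = 0) (f : G →+ Q) {S : Multiset G}
    (hS : Nat.card Q < S.card) : ∃ T ≤ S, T.card = 2 ∧ f T.sum = 0 := by
  classical
  have := Fintype.ofFinite Q
  have hn : ¬ (S.map f).Nodup := fun hn => by
    have := Finset.card_le_univ (⟨S.map f, hn⟩ : Finset Q)
    rw [Nat.card_eq_fintype_card] at hS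
    simp at this; omega
  rw [Multiset.nodup_iff_count_le_one] at hn
  push Not at hn
  obtain ⟨q, hq⟩ := hn
  obtain ⟨T, hT, h⟩ := exists_le_map (Multiset.le_count_iff_replicate_le.1 hq)
  refine ⟨T, hT, by simpa using congrArg Multiset.card h, ?_⟩
  rw [map_multiset_sum, h]
  simp [hQ]

/-- As long as at least five terms remain, two have the same image and are split off as a pair; the
last three terms supply the final subsequence. -/
theorem exists_family_map_sum_eq_zero (hQ : ∀ q : Q, q + q = 0) (hc : Nat.card Q ≤ 4)
    (f : G →+ Q) (k : ℕ) : ∀ S : Multiset G, 2 * k + 1 ≤ S.card → ∃ F : Multiset (Multiset G),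
      F.card = k ∧ F.sum ≤ S ∧ ∀ T ∈ F, T ≠ 0 ∧ f T.sum = 0 := by
  induction k with
  | zero => exact fun S _ => ⟨0, by simp⟩
  | succ k ih =>
    intro S hS
    rcases Nat.eq_zero_or_pos k with rfl | hk
    · obtain ⟨T, hT, h⟩ := exists_le_map_sum_eq_zero hQ hc f (S := S) (by omega)
      exact ⟨{T}, by simp, by simpa using hT, by simpa using h⟩
    · obtain ⟨T, hT, h2, h0⟩ := exists_pair_le_map_sum_eq_zero hQ f (S := S) (by omega)
      obtain ⟨S', rfl⟩ := Multiset.le_iff_exists_add.1 hT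
      rw [Multiset.card_add] at hS
      obtain ⟨F, h3, h4, h5⟩ := ih S' (by omega)
      refine ⟨T ::ₘ F, by simp [h3], by simpa using h4, fun X hX => ?_⟩
      rcases Multiset.mem_cons.1 hX with rfl | hX
      · exact ⟨by rintro rfl; simp at h2, h0⟩
      · exact h5 X hX

/-- From `2k + 1` terms, where `k` is the order of the kernel, one obtains `k` disjoint subsequences
with sums in the kernel. Some of these sums add up to 0. -/
theorem lengthBound_of_ker (hQ : ∀ q : Q, q + q = 0) (hc : Nat.card Q ≤ 4) (f : G →+ Q)
    [Finite f.ker] : LengthBound G (2 * Nat.card f.ker + 1) := by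
  refine lengthBound_of_zeroSumFree fun S hS => ?_
  by_contra! hlt
  obtain ⟨F, hF, hFS, hT⟩ := exists_family_map_sum_eq_zero hQ hc f _ S hlt
  obtain ⟨M, hM⟩ : ∃ M : Multiset f.ker, M.map (↑) = F.map Multiset.sum := by
    refine CanLift.prf (F.map Multiset.sum) fun x hx => ?_
    obtain ⟨T, hTF, rfl⟩ := Multiset.mem_map.1 hx
    exact (hT T hTF).2
  have hMc : M.card = Nat.card f.ker := by
    have := congrArg Multiset.card hM
    simpa [hF] using this
  have hz : ¬ ZeroSumFree M := fun h => by have := h.card_lt_natCard; omega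
  simp only [ZeroSumFree, not_forall] at hz
  obtain ⟨N, hN, h0, hN0⟩ := hz
  obtain ⟨F', hF', he⟩ := exists_le_map (T := N.map (↑)) (M := F) (f := Multiset.sum)
    (by rw [← hM]; exact Multiset.map_le_map hN)
  obtain ⟨F'', rfl⟩ := Multiset.le_iff_exists_add.1 hF'
  have hle : F'.sum ≤ S := by
    rw [Multiset.sum_add] at hFS
    exact (Multiset.le_add_right _ _).trans hFS
  have hs : F'.sum.sum = 0 := by
    have h1 : F'.sum.sum = (F'.map Multiset.sum).sum := by
      have := map_multiset_sum (Multiset.sumAddMonoidHom : Multiset G →+ G) F'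
      simpa using this
    rw [h1, he]
    have := map_multiset_sum f.ker.subtype N
    rw [h0] at this
    simpa using this.symm
  have hz := hS _ hle hs
  apply hN0
  rw [← Multiset.map_eq_zero (f := ((↑) : f.ker → G)), ← he, Multiset.map_eq_zero]
  by_contra hne
  obtain ⟨T, hTm⟩ := Multiset.exists_mem_of_ne_zero hne
  obtain ⟨F₃, rfl⟩ := Multiset.exists_cons_of_mem hTm
  rw [Multiset.sum_cons] at hz
  have := (hT T (by simp)).1
  apply this
  rw [← Multiset.le_zero, ← hz]
  exact Multiset.le_add_right _ _

end KleinQuotient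

/-! ### Almost dissociated sequences of length at least `D - 1` in the two families of groups. -/

section Models

/-- A cyclic group has at most two elements modulo a subgroup that contains all doubles. -/
theorem not_cyclic_of_hom {G Q : Type*} [AddCommGroup G] [AddCommGroup Q] (f : G →+ Q)
    (hQ : ∀ q : Q, q + q = 0) {a b : G} (ha : f a ≠ 0) (hb : f b ≠ 0) (hab : f a ≠ f b) :
    ¬ ∃ g : G, ∀ x : G, ∃ k : ℤ, x = k • g := by
  rintro ⟨g, hg⟩
  have key : ∀ x, f x = 0 ∨ f x = f g := by
    intro x
    obtain ⟨k, rfl⟩ := hg x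
    rw [map_zsmul]
    obtain ⟨l, rfl | rfl⟩ := Int.even_or_odd' k
    · left
      rw [two_mul, add_zsmul, hQ]
    · right
      rw [two_mul, add_zsmul, add_zsmul, hQ, zero_add, one_zsmul]
  exact hab (((key a).resolve_left ha).trans ((key b).resolve_left hb).symm)

theorem zmod_two_add_self (q : ZMod 2) : q + q = 0 := CharTwo.add_self_eq_zero q

section RankTwo

variable (n : ℕ)

/-- Take `(0, 1)` with multiplicity `2n`. Reduction modulo 2 has a kernel of order `n`, so the
Davenport constant is at most `2n + 1`. -/
theorem exists_almostDissociated_rankTwo (hn : 2 ≤ n) :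
    ∃ (D : ℕ) (U : Multiset (ZMod 2 × ZMod (2 * n))), LengthBound (ZMod 2 × ZMod (2 * n)) D ∧
      AlmostDissociated U ∧ U ≠ 0 ∧ U.sum = 0 ∧ D ≤ U.card + 1 ∧ 3 ≤ U.card := by
  have : NeZero (2 * n) := ⟨by omega⟩
  have ho : addOrderOf ((0, 1) : ZMod 2 × ZMod (2 * n)) = 2 * n := by
    rw [Prod.addOrderOf, addOrderOf_zero, ZMod.addOrderOf_one, Nat.lcm_one_left]
  have hU := isMinimalZeroSum_replicate ((0, 1) : ZMod 2 × ZMod (2 * n))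
  have hF := almostDissociated_replicate ((0, 1) : ZMod 2 × ZMod (2 * n))
  rw [ho] at hU hF
  let c : ZMod (2 * n) →+ ZMod 2 := (ZMod.castHom (dvd_mul_right 2 n) (ZMod 2)).toAddMonoidHom
  let f : ZMod 2 × ZMod (2 * n) →+ ZMod 2 × ZMod 2 := (AddMonoidHom.id _).prodMap c
  have hsurj : Function.Surjective f := by
    rintro ⟨a, b⟩
    obtain ⟨b', hb'⟩ := ZMod.castHom_surjective (dvd_mul_right 2 n) b
    exact ⟨(a, b'), Prod.ext rfl hb'⟩
  have hker : Nat.card f.ker = n := by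
    have h1 := AddSubgroup.card_mul_index f.ker
    rw [AddSubgroup.index_ker, AddMonoidHom.range_eq_top.2 hsurj, Nat.card_prod, Nat.card_zmod,
      Nat.card_zmod, Nat.card_congr AddSubgroup.topEquiv.toEquiv, Nat.card_prod, Nat.card_zmod] at h1
    omega
  have hb := lengthBound_of_ker (Q := ZMod 2 × ZMod 2) (fun q => by
    ext <;> exact zmod_two_add_self _) (by simp) f
  rw [hker] at hb
  exact ⟨_, _, hb, hF, hU.1, hU.2.1, by simp, by simp; omega⟩

theorem not_cyclic_rankTwo : ¬ ∃ g : ZMod 2 × ZMod (2 * n), ∀ x, ∃ k : ℤ, x = k • g := by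
  let c : ZMod (2 * n) →+ ZMod 2 := (ZMod.castHom (dvd_mul_right 2 n) (ZMod 2)).toAddMonoidHom
  have hc : c 1 = 1 := map_one (ZMod.castHom (dvd_mul_right 2 n) (ZMod 2))
  refine not_cyclic_of_hom ((AddMonoidHom.id (ZMod 2)).prodMap c)
    (fun q => by ext <;> exact zmod_two_add_self _) (a := (1, 0)) (b := (0, 1)) ?_ ?_ ?_ <;>
    simp [hc]

theorem not_elementary_rankTwo (hn : 2 ≤ n) : ¬ ∀ x : ZMod 2 × ZMod (2 * n), x + x = 0 := by
  intro h
  have h1 := congrArg Prod.snd (h (0, 1))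
  have h2 : ((2 : ℕ) : ZMod (2 * n)) = 0 := by
    simpa [one_add_one_eq_two] using h1
  rw [ZMod.natCast_eq_zero_iff] at h2
  have := Nat.le_of_dvd (by omega) h2
  omega

end RankTwo

section RankLarge

variable {ι : Type*} [Fintype ι] [DecidableEq ι]

/-- The sequence `f ^ i * ∏_{j ∈ T} e_j * (2 f + ∑ e_j) ^ s`. -/
def standardSeq (T : Finset ι) (i s : ℕ) : Multiset ((ι → ZMod 2) × ZMod 4) :=
  Multiset.replicate i (0, 1) + T.val.map (fun j => (Pi.single j 1, 0)) +
    Multiset.replicate s (1, 2)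

omit [Fintype ι] in
theorem sum_standardSeq (T : Finset ι) (i s : ℕ) : (standardSeq T i s).sum =
    ((fun j => (if j ∈ T then 1 else 0) + (s : ZMod 2)), (i : ZMod 4) + s * 2) := by
  rw [standardSeq, Multiset.sum_add, Multiset.sum_add, Multiset.sum_replicate,
    Multiset.sum_replicate]
  change i • _ + ∑ j ∈ T, _ + _ = _
  ext j
  · simp [Prod.fst_sum, Finset.sum_apply, Pi.single_apply]
  · simp [Prod.snd_sum]

theorem exists_eq_standardSeq {A : Multiset ((ι → ZMod 2) × ZMod 4)} {i s : ℕ}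
    (hA : A ≤ standardSeq Finset.univ i s) :
    ∃ T i', ∃ s' ≤ s, i' ≤ i ∧ A = standardSeq T i' s' := by
  obtain ⟨A', A₃, h0, h3, rfl⟩ := exists_add_of_le_add hA
  obtain ⟨A₁, A₂, h1, h2, rfl⟩ := exists_add_of_le_add h0
  obtain ⟨i', hi, rfl⟩ := Multiset.le_replicate_iff.1 h1
  obtain ⟨s', hs, rfl⟩ := Multiset.le_replicate_iff.1 h3
  obtain ⟨N, hN, rfl⟩ := exists_le_map h2
  exact ⟨⟨N, Multiset.nodup_of_le hN Finset.univ.nodup⟩, i', s', hs, hi, rfl⟩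

omit [Fintype ι] in
theorem mem_standardSeq {T : Finset ι} {i s : ℕ} {x : (ι → ZMod 2) × ZMod 4}
    (hx : x ∈ standardSeq T i s) : (i ≠ 0 ∧ x = (0, 1)) ∨ (∃ j ∈ T, x = (Pi.single j 1, 0)) ∨
      (s ≠ 0 ∧ x = (1, 2)) := by
  rw [standardSeq, Multiset.mem_add, Multiset.mem_add, Multiset.mem_replicate, Multiset.mem_map,
    Multiset.mem_replicate] at hx
  rcases hx with (hx | ⟨j, hj, rfl⟩) | hx
  · exact Or.inl hx
  · exact Or.inr (Or.inl ⟨j, hj, rfl⟩)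
  · exact Or.inr (Or.inr hx)

/-- The coordinates determine everything from the multiplicity of the last element. If it agrees, so
do `T` and `i`, as `i ≤ 2`. If it differs, the first coordinate makes the sets complementary, and `i
≡ i' + 2` modulo 4 leaves only the values 0 and 2. -/
theorem almostDissociated_standardSeq :
    AlmostDissociated (standardSeq (Finset.univ : Finset ι) 2 1) := by
  intro A B hA hB hs
  obtain ⟨T, i, s, hs1, hi, rfl⟩ := exists_eq_standardSeq hA
  obtain ⟨T', i', s', hs1', hi', rfl⟩ := exists_eq_standardSeq hB
  rw [sum_standardSeq, sum_standardSeq, Prod.mk.injEq] at hs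
  obtain ⟨h1, h2⟩ := hs
  have h1 : ∀ j, (if j ∈ T then (1 : ZMod 2) else 0) + s = (if j ∈ T' then 1 else 0) + s' :=
    fun j => congrFun h1 j
  by_cases hss : s = s'
  · subst hss
    left
    have hT : T = T' := by
      ext j
      have := add_right_cancel (h1 j)
      by_cases h3 : j ∈ T <;> by_cases h4 : j ∈ T' <;> simp_all
    have hi : i = i' := by
      have := add_right_cancel h2
      interval_cases i <;> interval_cases i' <;> revert this <;> decide
    rw [hT, hi]
  · right
    have hs2 : s' = 1 - s := by omega
    have hs3 : (s = 0 ∧ s' = 1) ∨ (s = 1 ∧ s' = 0) := by omega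
    have hT : T' = Tᶜ := by
      ext j
      have := h1 j
      rw [Finset.mem_compl]
      rcases hs3 with ⟨rfl, rfl⟩ | ⟨rfl, rfl⟩ <;> by_cases h3 : j ∈ T <;> by_cases h4 : j ∈ T' <;>
        simp only [h3, h4, if_true, if_false] at this ⊢ <;> revert this <;> decide
    have hi2 : i' = 2 - i ∧ (i = 0 ∨ i = 2) := by
      rcases hs3 with ⟨rfl, rfl⟩ | ⟨rfl, rfl⟩ <;> interval_cases i <;> interval_cases i' <;>
        revert h2 <;> decide
    obtain ⟨rfl, hi2⟩ := hi2
    subst hs2 hT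
    constructor
    · have hT : T.val.map (fun j => ((Pi.single j 1, 0) : (ι → ZMod 2) × ZMod 4)) +
          Tᶜ.val.map (fun j => (Pi.single j 1, 0)) =
          (Finset.univ : Finset ι).val.map (fun j => (Pi.single j 1, 0)) := by
        rw [← Multiset.map_add]
        congr 1
        have := (Finset.disjUnion_val T Tᶜ disjoint_compl_right)
        rw [← this, Finset.disjUnion_eq_union, Finset.union_compl]
      have hr : ∀ (x : (ι → ZMod 2) × ZMod 4) (a b : ℕ), a ≤ b →
          Multiset.replicate b x = Multiset.replicate a x + Multiset.replicate (b - a) x := by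
        intro x a b hab
        rw [← Multiset.replicate_add, Nat.add_sub_cancel' hab]
      rw [standardSeq, standardSeq, standardSeq, ← hT, hr _ i 2 hi, hr _ s 1 hs1]
      abel
    · intro x hx hx'
      rcases mem_standardSeq hx with ⟨h3, rfl⟩ | ⟨j, hj, rfl⟩ | ⟨h3, rfl⟩ <;>
        rcases mem_standardSeq hx' with ⟨h4, h5⟩ | ⟨j', hj', h5⟩ | ⟨h4, h5⟩ <;>
        have h6 := congrArg Prod.snd h5 <;> simp only at h6 
      · omega
      · revert h6; decide
      · revert h6; decide
      · revert h6; decide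
      · have h7 := congrFun (congrArg Prod.fst h5) j
        simp only [Pi.single_eq_same] at h7
        by_cases hjj : j = j'
        · subst hjj
          exact (Finset.mem_compl.1 hj') hj
        · rw [Pi.single_eq_of_ne hjj] at h7
          exact one_ne_zero h7
      · revert h6; decide
      · revert h6; decide
      · revert h6; decide
      · omega

omit [Fintype ι] in
theorem card_standardSeq (T : Finset ι) (i s : ℕ) : (standardSeq T i s).card = i + T.card + s := by
  simp [standardSeq]

/-- The sequence has length `|ι| + 3`, one below the bound `|ι| + 4` from `lengthBound_of_closure`.
-/
theorem exists_almostDissociated_rankLarge [Nonempty ι] :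
    ∃ (D : ℕ) (U : Multiset ((ι → ZMod 2) × ZMod 4)), LengthBound ((ι → ZMod 2) × ZMod 4) D ∧
      AlmostDissociated U ∧ U ≠ 0 ∧ U.sum = 0 ∧ D ≤ U.card + 1 ∧ 3 ≤ U.card := by
  have hb := lengthBound_of_closure (G := (ι → ZMod 2) × ZMod 4)
    (fun j : ι => (Pi.single j 1, 0)) (0, 1) (fun j => by
      ext <;> simp [CharTwo.add_self_eq_zero])
      (by ext <;> simp; decide) ?_
  · refine ⟨_, _, hb, almostDissociated_standardSeq, ?_, ?_, ?_, ?_⟩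
    · intro h
      have := congrArg Multiset.card h
      rw [card_standardSeq] at this
      simp at this
    · rw [sum_standardSeq]
      refine Prod.ext (funext fun j => ?_) ?_
      · simp [CharTwo.add_self_eq_zero]
      · change ((2 : ℕ) : ZMod 4) + ((1 : ℕ) : ZMod 4) * 2 = 0
        decide
    · rw [card_standardSeq, Finset.card_univ]; omega
    · rw [card_standardSeq]; have := Finset.card_pos.2 (Finset.univ_nonempty (α := ι)); omega
  · rw [eq_top_iff]
    rintro ⟨a, b⟩ -
    have : ((a, b) : (ι → ZMod 2) × ZMod 4) = ∑ j, (a j).val • (Pi.single j 1, 0) + b.val • (0, 1) := by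
      ext j
      · simp only [Prod.fst_add, Prod.fst_sum, Pi.add_apply, Finset.sum_apply, Prod.smul_fst,
          smul_zero, Pi.smul_apply, Pi.single_apply, Pi.zero_apply, add_zero]
        simp
      · simp [Prod.snd_sum]
    rw [this]
    refine add_mem (sum_mem fun j _ => AddSubgroup.nsmul_mem _ ?_ _) (AddSubgroup.nsmul_mem _ ?_ _)
    · exact AddSubgroup.subset_closure (Or.inl ⟨j, rfl⟩)
    · exact AddSubgroup.subset_closure (Or.inr rfl)

omit [Fintype ι] [DecidableEq ι] in
theorem not_cyclic_rankLarge [Nonempty ι] :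
    ¬ ∃ g : (ι → ZMod 2) × ZMod 4, ∀ x, ∃ k : ℤ, x = k • g := by
  obtain ⟨j⟩ := ‹Nonempty ι›
  let c : ZMod 4 →+ ZMod 2 := (ZMod.castHom (show 2 ∣ 4 by decide) (ZMod 2)).toAddMonoidHom
  have hc : c 1 = 1 := map_one (ZMod.castHom (show 2 ∣ 4 by decide) (ZMod 2))
  refine not_cyclic_of_hom ((Pi.evalAddMonoidHom (fun _ : ι => ZMod 2) j).prodMap c)
    (fun q => by ext <;> exact zmod_two_add_self _) (a := (1, 0)) (b := (0, 1)) ?_ ?_ ?_ <;>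
    simp [hc]

omit [Fintype ι] [DecidableEq ι] in
theorem not_elementary_rankLarge : ¬ ∀ x : (ι → ZMod 2) × ZMod 4, x + x = 0 := by
  intro h
  have h1 := congrArg Prod.snd (h (0, 1))
  change (1 + 1 : ZMod 4) = 0 at h1
  revert h1; decide

end RankLarge

section Characterization

variable {G : Type*} [AddCommGroup G]

/-- The isomorphism types of groups for which equality holds. -/
theorem exists_almostDissociated_of_iso (h : (∃ r : ℕ, 2 ≤ r ∧
      Nonempty (G ≃+ (Fin (r - 1) → ZMod 2) × ZMod 4)) ∨
      ∃ n : ℕ, 2 ≤ n ∧ Nonempty (G ≃+ ZMod 2 × ZMod (2 * n))) :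
    (¬ ∃ g : G, ∀ x : G, ∃ k : ℤ, x = k • g) ∧ (¬ ∀ x : G, x + x = 0) ∧
    ∃ (D : ℕ) (U : Multiset G), LengthBound G D ∧ AlmostDissociated U ∧ IsMinimalZeroSum U ∧
      D ≤ U.card + 1 ∧ 3 ≤ U.card := by
  have key : ∀ (M : Type) [AddCommGroup M] (_ : G ≃+ M),
      (¬ ∃ g : M, ∀ x : M, ∃ k : ℤ, x = k • g) → (¬ ∀ x : M, x + x = 0) →
      (∃ (D : ℕ) (U : Multiset M), LengthBound M D ∧ AlmostDissociated U ∧ U ≠ 0 ∧ U.sum = 0 ∧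
        D ≤ U.card + 1 ∧ 3 ≤ U.card) →
      (¬ ∃ g : G, ∀ x : G, ∃ k : ℤ, x = k • g) ∧ (¬ ∀ x : G, x + x = 0) ∧
      ∃ (D : ℕ) (U : Multiset G), LengthBound G D ∧ AlmostDissociated U ∧ IsMinimalZeroSum U ∧
      D ≤ U.card + 1 ∧ 3 ≤ U.card := by
    rintro M _ e h1 h2 ⟨D, U, h3, h4, h5, h6, h7, h8⟩
    refine ⟨fun ⟨g, hg⟩ => h1 ⟨e g, fun x => ?_⟩, fun hx => h2 fun x => ?_, D, U.map e.symm,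
      h3.map e.symm, h4.map e.symm, (h4.isMinimalZeroSum h5 h6).map e.symm, by simpa using h7,
      by simpa using h8⟩
    · obtain ⟨k, hk⟩ := hg (e.symm x)
      exact ⟨k, by rw [← map_zsmul, ← hk, e.apply_symm_apply]⟩
    · have := congrArg e (hx (e.symm x))
      simpa using this
  rcases h with ⟨r, hr, ⟨e⟩⟩ | ⟨n, hn, ⟨e⟩⟩
  · have : Nonempty (Fin (r - 1)) := ⟨⟨0, by omega⟩⟩
    exact key _ e not_cyclic_rankLarge not_elementary_rankLarge exists_almostDissociated_rankLarge
  · exact key _ e (not_cyclic_rankTwo n) (not_elementary_rankTwo n hn)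
      (exists_almostDissociated_rankTwo n hn)

end Characterization

end Models

/-! ### Isomorphism types of the groups found. -/

section Structure

variable {G : Type*} [AddCommGroup G] [Finite G]

/-- As `G` is not cyclic, `t` lies outside `⟨g⟩`, so the sum is direct. The order of `g` is even,
and it is not 2 because `G` is not elementary. -/
theorem CyclicByTwo.exists_equiv (h : CyclicByTwo G)
    (hc : ¬ ∃ g : G, ∀ x : G, ∃ k : ℤ, x = k • g) (he : ¬ ∀ x : G, x + x = 0) :
    ∃ n : ℕ, 2 ≤ n ∧ Nonempty (G ≃+ ZMod 2 × ZMod (2 * n)) := by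
  obtain ⟨g, t, ht, hx⟩ := h
  have hN := addOrderOf_pos g
  have htg : ∀ k : ℤ, t ≠ k • g := by
    rintro k rfl
    exact hc ⟨g, fun x => by
      obtain ⟨l, rfl | rfl⟩ := hx x
      · exact ⟨l, rfl⟩
      · exact ⟨l + k, by module⟩⟩
  -- the order of `g` is even, since otherwise `g + t` is a generator
  have heven : Even (addOrderOf g) := by
    by_contra hodd
    rw [Nat.not_even_iff_odd] at hodd
    obtain ⟨m, hm⟩ := hodd
    have hg0 : (2 * m + 1 : ℤ) • g = 0 := by
      have := addOrderOf_nsmul_eq_zero g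
      rw [hm] at this
      exact_mod_cast this
    have ht2 : (2 : ℤ) • t = 0 := by rw [two_zsmul, ht]
    apply hc
    refine ⟨g + t, fun x => ?_⟩
    have e1 : g = (-(2 * m : ℤ)) • (g + t) := by
      have : (-(2 * m : ℤ)) • (g + t) = g - (2 * m + 1 : ℤ) • g - (m : ℤ) • (2 : ℤ) • t := by module
      rw [this, hg0, ht2]; simp
    have e2 : t = (2 * m + 1 : ℤ) • (g + t) := by
      have : (2 * m + 1 : ℤ) • (g + t) = t + (2 * m + 1 : ℤ) • g + (m : ℤ) • (2 : ℤ) • t := by module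
      rw [this, hg0, ht2]; simp
    obtain ⟨k, rfl | rfl⟩ := hx x
    · exact ⟨k * (-(2 * m : ℤ)), by rw [mul_smul, ← e1]⟩
    · exact ⟨k * (-(2 * m : ℤ)) + (2 * m + 1), by rw [add_smul, mul_smul, ← e1, ← e2]⟩
  obtain ⟨n, hn⟩ := heven
  rw [← two_mul] at hn
  have hn2 : 2 ≤ n := by
    by_contra hlt
    have hn1 : n = 1 := by omega
    have hg2 : (2 : ℤ) • g = 0 := by
      have := addOrderOf_nsmul_eq_zero g
      rw [hn, hn1] at this
      exact_mod_cast this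
    have ht2 : (2 : ℤ) • t = 0 := by rw [two_zsmul, ht]
    apply he
    intro x
    obtain ⟨k, rfl | rfl⟩ := hx x
    · rw [show k • g + k • g = k • (2 : ℤ) • g by module, hg2, smul_zero]
    · rw [show k • g + t + (k • g + t) = k • (2 : ℤ) • g + (2 : ℤ) • t by module, hg2, ht2]; simp
  refine ⟨n, hn2, ⟨AddEquiv.symm ?_⟩⟩
  let f₁ : ZMod 2 →+ G := ZMod.lift 2 ⟨zmultiplesHom G t, by simp [two_zsmul, ht]⟩
  let f₂ : ZMod (2 * n) →+ G := ZMod.lift (2 * n) ⟨zmultiplesHom G g, by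
    have := addOrderOf_nsmul_eq_zero g
    rw [hn] at this
    simp only [zmultiplesHom_apply, natCast_zsmul]; exact this⟩
  have hf₁ : ∀ k : ℤ, f₁ k = k • t := fun k => by simp [f₁]
  have hf₂ : ∀ k : ℤ, f₂ k = k • g := fun k => by simp [f₂]
  refine AddEquiv.ofBijective (f₁.coprod f₂) ⟨?_, ?_⟩
  · rw [injective_iff_map_eq_zero]
    rintro ⟨a, b⟩ hab
    obtain ⟨k, rfl⟩ := ZMod.intCast_surjective a
    obtain ⟨l, rfl⟩ := ZMod.intCast_surjective b
    rw [AddMonoidHom.coprod_apply, hf₁, hf₂] at hab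
    have ht2 : (2 : ℤ) • t = 0 := by rw [two_zsmul, ht]
    obtain ⟨j, rfl | rfl⟩ := Int.even_or_odd' k
    · rw [mul_comm, mul_smul, ht2, smul_zero, zero_add] at hab
      have hl : ((2 * n : ℕ) : ℤ) ∣ l := by
        rw [← hn]; exact addOrderOf_dvd_iff_zsmul_eq_zero.2 hab
      rw [← ZMod.intCast_zmod_eq_zero_iff_dvd] at hl
      refine Prod.ext ?_ hl
      exact (ZMod.intCast_zmod_eq_zero_iff_dvd _ 2).2 (dvd_mul_right _ _)
    · exfalso
      rw [add_smul, mul_comm, mul_smul, ht2, smul_zero, zero_add, one_smul] at hab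
      exact htg (-l) (by rw [neg_smul]; exact eq_neg_of_add_eq_zero_left hab)
  · intro x
    obtain ⟨k, rfl | rfl⟩ := hx x
    · exact ⟨(0, (k : ZMod (2 * n))), by rw [AddMonoidHom.coprod_apply, hf₂, map_zero, zero_add]⟩
    · refine ⟨(((1 : ℤ) : ZMod 2), (k : ZMod (2 * n))), ?_⟩
      rw [AddMonoidHom.coprod_apply, hf₁, hf₂, one_smul, add_comm]

/-- Choose `f` with `2f = w ≠ 0`. The elements of order at most two form a vector space over the
field with two elements; let `L` be a complement of the line through `w`. Then `G = L ⊕ ⟨f⟩`, as `x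
- f` has order at most two whenever `2x = w`. The dimension of `L` is positive because `G` is not
cyclic. -/
theorem DoublingLeTwo.exists_equiv (h : DoublingLeTwo G)
    (hc : ¬ ∃ g : G, ∀ x : G, ∃ k : ℤ, x = k • g) (he : ¬ ∀ x : G, x + x = 0) :
    ∃ r : ℕ, 2 ≤ r ∧ Nonempty (G ≃+ (Fin (r - 1) → ZMod 2) × ZMod 4) := by
  classical
  obtain ⟨w, hw⟩ := h
  push Not at he
  obtain ⟨f, hf⟩ := he
  have hfw := (hw f).resolve_left hf
  have hw0 : w ≠ 0 := hfw ▸ hf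
  have hww : w + w = 0 := (hw w).resolve_right fun h0 => hw0 (by simpa using h0)
  let K : AddSubgroup G := (zsmulAddGroupHom (2 : ℤ)).ker
  have hK : ∀ x, x ∈ K ↔ x + x = 0 := fun x => by
    rw [AddMonoidHom.mem_ker, zsmulAddGroupHom_apply, two_zsmul]
  let _ : Module (ZMod 2) K := AddCommGroup.zmodModule (fun x => by
    ext; rw [two_nsmul]; exact (hK x).1 x.2)
  let w' : K := ⟨w, (hK w).2 hww⟩
  obtain ⟨L, hL⟩ := Submodule.exists_isCompl (Submodule.span (ZMod 2) {w'})
  have : Module.Finite (ZMod 2) L := Module.Finite.of_finite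
  let k := Module.finrank (ZMod 2) L
  let b : (Fin k → ZMod 2) ≃ₗ[ZMod 2] L := (Module.finBasis (ZMod 2) L).equivFun.symm
  let f₁ : (Fin k → ZMod 2) →+ G :=
    K.subtype.comp (L.subtype.toAddMonoidHom.comp b.toLinearMap.toAddMonoidHom)
  let f₂ : ZMod 4 →+ G := ZMod.lift 4 ⟨zmultiplesHom G f, by
    change ((4 : ℕ) : ℤ) • f = 0
    rw [natCast_zsmul, show 4 • f = (f + f) + (f + f) by abel, hfw, hww]⟩
  have hf₁ : ∀ v, f₁ v = ((b v : K) : G) := fun v => rfl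
  have hf₂ : ∀ k : ℤ, f₂ k = k • f := fun k => by simp [f₂]
  have hspan : ∀ s ∈ Submodule.span (ZMod 2) {w'}, s = 0 ∨ s = w' := by
    intro s hs
    obtain ⟨c, rfl⟩ := Submodule.mem_span_singleton.1 hs
    rcases (show ∀ c : ZMod 2, c = 0 ∨ c = 1 by decide) c with rfl | rfl
    · exact Or.inl (zero_smul _ _)
    · exact Or.inr (one_smul _ _)
  have hinj : Function.Injective (f₁.coprod f₂) := by
    rw [injective_iff_map_eq_zero]
    rintro ⟨v, c⟩ hvc
    obtain ⟨m, rfl⟩ := ZMod.intCast_surjective c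
    rw [AddMonoidHom.coprod_apply, hf₁, hf₂] at hvc
    change ((b v : K) : G) + m • f = 0 at hvc
    have hv2 : ((b v : K) : G) + ((b v : K) : G) = 0 := (hK _).1 (b v : K).2
    have hw2 : (2 : ℤ) • w = 0 := by rw [two_zsmul, hww]
    obtain ⟨j, rfl | rfl⟩ := Int.even_or_odd' m
    · rw [mul_comm, mul_smul, two_zsmul, hfw] at hvc
      obtain ⟨i, rfl | rfl⟩ := Int.even_or_odd' j
      · rw [mul_comm, mul_smul, hw2, smul_zero, add_zero] at hvc
        have hv : b v = 0 := Subtype.ext (Subtype.ext hvc)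
        refine Prod.ext (b.map_eq_zero_iff.1 hv) ?_
        exact (ZMod.intCast_zmod_eq_zero_iff_dvd _ 4).2 ⟨i, by push_cast; ring⟩
      · exfalso
        rw [add_smul, mul_comm, mul_smul, hw2, smul_zero, zero_add, one_smul] at hvc
        have hbw : (b v : K) = w' := Subtype.ext (by
          have := eq_neg_of_add_eq_zero_left hvc
          rw [this]; exact neg_eq_of_add_eq_zero_left hww)
        have h0 := Submodule.disjoint_def.1 hL.disjoint w' (Submodule.mem_span_singleton_self _)
          (hbw ▸ (b v).2)
        exact hw0 (congrArg Subtype.val h0)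
    · exfalso
      have h4 : (((b v : K) : G) + (2 * j + 1) • f) + (((b v : K) : G) + (2 * j + 1) • f) =
          (((b v : K) : G) + ((b v : K) : G)) + j • (2 : ℤ) • (f + f) + (f + f) := by module
      rw [hvc, hv2, hfw, hw2] at h4
      simp at h4
      exact hw0 h4.symm
  have hK' : ∀ x, x + x = 0 → ∃ v, ∃ m : ℤ, x = f₁ v + m • f := by
    intro x hx
    obtain ⟨s, hs, l, hl, hsl⟩ := Submodule.mem_sup.1
      (show (⟨x, (hK x).2 hx⟩ : K) ∈ _ from hL.sup_eq_top ▸ Submodule.mem_top)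
    have hxl : x = (s : G) + (l : G) := (congrArg Subtype.val hsl).symm
    have hbl : f₁ (b.symm ⟨l, hl⟩) = l := by rw [hf₁, b.apply_symm_apply]
    refine ⟨b.symm ⟨l, hl⟩, ?_⟩
    rw [hbl, hxl]
    rcases hspan s hs with rfl | rfl
    · exact ⟨0, by simp⟩
    · refine ⟨2, ?_⟩
      rw [two_zsmul, hfw, add_comm]
  have hall : ∀ x, ∃ v, ∃ m : ℤ, x = f₁ v + m • f := by
    intro x
    rcases hw x with hx | hx
    · exact hK' x hx
    · obtain ⟨v, m, h1⟩ := hK' (x - f) (by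
        rw [show x - f + (x - f) = (x + x) - (f + f) by abel, hx, hfw, sub_self])
      exact ⟨v, m + 1, by rw [← sub_add_cancel x f, h1]; module⟩
  have hsurj : Function.Surjective (f₁.coprod f₂) := by
    intro x
    obtain ⟨v, m, rfl⟩ := hall x
    exact ⟨(v, (m : ZMod 4)), by rw [AddMonoidHom.coprod_apply, hf₂]⟩
  refine ⟨k + 1, ?_, ⟨?_⟩⟩
  · by_contra hk
    have hk0 : IsEmpty (Fin k) := by
      rw [show k = 0 by omega]; infer_instance
    refine hc ⟨f, fun x => ?_⟩
    obtain ⟨v, m, rfl⟩ := hall x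
    exact ⟨m, by rw [Subsingleton.elim v 0, map_zero, zero_add]⟩
  · exact (AddEquiv.ofBijective (f₁.coprod f₂) ⟨hinj, hsurj⟩).symm

end Structure

/-! ### From elements of `H` to zero-sum sequences over the class group. -/

section DivisorHom

variable {H P : Type*} [CancelCommMonoid H] (φ : H →* Multiplicative (P →₀ ℕ))

/-- The formal product of primes corresponding to an element, as a multiset. -/
noncomputable def primeMultiset (a : H) : Multiset P := Finsupp.toMultiset (φ a).toAdd

/-- The class of a prime. -/
noncomputable def classOf (p : P) : ClassGroup φ := QuotientAddGroup.mk (toQuotientGroup (primeElt p))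

theorem primeMultiset_mul (a b : H) :
    primeMultiset φ (a * b) = primeMultiset φ a + primeMultiset φ b := by
  simp [primeMultiset]

theorem primeMultiset_one : primeMultiset φ 1 = 0 := by simp [primeMultiset]

theorem primeMultiset_unit (u : Hˣ) : primeMultiset φ u = 0 := by
  have h := primeMultiset_mul φ (u : H) (↑u⁻¹ : H)
  rw [Units.mul_inv, primeMultiset_one] at h
  exact (add_eq_zero.1 h.symm).1

theorem mk_toQuotientGroup (x : P →₀ ℕ) :
    (QuotientAddGroup.mk (toQuotientGroup (Multiplicative.ofAdd x)) : ClassGroup φ) =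
      (x.toMultiset.map (classOf φ)).sum := by
  let f : (P →₀ ℕ) →+ ClassGroup φ := (QuotientAddGroup.mk' _).comp
    (Finsupp.mapRange.addMonoidHom (Nat.castAddMonoidHom ℤ))
  let g : (P →₀ ℕ) →+ ClassGroup φ := Multiset.sumAddMonoidHom.comp
    ((Multiset.mapAddMonoidHom (classOf φ)).comp Finsupp.toMultiset)
  have hfg : f = g := by
    refine Finsupp.addHom_ext' fun p => AddMonoidHom.ext_nat ?_
    change (QuotientAddGroup.mk _ : ClassGroup φ) = ((Finsupp.toMultiset (Finsupp.single p 1)).map (classOf φ)).sum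
    rw [Finsupp.toMultiset_single, one_smul, Multiset.map_singleton, Multiset.sum_singleton]
    rfl
  exact DFunLike.congr_fun hfg x

theorem sum_map_classOf_primeMultiset (a : H) : ((primeMultiset φ a).map (classOf φ)).sum = 0 := by
  rw [primeMultiset, ← mk_toQuotientGroup, ofAdd_toAdd, QuotientAddGroup.eq_zero_iff]
  exact AddSubgroup.subset_closure ⟨a, rfl⟩

variable {φ}

theorem IsDivisorHom.dvd_of_le (hφ : IsDivisorHom φ) {a b : H}
    (h : primeMultiset φ a ≤ primeMultiset φ b) : a ∣ b := by
  classical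
  obtain ⟨K, hK⟩ := Multiset.le_iff_exists_add.1 h
  refine hφ a b ⟨Multiplicative.ofAdd (Multiset.toFinsupp K), ?_⟩
  apply Multiplicative.toAdd.injective
  apply Multiset.toFinsupp.symm.injective
  rw [toAdd_mul, toAdd_ofAdd, map_add, AddEquiv.symm_apply_apply]
  exact hK

theorem exists_mul_of_mem_principalSubgroup {x : P →₀ ℤ} (hx : x ∈ principalSubgroup φ) :
    ∃ a b : H, x = toQuotientGroup (φ a) - toQuotientGroup (φ b) := by
  have hmul : ∀ a b : H, toQuotientGroup (φ (a * b)) =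
      toQuotientGroup (φ a) + toQuotientGroup (φ b) := by
    intro a b
    ext p
    simp [toQuotientGroup]
  have hone : toQuotientGroup (φ 1) = 0 := by
    ext p; simp [toQuotientGroup]
  induction hx using AddSubgroup.closure_induction with
  | mem x hx =>
    obtain ⟨a, rfl⟩ := hx
    exact ⟨a, 1, by rw [hone, sub_zero]⟩
  | zero => exact ⟨1, 1, by rw [sub_self]⟩
  | add x y _ _ hx hy =>
    obtain ⟨a, b, rfl⟩ := hx
    obtain ⟨a', b', rfl⟩ := hy
    exact ⟨a * a', b * b', by rw [hmul, hmul]; abel⟩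
  | neg x _ hx =>
    obtain ⟨a, b, rfl⟩ := hx
    exact ⟨b, a, by abel⟩

/-- A product of primes with trivial class is a quotient `φ(a) / φ(b)`. As this is integral, the
divisor homomorphism gives `b ∣ a`, and the cofactor has the prescribed primes. -/
theorem IsDivisorHom.exists_primeMultiset_eq (hφ : IsDivisorHom φ) {M : Multiset P}
    (hM : (M.map (classOf φ)).sum = 0) : ∃ a : H, primeMultiset φ a = M := by
  classical
  have h1 := mk_toQuotientGroup φ (Multiset.toFinsupp M)
  rw [Multiset.toFinsupp_toMultiset, hM, QuotientAddGroup.eq_zero_iff] at h1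
  obtain ⟨a, b, hab⟩ := exists_mul_of_mem_principalSubgroup h1
  have h2 : (φ a).toAdd = (φ b).toAdd + Multiset.toFinsupp M := by
    ext p
    have := DFunLike.congr_fun hab p
    simp only [toQuotientGroup, toAdd_ofAdd, Finsupp.mapRange_apply, Finsupp.sub_apply] at this
    rw [Finsupp.add_apply]
    omega
  have h3 : primeMultiset φ a = primeMultiset φ b + M := by
    rw [primeMultiset, h2, map_add, Multiset.toFinsupp_toMultiset]; rfl
  obtain ⟨c, rfl⟩ := hφ.dvd_of_le (h3 ▸ Multiset.le_add_right _ _)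
  rw [primeMultiset_mul] at h3
  exact ⟨c, add_left_cancel h3⟩

variable (φ) in
/-- The multiset of primes of a principal ideal. -/
noncomputable def assocMultiset : Associates H → Multiset P :=
  Quotient.lift (primeMultiset φ) (by
    rintro a _ ⟨u, rfl⟩
    rw [primeMultiset_mul, primeMultiset_unit, add_zero])

theorem assocMultiset_mk (a : H) : assocMultiset φ (Associates.mk a) = primeMultiset φ a := rfl

theorem assocMultiset_mul (x y : Associates H) :
    assocMultiset φ (x * y) = assocMultiset φ x + assocMultiset φ y := by
  obtain ⟨x, rfl⟩ := Associates.mk_surjective x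
  obtain ⟨y, rfl⟩ := Associates.mk_surjective y
  exact primeMultiset_mul φ _ _

theorem assocMultiset_one : assocMultiset φ 1 = 0 := primeMultiset_one φ

theorem sum_map_classOf_assocMultiset (x : Associates H) :
    ((assocMultiset φ x).map (classOf φ)).sum = 0 := by
  obtain ⟨x, rfl⟩ := Associates.mk_surjective x
  exact sum_map_classOf_primeMultiset φ _

theorem IsDivisorHom.assocMultiset_injective (hφ : IsDivisorHom φ) :
    Function.Injective (assocMultiset φ) := by
  intro x y h
  obtain ⟨x, rfl⟩ := Associates.mk_surjective x
  obtain ⟨y, rfl⟩ := Associates.mk_surjective y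
  rw [assocMultiset_mk, assocMultiset_mk] at h
  obtain ⟨c, rfl⟩ := hφ.dvd_of_le h.le
  obtain ⟨d, hd⟩ := hφ.dvd_of_le h.ge
  have hcd : c * d = 1 := by
    rw [mul_assoc] at hd
    exact mul_left_cancel (a := x) (by rw [mul_one]; exact hd.symm)
  exact Associates.mk_eq_mk_iff_associated.2 ⟨Units.mkOfMulEqOne c d hcd, rfl⟩

/-- Splittings of `x` correspond to splittings of its primes into two parts with trivial class, that
is, to zero-sum subsequences of the sequence of classes. -/
theorem IsDivisorHom.irreducible_iff (hφ : IsDivisorHom φ) (x : Associates H) :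
    Irreducible x ↔ IsMinimalZeroSum ((assocMultiset φ x).map (classOf φ)) := by
  have h0 : ∀ x, assocMultiset φ x = 0 → x = 1 := fun x hx =>
    hφ.assocMultiset_injective (hx.trans assocMultiset_one.symm)
  constructor
  · intro hx
    refine ⟨fun h => hx.not_isUnit ?_, sum_map_classOf_assocMultiset x, fun T hT hT0 hs => ?_⟩
    · rw [h0 x (Multiset.map_eq_zero.1 h)]; exact isUnit_one
    · obtain ⟨N, hN, rfl⟩ := exists_le_map hT
      obtain ⟨K, hK⟩ := Multiset.le_iff_exists_add.1 hN
      obtain ⟨a, ha⟩ := hφ.exists_primeMultiset_eq hs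
      obtain ⟨b, hb⟩ := hφ.exists_primeMultiset_eq (M := K) (by
        have := sum_map_classOf_assocMultiset (φ := φ) x
        rw [hK, Multiset.map_add, Multiset.sum_add, hs, zero_add] at this
        exact this)
      have hxab : x = Associates.mk a * Associates.mk b := by
        apply hφ.assocMultiset_injective
        rw [assocMultiset_mul, assocMultiset_mk, assocMultiset_mk, ha, hb, hK]
      rcases hx.isUnit_or_isUnit hxab with h | h
      · rw [Associates.isUnit_iff_eq_one] at h
        have := assocMultiset_mk (φ := φ) a
        rw [h, assocMultiset_one, ha] at this
        exact absurd (by rw [← this, Multiset.map_zero]) hT0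
      · rw [Associates.isUnit_iff_eq_one] at h
        have := assocMultiset_mk (φ := φ) b
        rw [h, assocMultiset_one, hb] at this
        rw [hK, ← this, add_zero]
  · intro hm
    refine ⟨fun hu => hm.1 ?_, fun {y z} hyz => ?_⟩
    · rw [(Associates.isUnit_iff_eq_one _).1 hu, assocMultiset_one, Multiset.map_zero]
    · rw [hyz, assocMultiset_mul, Multiset.map_add] at hm
      rcases hm.eq_or (Multiset.le_add_right _ _) (sum_map_classOf_assocMultiset y) with h | h
      · left
        rw [Associates.isUnit_iff_eq_one]
        exact h0 y (Multiset.map_eq_zero.1 h)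
      · right
        rw [Associates.isUnit_iff_eq_one]
        have h := left_eq_add.1 h
        exact h0 z (Multiset.map_eq_zero.1 h)

variable (φ) in
/-- The multiset of primes of an atom. -/
noncomputable def atomMultiset (u : Atom H) : Multiset P := assocMultiset φ u.1

theorem assocMultiset_factorizationHom (z : FactorizationMonoid H) :
    assocMultiset φ (factorizationHom z) = (z.map (atomMultiset φ)).sum := by
  induction z using Multiset.induction with
  | empty => exact assocMultiset_one
  | cons u z ih =>
    rw [factorizationHom, Multiset.map_cons, Multiset.prod_cons, assocMultiset_mul,
      Multiset.map_cons, Multiset.sum_cons, ← ih]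
    rfl

theorem IsDivisorHom.mem_factorizations_iff (hφ : IsDivisorHom φ) {a : H}
    {z : FactorizationMonoid H} :
    z ∈ factorizations a ↔ (z.map (atomMultiset φ)).sum = primeMultiset φ a := by
  rw [← assocMultiset_factorizationHom, ← assocMultiset_mk, hφ.assocMultiset_injective.eq_iff]
  rfl

theorem IsDivisorHom.isMinimalZeroSum_atom (hφ : IsDivisorHom φ) (u : Atom H) :
    IsMinimalZeroSum ((atomMultiset φ u).map (classOf φ)) := (hφ.irreducible_iff _).1 u.2

theorem IsDivisorHom.exists_atom (hφ : IsDivisorHom φ) {M : Multiset P}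
    (hM : IsMinimalZeroSum (M.map (classOf φ))) : ∃ u : Atom H, atomMultiset φ u = M := by
  obtain ⟨a, ha⟩ := hφ.exists_primeMultiset_eq hM.2.1
  exact ⟨⟨Associates.mk a, (hφ.irreducible_iff _).2 (by rwa [assocMultiset_mk, ha])⟩, ha⟩

theorem IsDivisorHom.hasFactorization (hφ : IsDivisorHom φ) (z : FactorizationMonoid H) :
    HasFactorization ((z.map (atomMultiset φ)).sum.map (classOf φ)) z.card := by
  induction z using Multiset.induction with
  | empty => exact .zero
  | cons u z ih =>
    rw [Multiset.map_cons, Multiset.sum_cons, Multiset.map_add, Multiset.card_cons]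
    exact .cons (hφ.isMinimalZeroSum_atom u) ih

/-- A decomposition of the class sequence lifts to any multiset of primes above it: choose primes
over each minimal zero-sum factor and take the atom they form. -/
theorem IsDivisorHom.exists_factorization (hφ : IsDivisorHom φ) {S : Multiset (ClassGroup φ)}
    {n : ℕ} (h : HasFactorization S n) : ∀ {M : Multiset P}, M.map (classOf φ) = S →
    ∃ z : FactorizationMonoid H, (z.map (atomMultiset φ)).sum = M ∧ z.card = n := by
  induction h with
  | zero => exact fun {M} hM => ⟨0, by simpa [eq_comm] using hM, rfl⟩
  | @cons W S n hW _ ih =>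
    intro M hM
    obtain ⟨N, hN, rfl⟩ := exists_le_map (show W ≤ M.map (classOf φ) by
      rw [hM]; exact Multiset.le_add_right _ _)
    obtain ⟨K, rfl⟩ := Multiset.le_iff_exists_add.1 hN
    rw [Multiset.map_add] at hM
    obtain ⟨z, hz, hc⟩ := ih (add_left_cancel hM)
    obtain ⟨u, hu⟩ := hφ.exists_atom hW
    exact ⟨u ::ₘ z, by rw [Multiset.map_cons, Multiset.sum_cons, hz, hu], by simp [hc]⟩

theorem IsDivisorHom.mem_setOfLengths_iff (hφ : IsDivisorHom φ) {a : H} {n : ℕ} :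
    n ∈ setOfLengths a ↔ HasFactorization ((primeMultiset φ a).map (classOf φ)) n := by
  constructor
  · rintro ⟨z, hz, rfl⟩
    rw [← hφ.mem_factorizations_iff.1 hz]
    exact hφ.hasFactorization z
  · intro h
    obtain ⟨z, hz, hc⟩ := hφ.exists_factorization h rfl
    exact ⟨z, hφ.mem_factorizations_iff.2 hz, hc⟩

theorem exists_map_classOf_eq (hp : EveryClassContainsPrime φ) (S : Multiset (ClassGroup φ)) :
    ∃ M : Multiset P, M.map (classOf φ) = S := by
  induction S using Multiset.induction with
  | empty => exact ⟨0, rfl⟩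
  | cons g S ih =>
    obtain ⟨M, rfl⟩ := ih
    obtain ⟨p, hp⟩ := hp g
    exact ⟨p ::ₘ M, by rw [Multiset.map_cons]; congr 1⟩

/-- The smallest length other than two of a product of two minimal zero-sum sequences. -/
def IsDalethValue (G : Type*) [AddCommGroup G] (m : ℕ) : Prop :=
  ∃ U V : Multiset G, IsMinimalZeroSum U ∧ IsMinimalZeroSum V ∧
    PairFactorization U V m ∧ 3 ≤ m ∧ LengthGap m U V

theorem IsMinimalZeroSum.hasFactorization_two {G : Type*} [AddCommGroup G] {U V : Multiset G}
    (hU : IsMinimalZeroSum U) (hV : IsMinimalZeroSum V) :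
    HasFactorization (U + V.map Neg.neg) 2 := by
  have := HasFactorization.cons hU (HasFactorization.cons hV.map_neg .zero)
  rwa [add_zero] at this

theorem map_neg_map_neg {G : Type*} [AddCommGroup G] (S : Multiset G) :
    (S.map Neg.neg).map Neg.neg = S := by
  rw [Multiset.map_map, show (Neg.neg ∘ Neg.neg : G → G) = id by ext; simp, Multiset.map_id]

/-- An element with 2 in its set of lengths is a product of two atoms, with class sequences `U` and
`-V`. Primes in all classes realize every such pair, and the lengths 0 and 1 cannot occur beside 2.
-/
theorem IsDivisorHom.daleth_eq (hφ : IsDivisorHom φ) (hp : EveryClassContainsPrime φ) :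
    daleth H = sSup {x : ℕ∞ | ∃ m : ℕ, IsDalethValue (ClassGroup φ) m ∧ x = m} := by
  rw [daleth]
  congr 1
  ext x
  constructor
  · rintro ⟨_, ⟨a, rfl⟩, h2, m, hm, rfl⟩
    refine ⟨m, ?_, rfl⟩
    have h2' := hφ.mem_setOfLengths_iff.1 h2
    have hmin : ∀ n, HasFactorization ((primeMultiset φ a).map (classOf φ)) n → n = 2 ∨ m ≤ n := by
      intro n hn
      by_cases h : n = 2
      · exact Or.inl h
      · exact Or.inr (hm.2 ⟨hφ.mem_setOfLengths_iff.2 hn, h⟩)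
    have hm1 := hφ.mem_setOfLengths_iff.1 hm.1.1
    have hm2 : m ≠ 2 := hm.1.2
    generalize (primeMultiset φ a).map (classOf φ) = S at h2' hmin hm1
    have hm3 : 3 ≤ m := by
      by_contra hlt
      have : m = 0 ∨ m = 1 := by omega
      rcases this with rfl | rfl
      · have := hm1.eq_zero
        subst this
        generalize hZ : (0 : Multiset (ClassGroup φ)) = Z at h2'
        cases h2' with
        | @cons W S' _ hW _ => exact hW.1 (add_eq_zero.1 hZ.symm).1
      · have hS : IsMinimalZeroSum S := by
          cases hm1 with
          | @cons W S' _ hW h0 =>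
            rw [h0.eq_zero, add_zero]; exact hW
        have := h2'.eq_one hS
        omega
    cases h2' with
    | @cons W S' _ hW h1 =>
      cases h1 with
      | @cons W' S'' _ hW' h0 =>
        have := h0.eq_zero
        subst this
        refine ⟨W, W'.map Neg.neg, hW, hW'.map_neg, ?_, hm3, fun n hn => hmin n ?_⟩
        · exact hm1.pairFactorization _ _ (by rw [map_neg_map_neg, add_zero])
        · have := hn.hasFactorization
          rwa [map_neg_map_neg, ← add_zero W'] at this
  · rintro ⟨m, ⟨U, V, hU, hV, hm, h3, hg⟩, rfl⟩
    obtain ⟨M, hM⟩ := exists_map_classOf_eq hp (U + V.map Neg.neg)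
    obtain ⟨a, ha⟩ := hφ.exists_primeMultiset_eq (M := M) (by
      rw [hM]; exact hm.hasFactorization.sum_eq)
    have hL : ∀ n, n ∈ setOfLengths a ↔ HasFactorization (U + V.map Neg.neg) n := fun n => by
      rw [hφ.mem_setOfLengths_iff, ha, hM]
    refine ⟨_, ⟨a, rfl⟩, (hL 2).2 (hU.hasFactorization_two hV), m,
      ⟨⟨(hL m).2 hm.hasFactorization, fun h => ?_⟩, fun n hn => ?_⟩, rfl⟩
    · rw [Set.mem_singleton_iff] at h; omega
    · exact (hg n (((hL n).1 hn.1).pairFactorization _ _ rfl)).resolve_left hn.2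

end DivisorHom

/-! ### The catenary degree between daleth values and the Davenport constant. -/

section Catenary

/-- Distribute the elements of `T` over the members of `F`; with fewer elements than members, some
member receives none. -/
theorem exists_mem_le_sum_erase {α : Type*} [DecidableEq α] {F : Multiset (Multiset α)} :
    ∀ {T : Multiset α}, T ≤ F.sum → T.card < F.card → ∃ W F', F = W ::ₘ F' ∧ T ≤ F'.sum := by
  induction F using Multiset.induction with
  | empty => intro T _ h; simp at h
  | cons W F ih =>
    intro T hT hc
    rw [Multiset.sum_cons] at hT
    obtain ⟨T₁, T₂, h1, h2, rfl⟩ := exists_add_of_le_add hT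
    by_cases hT₁ : T₁ = 0
    · exact ⟨W, F, rfl, by rw [hT₁, zero_add]; exact h2⟩
    · have := Multiset.card_pos.2 hT₁
      rw [Multiset.card_add, Multiset.card_cons] at hc
      obtain ⟨W', F', rfl, h3⟩ := ih h2 (by omega)
      exact ⟨W', W ::ₘ F', Multiset.cons_swap _ _ _, by
        rw [Multiset.sum_cons]; exact add_le_add h1 h3⟩

variable {H P : Type*} [CancelCommMonoid H] {φ : H →* Multiplicative (P →₀ ℕ)}

theorem factorizationDist_comm (z z' : FactorizationMonoid H) :
    factorizationDist z z' = factorizationDist z' z := by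
  classical
  rw [factorizationDist, factorizationDist, max_comm, Multiset.inter_comm]

theorem factorizationDist_cons (u : Atom H) (z z' : FactorizationMonoid H) :
    factorizationDist (u ::ₘ z) (u ::ₘ z') = factorizationDist z z' := by
  classical
  have h : ∀ z z' : FactorizationMonoid H,
      (u ::ₘ z) - (u ::ₘ z) ∩ (u ::ₘ z') = z - z ∩ z' ∧
      (u ::ₘ z') - (u ::ₘ z) ∩ (u ::ₘ z') = z' - z ∩ z' := by
    intro z z'
    constructor <;> ext v <;> simp only [Multiset.count_sub, Multiset.count_inter,
      Multiset.count_cons] <;> omega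
  rw [factorizationDist, factorizationDist, (h z z').1, (h z z').2]

theorem factorizationDist_le (z z' : FactorizationMonoid H) :
    factorizationDist z z' ≤ max z.card z'.card := by
  classical
  exact max_le_max (Multiset.card_le_card (Multiset.sub_le_self _ _))
    (Multiset.card_le_card (Multiset.sub_le_self _ _))

variable (φ) in
/-- The product of a factorization, as a multiset of primes. -/
noncomputable def primesOf (z : FactorizationMonoid H) : Multiset P := (z.map (atomMultiset φ)).sum

theorem primesOf_cons (u : Atom H) (z : FactorizationMonoid H) :
    primesOf φ (u ::ₘ z) = atomMultiset φ u + primesOf φ z := by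
  rw [primesOf, Multiset.map_cons, Multiset.sum_cons]; rfl

variable (φ) in
/-- Two factorizations of the same element that are connected by an `N`-chain. -/
def Connected (N : ℕ) : FactorizationMonoid H → FactorizationMonoid H → Prop :=
  Relation.ReflTransGen fun z z' => primesOf φ z = primesOf φ z' ∧ factorizationDist z z' ≤ N

variable {N : ℕ}

theorem Connected.symm {z z' : FactorizationMonoid H} (h : Connected φ N z z') :
    Connected φ N z' z := by
  induction h with
  | refl => exact .refl
  | tail _ h ih =>
    exact .head ⟨h.1.symm, by rw [factorizationDist_comm]; exact h.2⟩ ih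

theorem Connected.cons {z z' : FactorizationMonoid H} (h : Connected φ N z z') (u : Atom H) :
    Connected φ N (u ::ₘ z) (u ::ₘ z') := by
  induction h with
  | refl => exact .refl
  | tail _ h ih =>
    exact .tail ih ⟨by rw [primesOf_cons, primesOf_cons, h.1],
      by rw [factorizationDist_cons]; exact h.2⟩

theorem Connected.of_card_le {z z' : FactorizationMonoid H} (h : primesOf φ z = primesOf φ z')
    (hz : z.card ≤ N) (hz' : z'.card ≤ N) : Connected φ N z z' :=
  .single ⟨h, (factorizationDist_le z z').trans (max_le hz hz')⟩

theorem Connected.exists_chain {z z' : FactorizationMonoid H} (h : Connected φ N z z') :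
    ∃ (k : ℕ) (c : ℕ → FactorizationMonoid H), c 0 = z ∧ c k = z' ∧
      (∀ i ≤ k, primesOf φ (c i) = primesOf φ z) ∧
      ∀ i < k, factorizationDist (c i) (c (i + 1)) ≤ N := by
  induction h with
  | refl => exact ⟨0, fun _ => z, rfl, rfl, fun _ _ => rfl, fun i hi => by omega⟩
  | @tail b x _ hbx ih =>
    obtain ⟨k, c, h0, hk, h1, h2⟩ := ih
    refine ⟨k + 1, fun i => if i ≤ k then c i else x, by simpa using h0, by simp, fun i hi => ?_,
      fun i hi => ?_⟩
    · by_cases hik : i ≤ k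
      · simpa only [hik, if_true] using h1 i hik
      · simp only [hik, if_false]
        rw [← hbx.1, ← hk, h1 k le_rfl]
    · by_cases hik : i + 1 ≤ k
      · simpa only [hik, show i ≤ k by omega, if_true] using h2 i (by omega)
      · obtain rfl : i = k := by omega
        simp only [le_refl, if_true, hik, if_false, hk]
        exact hbx.2

theorem sum_map_classOf_primesOf (z : FactorizationMonoid H) :
    ((primesOf φ z).map (classOf φ)).sum = 0 := by
  rw [primesOf, ← assocMultiset_factorizationHom]
  exact sum_map_classOf_assocMultiset _

theorem IsDivisorHom.exists_primesOf_eq (hφ : IsDivisorHom φ) {M : Multiset P}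
    (hM : (M.map (classOf φ)).sum = 0) : ∃ z : FactorizationMonoid H, primesOf φ z = M := by
  obtain ⟨n, hn⟩ := exists_hasFactorization hM
  obtain ⟨z, hz, -⟩ := hφ.exists_factorization hn rfl
  exact ⟨z, hz⟩

theorem IsDivisorHom.atomMultiset_ne_zero (hφ : IsDivisorHom φ) (u : Atom H) :
    atomMultiset φ u ≠ 0 := fun h => (hφ.isMinimalZeroSum_atom u).1 (by rw [h, Multiset.map_zero])

section Induction

variable (hφ : IsDivisorHom φ) {n : ℕ} (ih : ∀ y y' : FactorizationMonoid H,
  primesOf φ y = primesOf φ y' → (primesOf φ y).card < n → Connected φ N y y')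
include hφ ih

theorem Connected.of_common {u : Atom H} {z z' : FactorizationMonoid H} (hu : u ∈ z) (hu' : u ∈ z')
    (h : primesOf φ z = primesOf φ z') (hn : (primesOf φ z).card ≤ n) : Connected φ N z z' := by
  obtain ⟨y, rfl⟩ := Multiset.exists_cons_of_mem hu
  obtain ⟨y', rfl⟩ := Multiset.exists_cons_of_mem hu'
  rw [primesOf_cons, primesOf_cons] at h
  refine (ih y y' (add_left_cancel h) ?_).cons u
  rw [primesOf_cons, Multiset.card_add] at hn
  have := Multiset.card_pos.2 (hφ.atomMultiset_ne_zero u)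
  omega

/-- Some factorization of the same element contains both `u` and `v`. It shares an atom with each of
`z` and `z'`, so the induction hypothesis applies on both sides. -/
theorem Connected.of_add_le {u v : Atom H} {z z' : FactorizationMonoid H} (hu : u ∈ z)
    (hv : v ∈ z') (h : primesOf φ z = primesOf φ z') (hn : (primesOf φ z).card ≤ n)
    (hle : atomMultiset φ u + atomMultiset φ v ≤ primesOf φ z) : Connected φ N z z' := by
  obtain ⟨R, hR⟩ := Multiset.le_iff_exists_add.1 hle
  obtain ⟨w, rfl⟩ := hφ.exists_primesOf_eq (M := R) (by
    have h0 := sum_map_classOf_primesOf (φ := φ) z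
    rw [hR, Multiset.map_add, Multiset.map_add, Multiset.sum_add, Multiset.sum_add,
      (hφ.isMinimalZeroSum_atom u).2.1, (hφ.isMinimalZeroSum_atom v).2.1] at h0
    simpa using h0)
  have h1 : primesOf φ (u ::ₘ v ::ₘ w) = primesOf φ z := by
    rw [primesOf_cons, primesOf_cons, hR, add_assoc]
  refine (Connected.of_common hφ ih hu (Multiset.mem_cons_self _ _) h1.symm hn).trans ?_
  exact Connected.of_common hφ ih (u := v) (by simp) hv (h1.trans h) (h1 ▸ hn)

/-- Factorizations of length at least three are connected to long factorizations only if these are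
not too long. -/
theorem Connected.of_lengthBound {D : ℕ} (hD : LengthBound (ClassGroup φ) D)
    {z z' : FactorizationMonoid H} (h : primesOf φ z = primesOf φ z')
    (hn : (primesOf φ z).card ≤ n) (hz : z ≠ 0) (hz' : 3 ≤ z'.card) :
    Connected φ N z z' ∨ 2 * z.card ≤ D + 1 := by
  classical
  by_cases hcon : Connected φ N z z'
  · exact Or.inl hcon
  right
  obtain ⟨u, hu⟩ := Multiset.exists_mem_of_ne_zero hz
  obtain ⟨y, rfl⟩ := Multiset.exists_cons_of_mem hu
  obtain ⟨v₁, hv₁⟩ := Multiset.card_pos_iff_exists_mem.1 (show 0 < z'.card by omega)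
  obtain ⟨z₁, rfl⟩ := Multiset.exists_cons_of_mem hv₁
  rw [Multiset.card_cons] at hz'
  obtain ⟨v₂, hv₂⟩ := Multiset.card_pos_iff_exists_mem.1 (show 0 < z₁.card by omega)
  obtain ⟨z₂, rfl⟩ := Multiset.exists_cons_of_mem hv₂
  rw [Multiset.card_cons] at hz'
  obtain ⟨v₃, hv₃⟩ := Multiset.card_pos_iff_exists_mem.1 (show 0 < z₂.card by omega)
  obtain ⟨z₃, rfl⟩ := Multiset.exists_cons_of_mem hv₃
  -- From here on no product of an atom of `z` and an atom of `z'` divides the element. The set-up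
  -- divides the primes of `v₁`, `v₂`, `v₃` between those of `u` and those of `y`; `Q` is what `v₁`
  -- leaves of `y`.
  have hnot : ∀ a ∈ u ::ₘ y, ∀ b ∈ v₁ ::ₘ v₂ ::ₘ v₃ ::ₘ z₃,
      ¬ atomMultiset φ a + atomMultiset φ b ≤ primesOf φ (u ::ₘ y) := fun a ha b hb hle =>
    hcon (Connected.of_add_le hφ ih ha hb h hn hle)
  have hA := h
  simp only [primesOf_cons] at hA
  obtain ⟨S₁, T₁, hS₁, hT₁, hv₁e⟩ := exists_add_of_le_add
    (show atomMultiset φ v₁ ≤ atomMultiset φ u + primesOf φ y by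
      rw [hA]; exact Multiset.le_add_right _ _)
  obtain ⟨S', hS'⟩ := Multiset.le_iff_exists_add.1 hS₁
  obtain ⟨Q, hQ⟩ := Multiset.le_iff_exists_add.1 hT₁
  have hA' : S' + Q = atomMultiset φ v₂ + (atomMultiset φ v₃ + primesOf φ z₃) := by
    apply add_left_cancel (a := atomMultiset φ v₁)
    rw [← hA, hS', hQ]
    nth_rewrite 1 [hv₁e]
    abel
  -- the part of `v₂`, `v₃` in `Q` meets every atom of `y`
  have hmeet : ∀ v ∈ v₁ ::ₘ v₂ ::ₘ v₃ ::ₘ z₃, ∀ S T, S ≤ S' → T ≤ Q → atomMultiset φ v = S + T →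
      y.card ≤ T.card := by
    intro v hv S T hS hT he
    by_contra! hlt
    have hTy : T ≤ (y.map (atomMultiset φ)).sum := hT.trans (by
      change Q ≤ primesOf φ y
      rw [hQ]; exact Multiset.le_add_left _ _)
    obtain ⟨W, F', hF, hTF⟩ := exists_mem_le_sum_erase hTy (by simpa using hlt)
    obtain ⟨w, hw, rfl⟩ := Multiset.mem_map.1 (show W ∈ y.map (atomMultiset φ) by rw [hF]; simp)
    refine hnot w (Multiset.mem_cons_of_mem hw) v hv ?_
    rw [primesOf_cons, primesOf, hF, Multiset.sum_cons, he]
    calc atomMultiset φ w + (S + T) ≤ atomMultiset φ w + (atomMultiset φ u + F'.sum) := by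
          refine add_le_add le_rfl (add_le_add (hS.trans ?_) hTF)
          rw [hS']; exact Multiset.le_add_left _ _
      _ = _ := by abel
  obtain ⟨S₂, T₂, hS₂, hT₂, hv₂e⟩ := exists_add_of_le_add
    (show atomMultiset φ v₂ ≤ S' + Q by rw [hA']; exact Multiset.le_add_right _ _)
  obtain ⟨S'', hS''⟩ := Multiset.le_iff_exists_add.1 hS₂
  obtain ⟨Q', hQ'⟩ := Multiset.le_iff_exists_add.1 hT₂
  have hA'' : S'' + Q' = atomMultiset φ v₃ + primesOf φ z₃ := by
    apply add_left_cancel (a := atomMultiset φ v₂)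
    rw [← hA', hS'', hQ', hv₂e]
    abel
  obtain ⟨S₃, T₃, hS₃, hT₃, hv₃e⟩ := exists_add_of_le_add
    (show atomMultiset φ v₃ ≤ S'' + Q' by rw [hA'']; exact Multiset.le_add_right _ _)
  have c2 := hmeet v₂ (by simp) S₂ T₂ hS₂ hT₂ hv₂e
  have c3 := hmeet v₃ (by simp) S₃ T₃ (hS₃.trans (by rw [hS'']; exact Multiset.le_add_left _ _))
    (hT₃.trans (by rw [hQ']; exact Multiset.le_add_left _ _)) hv₃e
  have c4 := Multiset.card_le_card hT₃
  have c5 : Q.card = T₂.card + Q'.card := by rw [hQ', Multiset.card_add]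
  -- the classes of `Q` form a zero-sum free sequence
  have hzsf : ZeroSumFree (Q.map (classOf φ)) := by
    intro T hT h0
    by_contra hT0
    obtain ⟨W, hW, hWm⟩ := exists_isMinimalZeroSum_le hT0 h0
    obtain ⟨W, hWQ, rfl⟩ := exists_le_map (hW.trans hT)
    obtain ⟨w, rfl⟩ := hφ.exists_atom hWm
    apply hcon
    have hWy : atomMultiset φ w ≤ primesOf φ y := hWQ.trans (by
      rw [hQ]; exact Multiset.le_add_left _ _)
    obtain ⟨R, hR⟩ := Multiset.le_iff_exists_add.1 hWy
    obtain ⟨r, rfl⟩ := hφ.exists_primesOf_eq (M := R) (by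
      have h0 := sum_map_classOf_primesOf (φ := φ) y
      rw [hR, Multiset.map_add, Multiset.sum_add, hWm.2.1, zero_add] at h0
      exact h0)
    have h1 : primesOf φ (u ::ₘ w ::ₘ r) = primesOf φ (u ::ₘ y) := by
      rw [primesOf_cons, primesOf_cons, primesOf_cons, hR]
    refine (Connected.of_common hφ ih (u := u) (by simp) (by simp) h1.symm hn).trans ?_
    refine Connected.of_add_le hφ ih (u := w) (v := v₁) (by simp) (by simp) (h1.trans h)
      (h1 ▸ hn) ?_
    rw [h1, primesOf_cons, hv₁e, hS', hQ]
    calc atomMultiset φ w + (S₁ + T₁) ≤ Q + (S₁ + T₁) + S' :=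
          (add_le_add hWQ le_rfl).trans (Multiset.le_add_right _ _)
      _ = _ := by abel
  -- The disjoint parts `T₂` and `T₃` of `Q` have at least `|y|` elements each, so `2|y| ≤ |Q| ≤ D -
  -- 1` with `|y| = |z| - 1`.
  have := hD.card_lt hzsf
  rw [Multiset.card_map] at this
  rw [Multiset.card_cons]
  omega

end Induction

/-- Factorizations of length at least 3 are connected by induction, or both have length at most `(D
+ 1) / 2 ≤ N`. One of length 2 is first joined to a factorization of the least length `m ≥ 3`; this
`m` is a daleth value, so `m ≤ N`. -/
theorem IsDivisorHom.connected (hφ : IsDivisorHom φ) {D : ℕ} (hD : LengthBound (ClassGroup φ) D)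
    (h2 : 2 ≤ N) (hDN : D + 1 ≤ 2 * N) (hN : ∀ m, IsDalethValue (ClassGroup φ) m → m ≤ N) :
    ∀ (n : ℕ) (z z' : FactorizationMonoid H), primesOf φ z = primesOf φ z' →
      (primesOf φ z).card = n → Connected φ N z z' := by
  intro n
  induction n using Nat.strong_induction_on with
  | _ n ih =>
  have ih' : ∀ y y' : FactorizationMonoid H, primesOf φ y = primesOf φ y' →
      (primesOf φ y).card < n → Connected φ N y y' := fun y y' h hn => ih _ hn y y' h rfl
  -- factorizations of length at least three
  have hlong : ∀ z z' : FactorizationMonoid H, 3 ≤ z.card → 3 ≤ z'.card →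
      primesOf φ z = primesOf φ z' → (primesOf φ z).card = n → Connected φ N z z' := by
    intro z z' h3 h3' h hn
    rcases Connected.of_lengthBound hφ ih' hD h hn.le (by rintro rfl; simp at h3) h3' with hc | hc
    · exact hc
    rcases Connected.of_lengthBound hφ ih' hD h.symm (h ▸ hn.le) (by rintro rfl; simp at h3') h3 with
      hc' | hc'
    · exact hc'.symm
    exact Connected.of_card_le h (by omega) (by omega)
  -- every factorization is connected to a factorization of length at most `N`
  have hshort : ∀ z z' : FactorizationMonoid H, z.card ≤ 2 → 3 ≤ z'.card →
      primesOf φ z = primesOf φ z' → (primesOf φ z).card = n → Connected φ N z z' := by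
    intro z z' hz h3' h hn
    have hz2 : z.card = 2 := by
      by_contra hne
      have f1 := hφ.hasFactorization z
      have f2 := hφ.hasFactorization z'
      rw [← primesOf] at f1 f2
      rw [← h] at f2
      have : z.card = 0 ∨ z.card = 1 := by omega
      rcases this with h0 | h0
      · rw [Multiset.card_eq_zero.1 h0] at h
        obtain ⟨v, hv⟩ := Multiset.card_pos_iff_exists_mem.1 (show 0 < z'.card by omega)
        obtain ⟨z₁, rfl⟩ := Multiset.exists_cons_of_mem hv
        rw [primesOf_cons] at h
        exact hφ.atomMultiset_ne_zero v (add_eq_zero.1 h.symm).1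
      · obtain ⟨u, rfl⟩ := Multiset.card_eq_one.1 h0
        have hm : IsMinimalZeroSum ((primesOf φ {u}).map (classOf φ)) := by
          simpa [primesOf] using hφ.isMinimalZeroSum_atom u
        have := f2.eq_one hm
        omega
    obtain ⟨u, v, rfl⟩ := Multiset.card_eq_two.1 hz2
    have hu := hφ.isMinimalZeroSum_atom u
    have hv := hφ.isMinimalZeroSum_atom v
    set U := (atomMultiset φ u).map (classOf φ)
    set V := (atomMultiset φ v).map (classOf φ)
    have hprimes : (primesOf φ ({u, v} : FactorizationMonoid H)).map (classOf φ) = U + V := by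
      rw [primesOf]; simp [U, V]
    have hex : ∃ m, 3 ≤ m ∧ HasFactorization (U + V) m :=
      ⟨z'.card, h3', by
        have := hφ.hasFactorization z'
        rwa [← primesOf, ← h, hprimes] at this⟩
    classical
    obtain ⟨hm3, hm⟩ := Nat.find_spec hex
    have hmin := fun {k} hk => Nat.find_min' hex (m := k) hk
    set m := Nat.find hex
    have hval : IsDalethValue (ClassGroup φ) m := by
      refine ⟨U, V.map Neg.neg, hu, hv.map_neg, hm.pairFactorization _ _ (by rw [map_neg_map_neg]),
        hm3, fun k hk => ?_⟩
      have hk' := hk.hasFactorization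
      rw [map_neg_map_neg] at hk'
      by_cases hk3 : 3 ≤ k
      · exact Or.inr (hmin ⟨hk3, hk'⟩)
      left
      by_contra hk2
      have : k = 0 ∨ k = 1 := by omega
      rcases this with rfl | rfl
      · exact hu.1 (add_eq_zero.1 hk'.eq_zero).1
      · have hUV : IsMinimalZeroSum (U + V) := by
          generalize U + V = S at hk'
          cases hk' with
          | @cons W S' _ hW h0 => rw [h0.eq_zero, add_zero]; exact hW
        have h22 := hu.hasFactorization_two hv.map_neg
        rw [map_neg_map_neg] at h22
        have := h22.eq_one hUV
        omega
    obtain ⟨z'', hz'', hc''⟩ := hφ.exists_factorization hm hprimes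
    have hz'' : primesOf φ z'' = primesOf φ ({u, v} : FactorizationMonoid H) := hz''
    have hmN := hN m hval
    refine (Connected.of_card_le hz''.symm (by simpa using h2) (by omega)).trans
      (hlong z'' z' (by omega) h3' (hz''.trans h) (by rw [hz'', hn]))
  intro z z' h hn
  by_cases h3 : 3 ≤ z.card <;> by_cases h3' : 3 ≤ z'.card
  · exact hlong z z' h3 h3' h hn
  · exact (hshort z' z (by omega) h3 h.symm (h ▸ hn)).symm
  · exact hshort z z' (by omega) h3' h hn
  · exact Connected.of_card_le h (by omega) (by omega)

theorem IsDivisorHom.catenaryDegree_le (hφ : IsDivisorHom φ) {D : ℕ}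
    (hD : LengthBound (ClassGroup φ) D) (h2 : 2 ≤ N) (hDN : D + 1 ≤ 2 * N)
    (hN : ∀ m, IsDalethValue (ClassGroup φ) m → m ≤ N) : catenaryDegree H ≤ N := by
  refine iSup_le fun a => sInf_le fun z hz z' hz' => ?_
  rw [hφ.mem_factorizations_iff] at hz hz'
  obtain ⟨k, c, h0, hk, h1, h3⟩ := (hφ.connected hD h2 hDN hN _ z z' (hz.trans hz'.symm)
    rfl).exists_chain
  refine ⟨k, c, h0, hk, fun i hi => ?_, fun i hi => by exact_mod_cast h3 i hi⟩
  rw [hφ.mem_factorizations_iff]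
  exact (h1 i hi).trans hz

/-- A chain from a factorization of length 2 to one of length `m` has a step from length 2 to length
at least `m`. The two share no atom, since otherwise the other atom of the short one would be a
product of several. So this step has distance at least `m`. -/
theorem IsDivisorHom.le_catenaryDegree (hφ : IsDivisorHom φ) (hp : EveryClassContainsPrime φ)
    {m : ℕ} (hm : IsDalethValue (ClassGroup φ) m) : (m : ℕ∞) ≤ catenaryDegree H := by
  classical
  obtain ⟨U, V, hU, hV, hUV, h3, hg⟩ := hm
  obtain ⟨M, hM⟩ := exists_map_classOf_eq hp (U + V.map Neg.neg)
  obtain ⟨a, ha⟩ := hφ.exists_primeMultiset_eq (M := M) (by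
    rw [hM]; exact hUV.hasFactorization.sum_eq)
  refine le_trans ?_ (le_iSup catenaryDegreeAt a)
  refine le_sInf fun K hK => ?_
  obtain ⟨z, hz, hz2⟩ := hφ.exists_factorization (hU.hasFactorization_two hV) hM
  obtain ⟨z', hz', hzm⟩ := hφ.exists_factorization hUV.hasFactorization hM
  rw [← ha, ← hφ.mem_factorizations_iff] at hz hz'
  obtain ⟨k, c, h0, hk, h1, h2⟩ := hK z hz z' hz'
  have hlen : ∀ i ≤ k, (c i).card = 2 ∨ m ≤ (c i).card := by
    intro i hi
    have := hφ.hasFactorization (c i)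
    rw [hφ.mem_factorizations_iff.1 (h1 i hi), ha, hM] at this
    exact hg _ (this.pairFactorization _ _ rfl)
  have hex : ∃ i < k, (c i).card = 2 ∧ m ≤ (c (i + 1)).card := by
    by_contra! hno
    have : ∀ i ≤ k, (c i).card = 2 := by
      intro i
      induction i with
      | zero => intro _; rw [h0, hz2]
      | succ i ih =>
        intro hi
        exact (hlen (i + 1) hi).resolve_right (not_le.2 (hno i (by omega) (ih (by omega))))
    have := this k le_rfl
    rw [hk, hzm] at this
    omega
  obtain ⟨i, hi, hi2, him⟩ := hex
  refine le_trans ?_ (h2 i hi)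
  have h4 := hφ.mem_factorizations_iff.1 (h1 i hi.le)
  have h5 := hφ.mem_factorizations_iff.1 (h1 (i + 1) hi)
  generalize c i = x at *
  generalize c (i + 1) = y at *
  have hxy : x ∩ y = 0 := by
    rcases inter_eq_zero_or_exists_mem x y with h | ⟨u, hu, hu'⟩
    · exact h
    exfalso
    obtain ⟨x, rfl⟩ := Multiset.exists_cons_of_mem hu
    obtain ⟨y, rfl⟩ := Multiset.exists_cons_of_mem hu'
    obtain ⟨v, rfl⟩ := Multiset.card_eq_one.1 (show x.card = 1 by simpa using hi2)
    have h6 : atomMultiset φ v = (y.map (atomMultiset φ)).sum := by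
      have := h4.trans h5.symm
      simp only [Multiset.map_cons, Multiset.sum_cons, Multiset.map_singleton,
        Multiset.sum_singleton] at this
      exact add_left_cancel this
    have h7 := hφ.hasFactorization y
    rw [← h6] at h7
    have := h7.eq_one (hφ.isMinimalZeroSum_atom v)
    rw [Multiset.card_cons] at him
    omega
  have h6 : y.card ≤ factorizationDist x y := by
    rw [factorizationDist]
    refine le_trans ?_ (le_max_right _ _)
    convert le_refl y.card using 2
    ext w
    have := congrArg (Multiset.count w) hxy
    rw [Multiset.count_inter, Multiset.count_zero] at this
    rw [Multiset.count_sub, Multiset.count_inter]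
    omega
  exact_mod_cast him.trans h6

end Catenary

/-! ### Comparison of the three conditions. -/

section Equivalence

variable {G : Type*} [AddCommGroup G] {D m : ℕ}

theorem IsDalethValue.le (h : IsDalethValue G m) (hD : LengthBound G D) : m ≤ D := by
  obtain ⟨U, V, hU, hV, hUV, h3, -⟩ := h
  exact (hUV.le_card hU hV h3).trans (hD U hU)

theorem AlmostDissociated.isDalethValue {U : Multiset G} (h : AlmostDissociated U)
    (hU : IsMinimalZeroSum U) (h3 : 3 ≤ U.card) : IsDalethValue G U.card :=
  ⟨U, U, hU, hU, pairFactorization_self U fun _ hx h0 =>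
    (hU.noShortZeroSum h3).zero_notMem (h0 ▸ hx), h3, h.lengthGap⟩

theorem isDalethValue_of_cyclic_or_elementary [Finite G] (h3 : 3 ≤ D) (hD : LengthBound G D)
    {U : Multiset G} (hU : IsMinimalZeroSum U) (hc : U.card = D)
    (h : (∃ g : G, ∀ x : G, ∃ k : ℤ, x = k • g) ∨ ∀ x : G, x + x = 0) : IsDalethValue G D := by
  rcases h with h | h
  · obtain ⟨W, hW, hWd, rfl⟩ := exists_almostDissociated_of_cyclic hD hU hc h
    exact hWd.isDalethValue hW h3
  · subst hc
    exact (almostDissociated_of_elementary hU h3 h).isDalethValue hU h3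

theorem IsDalethValue.cyclic_or_elementary (h : IsDalethValue G D) (h3 : 3 ≤ D)
    (hD : LengthBound G D) :
    (∃ g : G, ∀ x : G, ∃ k : ℤ, x = k • g) ∨ ∀ x : G, x + x = 0 := by
  obtain ⟨U, V, hU, hV, hUV, -, hg⟩ := h
  exact hg.cyclic_or_elementary h3 hD hU hV hUV le_rfl

/-- Excluding the value `D` excludes cyclic groups and elementary 2-groups, hence also `D ≤ 4`.
Conversely, the model sequence has length at least `D - 1`, and length `D` would make `D` a daleth
value. -/
theorem isDalethValue_sub_one_iff [Finite G] (h3 : 3 ≤ D) (hD : LengthBound G D)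
    {S : Multiset G} (hS : IsMinimalZeroSum S) (hSc : S.card = D) :
    ¬ IsDalethValue G D ∧ IsDalethValue G (D - 1) ↔
      (∃ r : ℕ, 2 ≤ r ∧ Nonempty (G ≃+ (Fin (r - 1) → ZMod 2) × ZMod 4)) ∨
        ∃ n : ℕ, 2 ≤ n ∧ Nonempty (G ≃+ ZMod 2 × ZMod (2 * n)) := by
  constructor
  · rintro ⟨hno, U, V, hU, hV, hUV, -, hg⟩
    have hne : ¬ ((∃ g : G, ∀ x : G, ∃ k : ℤ, x = k • g) ∨ ∀ x : G, x + x = 0) := fun h =>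
      hno (isDalethValue_of_cyclic_or_elementary h3 hD hS hSc h)
    have h5 : 5 ≤ D := by
      by_contra h5
      exact hne (cyclic_or_elementary_of_le_four hD (by omega))
    rw [not_or] at hne
    exact (hg.doublingLeTwo_or_cyclicByTwo h5 hD hU hV hUV (by omega)).imp
      (fun h => h.exists_equiv hne.1 hne.2) (fun h => h.exists_equiv hne.1 hne.2)
  · intro h
    obtain ⟨hc, he, D', U, hD', hUd, hU, hDU, hU3⟩ := exists_almostDissociated_of_iso h
    have hno : ¬ IsDalethValue G D := fun h => (h.cyclic_or_elementary h3 hD).elim hc he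
    refine ⟨hno, ?_⟩
    have hval := hUd.isDalethValue hU hU3
    have h1 := hval.le hD
    have h2 := hD' S hS
    have h4 : U.card ≠ D := fun h => hno (h ▸ hval)
    rwa [show U.card = D - 1 by omega] at hval

theorem sSup_eq_sub_one_iff {p : ℕ → Prop} (h2 : 2 ≤ D) (hp : ∀ m, p m → m ≤ D) :
    sSup {x : ℕ∞ | ∃ m : ℕ, p m ∧ x = m} = ((D - 1 : ℕ) : ℕ∞) ↔ ¬ p D ∧ p (D - 1) := by
  constructor
  · intro h
    have hle : ∀ m, p m → m ≤ D - 1 := fun m hm => by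
      have : (m : ℕ∞) ≤ ((D - 1 : ℕ) : ℕ∞) := h ▸ le_sSup ⟨m, hm, rfl⟩
      exact_mod_cast this
    refine ⟨fun hpD => by have := hle D hpD; omega, ?_⟩
    by_contra hno
    have : sSup {x : ℕ∞ | ∃ m : ℕ, p m ∧ x = m} ≤ ((D - 2 : ℕ) : ℕ∞) := by
      refine sSup_le ?_
      rintro _ ⟨m, hm, rfl⟩
      have h1 := hle m hm
      have h3 : m ≠ D - 1 := fun h => hno (h ▸ hm)
      exact_mod_cast (show m ≤ D - 2 by omega)
    rw [h] at this
    have : D - 1 ≤ D - 2 := by exact_mod_cast this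
    omega
  · rintro ⟨hno, hyes⟩
    refine le_antisymm (sSup_le ?_) (le_sSup ⟨_, hyes, rfl⟩)
    rintro _ ⟨m, hm, rfl⟩
    have h1 := hp m hm
    have h3 : m ≠ D := fun h => hno (h ▸ hm)
    exact_mod_cast (show m ≤ D - 1 by omega)

theorem IsDivisorHom.catenaryDegree_eq_sub_one_iff {H P : Type*} [CancelCommMonoid H]
    {φ : H →* Multiplicative (P →₀ ℕ)} (hφ : IsDivisorHom φ) (hp : EveryClassContainsPrime φ)
    [Finite (ClassGroup φ)] (h3 : 3 ≤ D) (hD : LengthBound (ClassGroup φ) D)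
    {S : Multiset (ClassGroup φ)} (hS : IsMinimalZeroSum S) (hSc : S.card = D) :
    catenaryDegree H = ((D - 1 : ℕ) : ℕ∞) ↔
      ¬ IsDalethValue (ClassGroup φ) D ∧ IsDalethValue (ClassGroup φ) (D - 1) := by
  have h5 (hno : ¬ IsDalethValue (ClassGroup φ) D) : 5 ≤ D := by
    by_contra h5
    exact hno (isDalethValue_of_cyclic_or_elementary h3 hD hS hSc
      (cyclic_or_elementary_of_le_four hD (by omega)))
  constructor
  · intro h
    have hle : ∀ m, IsDalethValue (ClassGroup φ) m → m ≤ D - 1 := fun m hm => by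
      have := hφ.le_catenaryDegree hp hm
      rw [h] at this
      exact_mod_cast this
    have hno : ¬ IsDalethValue (ClassGroup φ) D := fun hm => by have := hle D hm; omega
    have h5 := h5 hno
    refine ⟨hno, ?_⟩
    by_contra hno'
    -- The condition `D + 1 ≤ 2(D - 2)` is exactly `D ≥ 5`.
    have := hφ.catenaryDegree_le hD (N := D - 2) (by omega) (by omega) fun m hm => by
      have h1 := hle m hm
      have h3 : m ≠ D - 1 := fun h => hno' (h ▸ hm)
      omega
    rw [h] at this
    have : D - 1 ≤ D - 2 := by exact_mod_cast this
    omega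
  · rintro ⟨hno, hyes⟩
    have h5 := h5 hno
    refine le_antisymm (hφ.catenaryDegree_le hD (by omega) (by omega) fun m hm => ?_)
      (hφ.le_catenaryDegree hp hyes)
    have h1 := hm.le hD
    have h3 : m ≠ D := fun h => hno (h ▸ hm)
    omega

end Equivalence

end KrullMonoid

theorem theorem1p1 {H P : Type*} [CancelCommMonoid H] (φ : H →* Multiplicative (P →₀ ℕ))
    (hφ : KrullMonoid.IsDivisorTheory φ)
    (hfin : Finite (KrullMonoid.ClassGroup φ))
    (hcard : 3 ≤ Nat.card (KrullMonoid.ClassGroup φ))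
    (hprime : KrullMonoid.EveryClassContainsPrime φ) :
    List.TFAE [
      KrullMonoid.catenaryDegree H = KrullMonoid.davenportConstant (KrullMonoid.ClassGroup φ) - 1,
      KrullMonoid.daleth H = KrullMonoid.davenportConstant (KrullMonoid.ClassGroup φ) - 1,
      (∃ r : ℕ, 2 ≤ r ∧
          Nonempty (KrullMonoid.ClassGroup φ ≃+ (Fin (r - 1) → ZMod 2) × ZMod 4)) ∨
        ∃ n : ℕ, 2 ≤ n ∧ Nonempty (KrullMonoid.ClassGroup φ ≃+ ZMod 2 × ZMod (2 * n))] := by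
  obtain ⟨D, hDeq, hD, S, hS, hSc⟩ :=
    KrullMonoid.exists_davenportConstant_eq (KrullMonoid.ClassGroup φ)
  have h3 := KrullMonoid.three_le_of_lengthBound hD hcard
  have hcast : KrullMonoid.davenportConstant (KrullMonoid.ClassGroup φ) - 1 =
      ((D - 1 : ℕ) : ℕ∞) := by
    rw [hDeq]; push_cast; rfl
  rw [hcast, ← KrullMonoid.isDalethValue_sub_one_iff h3 hD hS hSc,
    hφ.isDivisorHom.catenaryDegree_eq_sub_one_iff hprime h3 hD hS hSc,
    hφ.isDivisorHom.daleth_eq hprime,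
    KrullMonoid.sSup_eq_sub_one_iff (by omega) fun m hm => hm.le hD]
  tfae_finish
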